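/- Let $\Omega\subset\mathbb C^n$ be open and let $X\subset\Omega$ be an analytic subset of pure dimension $m$. Let $\Delta=\Delta_z\times\Delta_w$ be a Weierstrass polydisc for $X$: a polydisc in coordinates $z\times w$ obtained from the standard ones by a linear unitary transformation, with $\dim\Delta_z=m$, $\bar\Delta\subset\Omega$ and $X\cap(\bar\Delta_z\times\partial\Delta_w)=\emptyset$. Then $X\cap\Delta\to\Delta_z$ is a proper ramified covering; let $e=e(X,\Delta)$ be its degree (number of sheets), and put $E=e^{\,n-m}$ (with $0^0=1$). Let $\Delta^2$ be the polydisc with the same centre as $\Delta$ and half its radii. Let $\Phi:\Delta\to\mathbb C^{m+1}$ be holomorphic and bounded, and let $\|\Phi\|_\Delta$ be the supremum over $\Delta$ of the largest absolute value of its components. For a vector $y$ of algebraic numbers let $h(y)$ be the maximum of the absolute logarithmic Weil heights of its coordinates. For a nonzero integer polynomial $P$ let $h(P)$ be the logarithm of the largest absolute value of its coefficients. Write $\log^+t=\log\max(1,t)$. For an integer $g\ge1$ and a real $h\ge0$ let $$[\Delta^2\cap X](g,h;\Phi)=\{p\in\Delta^2\cap X:\ \Phi(p)\in(\mathbb Q^{\mathrm{alg}})^{m+1},\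 [\mathbb Q(\Phi(p)):\mathbb Q]\le g,\ h(\Phi(p))\le h\}.$$ Put $S=gh+\log^+\|\Phi\|_\Delta$ and assume $S\ge 1+\log g$ (this is automatic if $h\ge1$). **Proposition.** There is a polynomial $P\in\mathbb Z[y_1,\dots,y_{m+1}]\setminus\{0\}$ such that $P\circ\Phi$ vanishes on $[\Delta^2\cap X](g,h;\Phi)$ and $$\deg P\sim g\,E\,S^{m},\qquad h(P)\sim E\,S^{m+1}.$$ Here $A\sim B$ means $K^{-1}B\le A\le KB$, where $K>0$ is a constant that depends only on $n$. -/

import Mathlib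

open Polynomial in
/-- The minimal polynomial over `ℤ` of an algebraic number `x`: the primitive integer multiple of
its monic minimal polynomial over `ℚ` (determined up to sign). -/
noncomputable def intMinpoly (x : ℂ) : ℤ[X] :=
  (IsLocalization.integerNormalization (nonZeroDivisors ℤ) (minpoly ℚ x)).primPart

/-- The absolute logarithmic Weil height of an algebraic number `x`: if
`a₀ ∏ (X - xᵢ)`, `1 ≤ i ≤ d`, is the minimal polynomial of `x` over `ℤ`, this is
`(log |a₀| + ∑ log⁺ |xᵢ|) / d`. -/
noncomputable def weilHeight (x : ℂ) : ℝ :=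
  (Real.log |((intMinpoly x).leadingCoeff : ℝ)|
      + (((intMinpoly x).map (Int.castRingHom ℂ)).roots.map fun t => Real.posLog ‖t‖).sum)
    / ((intMinpoly x).natDegree : ℝ)

/-- The height of a vector of algebraic numbers: the maximal height of its coordinates. -/
noncomputable def vectorHeight {l : ℕ} (y : Fin l → ℂ) : ℝ :=
  ⨆ i, weilHeight (y i)

/-- The degree `[ℚ(y) : ℚ]` of the field generated by the coordinates of `y`
(meaningful when these are algebraic). -/
noncomputable def fieldDegree {l : ℕ} (y : Fin l → ℂ) : ℕ :=
  Module.finrank ℚ (IntermediateField.adjoin ℚ (Set.range y))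

/-- The set `A(g, h; Φ)` of the points of `A` at which `Φ` takes an algebraic value of degree at
most `g` and height at most `h`. -/
def algebraicPoints {α : Type*} {l : ℕ} (A : Set α) (g : ℕ) (h : ℝ) (Φ : α → Fin l → ℂ) : Set α :=
  {p | p ∈ A ∧ (∀ i, IsAlgebraic ℚ (Φ p i)) ∧ fieldDegree (Φ p) ≤ g ∧ vectorHeight (Φ p) ≤ h}

/-- The logarithmic height of an integer polynomial: the logarithm of the largest absolute value
of its coefficients. -/
noncomputable def polyHeight {l : ℕ} (P : MvPolynomial (Fin l) ℤ) : ℝ :=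
  Real.log ((P.support.sup fun s => (P.coeff s).natAbs : ℕ) : ℝ)

/-- `X` is an analytic subset of the open set `Ω ⊆ ℂⁿ`: near every point of `Ω` it is the common
zero set of finitely many holomorphic functions. -/
def IsAnalyticSubset {n : ℕ} (Ω X : Set (EuclideanSpace ℂ (Fin n))) : Prop :=
  X ⊆ Ω ∧ ∀ p ∈ Ω, ∃ U : Set (EuclideanSpace ℂ (Fin n)), IsOpen U ∧ p ∈ U ∧ U ⊆ Ω ∧
    ∃ (r : ℕ) (f : EuclideanSpace ℂ (Fin n) → Fin r → ℂ),
      DifferentiableOn ℂ f U ∧ X ∩ U = {x | x ∈ U ∧ f x = 0}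

/-- The regular points of dimension `d` of `X ⊆ ℂⁿ`: the points of `X` near which `X` is a complex
submanifold of dimension `d`, that is, the zero set of a holomorphic submersion to `ℂⁿ⁻ᵈ`. -/
def regularPoints {n : ℕ} (X : Set (EuclideanSpace ℂ (Fin n))) (d : ℕ) :
    Set (EuclideanSpace ℂ (Fin n)) :=
  {q | q ∈ X ∧ ∃ U : Set (EuclideanSpace ℂ (Fin n)), IsOpen U ∧ q ∈ U ∧
    ∃ c : ℕ, d + c = n ∧ ∃ f : EuclideanSpace ℂ (Fin n) → Fin c → ℂ,
      DifferentiableOn ℂ f U ∧ (∀ x ∈ U, Function.Surjective (fderiv ℂ f x)) ∧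
        X ∩ U = {x | x ∈ U ∧ f x = 0}}

/-- The analytic set `X` has dimension `d` at `p`: `d` is the largest dimension of regular points
of `X` arbitrarily close to `p`. -/
def HasDimensionAt {n : ℕ} (X : Set (EuclideanSpace ℂ (Fin n))) (p : EuclideanSpace ℂ (Fin n))
    (d : ℕ) : Prop :=
  IsGreatest {d' | p ∈ closure (regularPoints X d')} d

/-- `X` has pure dimension `m`: it has dimension `m` at each of its points. -/
def IsPureDimensional {n : ℕ} (X : Set (EuclideanSpace ℂ (Fin n))) (m : ℕ) : Prop :=
  ∀ p ∈ X, HasDimensionAt X p m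

/-- A polydisc `Δ = Δ_z × Δ_w` in `ℂⁿ` in unitary coordinates `z × w`, where `z` has `m` and `w`
has `k` components (the index `Sum.inl i` stands for `zᵢ`, the index `Sum.inr j` for `wⱼ`).
The unitary isomorphism forces `n = m + k`. -/
structure UnitaryPolydisc (n m k : ℕ) where
  /-- the unitary coordinates -/
  coord : EuclideanSpace ℂ (Fin n) ≃ₗᵢ[ℂ] EuclideanSpace ℂ (Fin m ⊕ Fin k)
  /-- the centre, in these coordinates -/
  center : Fin m ⊕ Fin k → ℂ
  /-- the radii -/
  radius : Fin m ⊕ Fin k → ℝ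
  radius_pos : ∀ i, 0 < radius i

namespace UnitaryPolydisc

/-- The polydisc `Δ^δ`: the same centre, every radius `r` replaced by `δ⁻¹ r`. -/
def pow {n m k : ℕ} (Δ : UnitaryPolydisc n m k) (δ : ℝ) : Set (EuclideanSpace ℂ (Fin n)) :=
  {x | ∀ i, ‖Δ.coord x i - Δ.center i‖ < δ⁻¹ * Δ.radius i}

/-- The open polydisc `Δ` itself. -/
def toSet {n m k : ℕ} (Δ : UnitaryPolydisc n m k) : Set (EuclideanSpace ℂ (Fin n)) :=
  {x | ∀ i, ‖Δ.coord x i - Δ.center i‖ < Δ.radius i}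

/-- The closed polydisc. -/
def closedSet {n m k : ℕ} (Δ : UnitaryPolydisc n m k) : Set (EuclideanSpace ℂ (Fin n)) :=
  {x | ∀ i, ‖Δ.coord x i - Δ.center i‖ ≤ Δ.radius i}

/-- The product of the closed polydisc `Δ_z` and the topological boundary of `Δ_w`. -/
def wall {n m k : ℕ} (Δ : UnitaryPolydisc n m k) : Set (EuclideanSpace ℂ (Fin n)) :=
  {x | x ∈ Δ.closedSet ∧
    ∃ j : Fin k, ‖Δ.coord x (Sum.inr j) - Δ.center (Sum.inr j)‖ = Δ.radius (Sum.inr j)}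

/-- The open polydisc `Δ_z`. -/
def base {n m k : ℕ} (Δ : UnitaryPolydisc n m k) : Set (Fin m → ℂ) :=
  {z | ∀ i, ‖z i - Δ.center (Sum.inl i)‖ < Δ.radius (Sum.inl i)}

/-- The fibre over `z` of the projection `X ∩ Δ → Δ_z`. -/
def fiber {n m k : ℕ} (Δ : UnitaryPolydisc n m k) (X : Set (EuclideanSpace ℂ (Fin n)))
    (z : Fin m → ℂ) : Set (EuclideanSpace ℂ (Fin n)) :=
  {x | x ∈ X ∩ Δ.toSet ∧ ∀ i, Δ.coord x (Sum.inl i) = z i}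

/-- `Δ` is a Weierstrass polydisc for the analytic subset `X` of `Ω`, of pure dimension `m`. -/
structure IsWeierstrass {n m k : ℕ} (Δ : UnitaryPolydisc n m k)
    (Ω X : Set (EuclideanSpace ℂ (Fin n))) : Prop where
  isOpen : IsOpen Ω
  isAnalytic : IsAnalyticSubset Ω X
  isPure : IsPureDimensional X m
  closedSet_subset : Δ.closedSet ⊆ Ω
  inter_wall : X ∩ Δ.wall = ∅

/-- The degree `e(X, Δ)` of the ramified covering `X ∩ Δ → Δ_z` of a Weierstrass polydisc: its
number of sheets, which is the largest number of points of a fibre (a fibre outside the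
ramification locus has exactly this many points, all other fibres have fewer). -/
noncomputable def degree {n m k : ℕ} (Δ : UnitaryPolydisc n m k)
    (X : Set (EuclideanSpace ℂ (Fin n))) : ℕ :=
  ⨆ z : Δ.base, (Δ.fiber X z).ncard

end UnitaryPolydisc

/-- The supremum norm of a vector-valued function over the set `S`. -/
noncomputable def supNorm {α : Type*} {l : ℕ} (S : Set α) (Φ : α → Fin l → ℂ) : ℝ :=
  ⨆ x : S, ‖Φ x‖

/-!
The degree and the height asked for reflect one fact: on `X ∩ Δ²`, bounded holomorphic functions are
approximated, up to an error exponentially small in `N`, by combinations of only about `E * N ^ m`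
monomials, although `Δ` has dimension `n`. The rest is the method of the auxiliary polynomial.

*Approximation.* In coordinates in which `Δ` is the unit polydisc, a bounded holomorphic function
has a Taylor expansion in `w` with coefficients holomorphic in `z` (`exists_taylor`). On `X` each
power `wⱼ ^ q` is a combination of `1, wⱼ, …, wⱼ ^ (e - 1)`: off the ramification locus its
coefficients are those of the remainder of `T ^ q` modulo `∏ (T - wⱼ(p))`, where `p` runs through
the fibre. They are bounded by `3 ^ q`, since the roots lie in the unit disc, and hence extend to
holomorphic functions on the whole of `Δ_z` (`IsProperOver.exists_power_reduction`). After this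
reduction only the `e ^ (n - m)` monomials in `w` with exponents below `e` remain, and an expansion
of their coefficients in `z`, long enough to make up for the factor `3 ^ q`, leaves `E * N' ^ m`
monomials (`exists_monomial_approximation`).

*Auxiliary polynomial.* There are more integer polynomials of degree `D` in each of the `m + 1`
variables, with coefficients at most `H`, than boxes for the coefficients of these monomials as soon
as `D ^ (m + 1) * log H` exceeds a constant times `E * N' ^ m * N'`. The box principle then gives a
nonzero `P` for which `P ∘ Φ` is tiny on `X ∩ Δ²` (`exists_int_polynomial_small`). With `D` a large
multiple of `g * E * S ^ m`, with `log H` one of `E * S ^ (m + 1)`, and with `N'` of the order of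
`g * log H` (`exists_parameters`), the value of `P` at a vector of algebraic numbers of degree at most
`g` and height at most `h` is smaller than Liouville's inequality permits for a nonzero value
(`one_le_norm_mul_of_ne_zero`), so it vanishes. The factor `2 ^ b * y₀ ^ a` raises the degree and
the height to the required order (`exists_padding`). A covering without sheets has no points, and
`P = 1` serves.

*Local theory of analytic sets.* The zeros of `f (y, ·)` in a disc depend on the parameter `y`
through symmetric functions that are holomorphic, by the logarithmic residue formula
(`exists_zero_functions`). Norms of suitable combinations of the defining functions then show that
the projection of an analytic set along a variable, if proper, is analytic (`disc_projection`); by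
iteration each coordinate `wⱼ` of the points of `X ∩ Δ` is one of finitely many local root functions
with holomorphic power sums (`IsProperOver.image_coord`). The number of distinct roots is maximal
where a Hankel determinant of the power sums does not vanish, and there the roots are separately
holomorphic (`IsProperOver.exists_discriminant`). Together with Riemann's extension theorem
(`exists_differentiableOn_extension`) this is all of the theory of ramified coverings that is
needed. That `X` has pure dimension `m` enters through `nonempty_interior_image_of_submersion`: no
part of `X ∩ Δ` lies over a subset of `Δ_z` without interior, so relations that hold over the
complement of the ramification locus hold on all of `X ∩ Δ`.
-/

open Set Filter Topology Metric

/-! ### Holomorphic functions on normed spaces -/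

section HolomorphicBasics

theorem eventually_forall_mem_of_isCompact {E F : Type*} [TopologicalSpace E]
    [TopologicalSpace F] {W : Set (E × F)} {K : Set F} {y₀ : E} (hW : IsOpen W)
    (hK : IsCompact K) (h : ∀ t ∈ K, (y₀, t) ∈ W) : ∀ᶠ y in 𝓝 y₀, ∀ t ∈ K, (y, t) ∈ W := by
  obtain ⟨u, v, hu, -, hyu, hsv, huv⟩ := generalized_tube_lemma (isCompact_singleton (x := y₀))
    hK hW (by
      rintro ⟨y, t⟩ ⟨hy, ht⟩
      obtain rfl : y = y₀ := hy
      exact h t ht)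
  filter_upwards [hu.mem_nhds (hyu rfl)] with y hy t ht using huv (mk_mem_prod hy (hsv ht))

variable {E F : Type*} [NormedAddCommGroup E] [NormedSpace ℂ E]
  [NormedAddCommGroup F] [NormedSpace ℂ F]

/-- The Cauchy estimate for the derivative. -/
theorem norm_fderiv_le_of_bounded_ball {f : E → F} {x : E} {r M : ℝ} (hr : 0 < r)
    (hf : DifferentiableOn ℂ f (ball x r)) (hM : ∀ y ∈ ball x r, ‖f y‖ ≤ M) :
    ‖fderiv ℂ f x‖ ≤ 2 * M / r := by
  refine Complex.norm_fderiv_le_div_of_mapsTo_ball hf (fun y hy => ?_) hr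
  rw [mem_closedBall, dist_eq_norm]
  have h1 := hM y hy
  have h2 := hM x (mem_ball_self hr)
  linarith [norm_sub_le (f y) (f x)]

/-- The derivative of a holomorphic function is continuous. The Cauchy estimate makes `f` locally
Lipschitz; applied to the differences of translates of `f`, it makes `fderiv ℂ f` locally
Lipschitz. -/
theorem continuousOn_fderiv_of_differentiableOn {f : E → F} {U : Set E} (hU : IsOpen U)
    (hf : DifferentiableOn ℂ f U) : ContinuousOn (fderiv ℂ f) U := by
  intro x hx
  apply ContinuousAt.continuousWithinAt
  have hd : ∀ y ∈ U, DifferentiableAt ℂ f y := fun y hy => hf.differentiableAt (hU.mem_nhds hy)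
  have hc : ContinuousAt f x := (hd x hx).continuousAt
  obtain ⟨M, hM⟩ : ∃ M, ∀ᶠ y in 𝓝 x, ‖f y‖ ≤ M :=
    ⟨‖f x‖ + 1, (hc.norm.eventually_lt continuousAt_const (lt_add_one _)).mono fun _ h => h.le⟩
  obtain ⟨r, hr, hball⟩ := Metric.eventually_nhds_iff_ball.1 (hM.and (hU.mem_nhds hx))
  have hL : ∀ y ∈ ball x (r / 2), ‖fderiv ℂ f y‖ ≤ 2 * M / (r / 2) := fun y hy => by
    have hsub : ball y (r / 2) ⊆ ball x r := by
      apply ball_subset_ball'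
      have := mem_ball.1 hy
      linarith
    exact norm_fderiv_le_of_bounded_ball (by positivity)
      (fun z hz => (hd z (hball z (hsub hz)).2).differentiableWithinAt)
      fun z hz => (hball z (hsub hz)).1
  set L := 2 * M / (r / 2)
  have hlip : ∀ y ∈ ball x (r / 2), ∀ z ∈ ball x (r / 2), ‖f y - f z‖ ≤ L * ‖y - z‖ := by
    intro y hy z hz
    exact (convex_ball x (r / 2)).norm_image_sub_le_of_norm_fderiv_le (𝕜 := ℂ)
      (fun w hw => hd w (hball w (ball_subset_ball (by linarith) hw)).2) hL hz hy
  -- the Cauchy estimate for `v ↦ f (y + v) - f (x + v)`, which is at most `L * ‖y - x‖`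
  have key : ∀ y ∈ ball x (r / 4), ‖fderiv ℂ f y - fderiv ℂ f x‖ ≤ (8 * L / r) * ‖y - x‖ := by
    intro y hy
    have hy' := mem_ball.1 hy
    have m1 : ∀ v ∈ ball (0 : E) (r / 4), y + v ∈ ball x (r / 2) := fun v hv => by
      rw [mem_ball, dist_eq_norm] at *
      rw [sub_zero] at hv
      calc ‖y + v - x‖ = ‖(y - x) + v‖ := by congr 1; abel
        _ ≤ ‖y - x‖ + ‖v‖ := norm_add_le _ _
        _ < r / 2 := by linarith
    have m2 : ∀ v ∈ ball (0 : E) (r / 4), x + v ∈ ball x (r / 2) := fun v hv => by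
      rw [mem_ball, dist_eq_norm] at *
      rw [sub_zero] at hv
      rw [add_sub_cancel_left]
      linarith
    have D : ∀ z ∈ ball x (r / 2), DifferentiableAt ℂ f z := fun z hz =>
      hd z (hball z (ball_subset_ball (by linarith) hz)).2
    have hg : DifferentiableOn ℂ (fun v => f (y + v) - f (x + v)) (ball 0 (r / 4)) := by
      intro v hv
      apply DifferentiableAt.differentiableWithinAt
      apply DifferentiableAt.sub
      · exact DifferentiableAt.comp v (D _ (m1 v hv)) (by fun_prop)
      · exact DifferentiableAt.comp v (D _ (m2 v hv)) (by fun_prop)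
    have := norm_fderiv_le_of_bounded_ball (M := L * ‖y - x‖) (by positivity) hg (fun v hv => by
      have := hlip _ (m1 v hv) _ (m2 v hv)
      rwa [add_sub_add_right_eq_sub] at this)
    have h0 : (0 : E) ∈ ball (0 : E) (r / 4) := mem_ball_self (by positivity)
    have e1 : fderiv ℂ (fun v => f (y + v) - f (x + v)) 0 = fderiv ℂ f y - fderiv ℂ f x := by
      rw [fderiv_fun_sub, fderiv_comp_add_left, fderiv_comp_add_left, add_zero, add_zero]
      · exact DifferentiableAt.comp (0 : E) (D _ (m1 0 h0)) (by fun_prop)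
      · exact DifferentiableAt.comp (0 : E) (D _ (m2 0 h0)) (by fun_prop)
    rw [e1] at this
    refine this.trans (le_of_eq ?_)
    field_simp
    ring
  rw [ContinuousAt, tendsto_iff_norm_sub_tendsto_zero]
  refine squeeze_zero' (Eventually.of_forall fun _ => norm_nonneg _)
    (eventually_of_mem (Metric.ball_mem_nhds x (by positivity : 0 < r / 4)) key) ?_
  · have : ContinuousAt (fun y => (8 * L / r) * ‖y - x‖) x := by fun_prop
    simpa [ContinuousAt] using this

theorem contDiffAt_one_of_differentiableOn {f : E → F} {U : Set E} (hU : IsOpen U)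
    (hf : DifferentiableOn ℂ f U) {x : E} (hx : x ∈ U) : ContDiffAt ℂ 1 f x := by
  have : ContDiffOn ℂ 1 f U := by
    rw [show (1 : WithTop ℕ∞) = 0 + 1 by rfl, contDiffOn_succ_iff_fderiv_of_isOpen hU]
    exact ⟨hf, by simp, contDiffOn_zero.2 (continuousOn_fderiv_of_differentiableOn hU hf)⟩
  exact this.contDiffAt (hU.mem_nhds hx)

/-- A circle integral depending holomorphically on a parameter is holomorphic in it. -/
theorem differentiableAt_circleIntegral {f : E × ℂ → ℂ} {U : Set (E × ℂ)} (hU : IsOpen U)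
    (hf : DifferentiableOn ℂ f U) {y₀ : E} {c : ℂ} {R : ℝ} (hR : 0 ≤ R)
    (h : ∀ t ∈ sphere c R, (y₀, t) ∈ U) :
    DifferentiableAt ℂ (fun y => ∮ t in C(c, R), f (y, t)) y₀ := by
  have hfd := continuousOn_fderiv_of_differentiableOn hU hf
  have hK : IsCompact (({y₀} : Set E) ×ˢ sphere c R) :=
      isCompact_singleton.prod (isCompact_sphere c R)
  have hKU : ({y₀} : Set E) ×ˢ sphere c R ⊆ U := by
    rintro ⟨y, t⟩ ⟨hy, ht⟩
    obtain rfl : y = y₀ := hy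
    exact h t ht
  obtain ⟨C, hC⟩ := (hK.image_of_continuousOn (hfd.norm.mono hKU)).bddAbove
  have hV : IsOpen (U ∩ {p | ‖fderiv ℂ f p‖ < C + 1}) :=
    hfd.norm.isOpen_inter_preimage hU isOpen_Iio
  obtain ⟨u, v, hu, hv, hyu, hsv, huv⟩ := generalized_tube_lemma isCompact_singleton
    (isCompact_sphere c R) hV (by
      intro p hp
      exact ⟨hKU hp, lt_of_le_of_lt (hC ⟨p, hp, rfl⟩) (lt_add_one C)⟩)
  have hu' : u ∈ 𝓝 y₀ := hu.mem_nhds (hyu rfl)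
  have hin : ∀ y ∈ u, ∀ θ : ℝ, (y, circleMap c R θ) ∈ U ∧ ‖fderiv ℂ f
      (y, circleMap c R θ)‖ < C + 1 :=
    fun y hy θ => huv (mk_mem_prod hy (hsv (circleMap_mem_sphere c hR θ)))
  have hcont : ∀ y ∈ u,
      Continuous fun θ : ℝ => deriv (circleMap c R) θ • f (y, circleMap c R θ) := by
    intro y hy
    simp only [deriv_circleMap]
    refine Continuous.smul ((continuous_circleMap 0 R).mul continuous_const) ?_
    exact hf.continuousOn.comp_continuous (f := fun θ : ℝ => (y, circleMap c R θ)) (by fun_prop)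
      fun θ => (hin y hy θ).1
  have hcont' : Continuous fun θ : ℝ => deriv (circleMap c R) θ •
      (fderiv ℂ f (y₀, circleMap c R θ)).comp (ContinuousLinearMap.inl ℂ E ℂ) := by
    simp only [deriv_circleMap]
    refine Continuous.smul ((continuous_circleMap 0 R).mul continuous_const) ?_
    refine Continuous.clm_comp ?_ continuous_const
    exact hfd.comp_continuous (f := fun θ : ℝ => (y₀, circleMap c R θ)) (by fun_prop)
      fun θ => (hin y₀ (hyu rfl) θ).1
  have := intervalIntegral.hasFDerivAt_integral_of_dominated_of_fderiv_le (𝕜 := ℂ)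
    (μ := MeasureTheory.volume) (a := 0) (b := 2 * Real.pi) (x₀ := y₀) (s := u)
    (F := fun y θ => deriv (circleMap c R) θ • f (y, circleMap c R θ))
    (F' := fun y θ => deriv (circleMap c R) θ •
      (fderiv ℂ f (y, circleMap c R θ)).comp (ContinuousLinearMap.inl ℂ E ℂ))
    (bound := fun _ => |R| * (C + 1)) hu'
    (eventually_of_mem hu' fun y hy => (hcont y hy).aestronglyMeasurable)
    ((hcont y₀ (hyu rfl)).intervalIntegrable _ _)
    hcont'.aestronglyMeasurable
    (Eventually.of_forall fun θ _ y hy => by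
      rw [norm_smul]
      have h1 : ‖deriv (circleMap c R) θ‖ = |R| := by simp [deriv_circleMap]
      rw [h1]
      refine mul_le_mul_of_nonneg_left ?_ (abs_nonneg R)
      refine (ContinuousLinearMap.opNorm_comp_le _ _).trans ?_
      refine (mul_le_of_le_one_right (norm_nonneg _)
          (ContinuousLinearMap.norm_inl_le_one ℂ E ℂ)).trans
        (hin y hy θ).2.le)
    (by simp)
    (Eventually.of_forall fun θ _ y hy => by
      have h1 : HasFDerivAt f (fderiv ℂ f (y, circleMap c R θ)) (y, circleMap c R θ) :=
        (hf.differentiableAt (hU.mem_nhds (hin y hy θ).1)).hasFDerivAt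
      have h2 := HasFDerivAt.comp (f := fun x : E => (x, circleMap c R θ)) y h1
        (hasFDerivAt_prodMk_left y (circleMap c R θ))
      exact h2.const_smul (deriv (circleMap c R) θ))
  exact this.differentiableAt

/-- The directional derivatives of a holomorphic function are holomorphic. -/
theorem differentiableOn_deriv_direction {f : E → ℂ} {U : Set E} (hU : IsOpen U)
    (hf : DifferentiableOn ℂ f U) (v : E) :
    DifferentiableOn ℂ (fun x => deriv (fun s : ℂ => f (x + s • v)) 0) U := by
  intro x hx
  apply DifferentiableAt.differentiableWithinAt
  have hopen : IsOpen {p : E × ℂ | p.1 + p.2 • v ∈ U} := hU.preimage (by fun_prop)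
  obtain ⟨u, w, hu, hw, hxu, h0w, huw⟩ := generalized_tube_lemma (isCompact_singleton (x := x))
    (isCompact_singleton (x := (0 : ℂ))) hopen (by
      rintro ⟨y, t⟩ ⟨hy, ht⟩
      simp only [mem_singleton_iff] at hy ht
      simpa [hy, ht] using hx)
  obtain ⟨R, hR, hball⟩ := Metric.isOpen_iff.1 hw 0 (h0w rfl)
  have hR2 : 0 < R / 2 := by positivity
  have hcb : closedBall (0 : ℂ) (R / 2) ⊆ w := (closedBall_subset_ball (by linarith)).trans hball
  have hF : DifferentiableOn ℂ (fun p : E × ℂ => (p.2 ^ 2)⁻¹ * f (p.1 + p.2 • v))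
      ({p : E × ℂ | p.1 + p.2 • v ∈ U} ∩ {p | p.2 ≠ 0}) := by
    rintro p ⟨hp, hp0⟩
    apply DifferentiableAt.differentiableWithinAt
    have h1 : DifferentiableAt ℂ f (p.1 + p.2 • v) := hf.differentiableAt (hU.mem_nhds hp)
    have h2 : DifferentiableAt ℂ (fun p : E × ℂ => f (p.1 + p.2 • v)) p :=
      DifferentiableAt.comp p h1 (by fun_prop)
    refine DifferentiableAt.mul (DifferentiableAt.inv (by fun_prop) (pow_ne_zero 2 hp0)) h2
  have hD := differentiableAt_circleIntegral (y₀ := x) (c := 0) (R := R / 2)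
    (hopen.inter (isOpen_ne_fun continuous_snd continuous_const)) hF hR2.le (fun t ht =>
      ⟨huw (mk_mem_prod (hxu rfl) (hcb (sphere_subset_closedBall ht))), by
        rintro rfl
        simp at ht
        linarith⟩)
  refine ((hD.const_mul ((2 * Real.pi * Complex.I : ℂ)⁻¹)).congr_of_eventuallyEq ?_)
  filter_upwards [hu.mem_nhds (hxu rfl)] with y hy
  have := Complex.two_pi_I_inv_smul_circleIntegral_sub_sq_inv_smul_of_differentiable
    (U := w) (f := fun s : ℂ => f (y + s • v)) (w₀ := 0) hw hcb (fun s hs => by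
      apply DifferentiableAt.differentiableWithinAt
      have h1 : DifferentiableAt ℂ f (y + s • v) :=
        hf.differentiableAt (hU.mem_nhds (huw (mk_mem_prod hy hs)))
      exact DifferentiableAt.comp s h1 (by fun_prop)) (mem_ball_self hR2)
  rw [← this]
  simp [smul_eq_mul]

/-- The identity theorem on balls, by restriction to complex lines. -/
theorem eqOn_zero_ball_of_eventuallyEq_zero {f : E → F} [CompleteSpace F] {x p : E} {r : ℝ}
    (hf : DifferentiableOn ℂ f (ball x r)) (hp : p ∈ ball x r) (h0 : f =ᶠ[𝓝 p] 0) :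
    ∀ y ∈ ball x r, f y = 0 := by
  intro y hy
  set ℓ : ℂ → E := fun t => p + t • (y - p) with hℓ
  have hc : Continuous ℓ := by fun_prop
  have hopen : IsOpen (ℓ ⁻¹' ball x r) := isOpen_ball.preimage hc
  have hconv : Convex ℝ (ℓ ⁻¹' ball x r) := by
    intro a ha b hb s t hs ht hst
    have := convex_ball x r ha hb hs ht hst
    have e : s • ℓ a + t • ℓ b = ℓ (s • a + t • b) := by
      simp only [hℓ, smul_add, add_smul, smul_assoc]
      have hsp : s • p + t • p = p := by rw [← add_smul, hst, one_smul]
      rw [add_add_add_comm, hsp]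
    rwa [e] at this
  have hd : DifferentiableOn ℂ (f ∘ ℓ) (ℓ ⁻¹' ball x r) := hf.comp (by fun_prop) fun t ht => ht
  have han := hd.analyticOnNhd hopen
  have h00 : (0 : ℂ) ∈ ℓ ⁻¹' ball x r := by simpa [hℓ] using hp
  have h01 : (1 : ℂ) ∈ ℓ ⁻¹' ball x r := by simpa [hℓ] using hy
  have hev : f ∘ ℓ =ᶠ[𝓝 0] 0 := by
    have : Tendsto ℓ (𝓝 0) (𝓝 p) := by
      have := hc.tendsto 0
      simpa [hℓ] using this
    exact this.eventually h0
  have := han.eqOn_zero_of_preconnected_of_eventuallyEq_zero hconv.isPreconnected h00 hev h01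
  simpa [hℓ] using this

/-- The zeros of a holomorphic function `f ≢ 0` on a ball have no interior point. -/
theorem dense_ne_zero_of_ne_zero {f : E → ℂ} {x : E} {r : ℝ}
    (hf : DifferentiableOn ℂ f (ball x r)) {p : E} (hp : p ∈ ball x r) (hp0 : f p ≠ 0)
    {y : E} (hy : y ∈ ball x r) : ∃ᶠ z in 𝓝 y, f z ≠ 0 := by
  intro h
  simp only [not_not] at h
  exact hp0 (eqOn_zero_ball_of_eventuallyEq_zero hf hy h p hp)

end HolomorphicBasics

/-! ### Zeros of a holomorphic function in a disc -/

section ZerosInDisc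

theorem finite_zeros_closedBall {f : ℂ → ℂ} {c : ℂ} {R : ℝ} (hR : 0 < R)
    (hf : AnalyticOnNhd ℂ f (closedBall c R)) (h0 : ∀ t ∈ sphere c R, f t ≠ 0) :
    {t | t ∈ closedBall c R ∧ f t = 0}.Finite := by
  by_contra hinf
  obtain ⟨a, ha, hacc⟩ := Set.Infinite.exists_accPt_of_subset_isCompact (K := closedBall c R) hinf
    (isCompact_closedBall c R) fun t ht => ht.1
  have hfr : ∃ᶠ t in 𝓝[≠] a, f t = 0 := by
    have := accPt_iff_frequently_nhdsNE.1 hacc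
    exact this.mono fun t ht => ht.2
  have := hf.eqOn_zero_of_preconnected_of_frequently_eq_zero
    (convex_closedBall c R).isPreconnected ha hfr
  have hs : c + R ∈ sphere c R := by simp [abs_of_pos hR]
  exact h0 _ hs (this (sphere_subset_closedBall hs))

theorem AnalyticOnNhd.exists_isOpen_differentiableOn {f : ℂ → ℂ} {K : Set ℂ}
    (hf : AnalyticOnNhd ℂ f K) : ∃ U, IsOpen U ∧ K ⊆ U ∧ DifferentiableOn ℂ f U :=
  ⟨{x | AnalyticAt ℂ f x}, isOpen_analyticAt ℂ f, hf,
    fun _ hx => (AnalyticAt.differentiableAt hx).differentiableWithinAt⟩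

theorem circleIntegral_div_sub_of_analyticOnNhd {G : ℂ → ℂ} {a c : ℂ} {R : ℝ}
    (hG : AnalyticOnNhd ℂ G (closedBall c R)) (ha : a ∈ ball c R) :
    ∮ t in C(c, R), G t * (t - a)⁻¹ = 2 * Real.pi * Complex.I * G a := by
  have := DifferentiableOn.circleIntegral_sub_inv_smul (f := G) (c := c) (R := R)
    (fun t ht => (hG t ht).differentiableAt.differentiableWithinAt) ha
  simpa [smul_eq_mul, mul_comm] using this

/-- The logarithmic residue formula: weighted by a holomorphic `G`, the zeros of `f` in a disc,
counted with multiplicity, are summed by a contour integral of `G f' / f`. -/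
theorem exists_zeros_multiset {f : ℂ → ℂ} {c : ℂ} {R : ℝ} (hR : 0 < R)
    (hf : AnalyticOnNhd ℂ f (closedBall c R)) (h0 : ∀ t ∈ sphere c R, f t ≠ 0) :
    ∃ Z : Multiset ℂ, (∀ t, t ∈ Z ↔ t ∈ closedBall c R ∧ f t = 0) ∧
      ∀ G : ℂ → ℂ, AnalyticOnNhd ℂ G (closedBall c R) →
        ∮ t in C(c, R), G t * (deriv f t / f t) = 2 * Real.pi * Complex.I * (Z.map G).sum := by
  -- induction on the number of distinct zeros: a zero `a` of order `k` is split off by writing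
  -- `f = (t - a) ^ k * g`, which adds `k / (t - a)` to the logarithmic derivative of `g`
  suffices H : ∀ (S : Finset ℂ) (f : ℂ → ℂ), AnalyticOnNhd ℂ f (closedBall c R) →
      (∀ t ∈ sphere c R, f t ≠ 0) → (∀ t, t ∈ S ↔ t ∈ closedBall c R ∧ f t = 0) →
      ∃ Z : Multiset ℂ, (∀ t, t ∈ Z ↔ t ∈ S) ∧ ∀ G : ℂ → ℂ, AnalyticOnNhd ℂ G (closedBall c R) →
        ∮ t in C(c, R), G t * (deriv f t / f t) = 2 * Real.pi * Complex.I * (Z.map G).sum by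
    have hfin := finite_zeros_closedBall hR hf h0
    obtain ⟨Z, hZ, hZ'⟩ := H hfin.toFinset f hf h0 (by simp)
    exact ⟨Z, fun t => by rw [hZ]; simp, hZ'⟩
  intro S
  induction S using Finset.induction_on with
  | empty =>
    intro f hf _ hS
    refine ⟨0, by simp, fun G hG => ?_⟩
    have hne : ∀ t ∈ closedBall c R, f t ≠ 0 := fun t ht h => by simpa using (hS t).2 ⟨ht, h⟩
    have hd : AnalyticOnNhd ℂ (fun t => G t * (deriv f t / f t)) (closedBall c R) := fun t ht =>
      (hG t ht).mul ((hf t ht).deriv.div (hf t ht) (hne t ht))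
    obtain ⟨U, hU, hKU, hdU⟩ := hd.exists_isOpen_differentiableOn
    simpa using (hdU.diffContOnCl_ball hKU).circleIntegral_eq_zero hR.le
  | insert a S haS ih =>
    intro f hf h0 hS
    obtain ⟨ha, hfa⟩ := (hS a).1 (Finset.mem_insert_self _ _)
    have hab : a ∈ ball c R := by
      rw [mem_ball]
      refine lt_of_le_of_ne (mem_closedBall.1 ha) fun h => h0 a h hfa
    have hntop : ¬ ∀ᶠ t in 𝓝 a, f t = 0 := by
      intro h
      have := hf.eqOn_zero_of_preconnected_of_eventuallyEq_zero
        (convex_closedBall c R).isPreconnected ha h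
      have hs : c + R ∈ sphere c R := by simp [abs_of_pos hR]
      exact h0 _ hs (this (sphere_subset_closedBall hs))
    obtain ⟨k, g₀, hg₀, hg₀a, hg₀e⟩ :=
      ((hf a ha).exists_eventuallyEq_pow_smul_nonzero_iff).2 hntop
    set g : ℂ → ℂ := fun t => if t = a then g₀ a else f t / (t - a) ^ k with hg
    have hfg : ∀ t ∈ closedBall c R, f t = (t - a) ^ k * g t := by
      intro t _
      by_cases hta : t = a
      · have := hg₀e.self_of_nhds
        subst hta
        simp [hg, this]
      · have : (t - a) ^ k ≠ 0 := pow_ne_zero _ (sub_ne_zero.2 hta)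
        simp [hg, hta]
        field_simp
    have hga : g =ᶠ[𝓝 a] g₀ := by
      filter_upwards [hg₀e] with t ht
      by_cases hta : t = a
      · simp [hg, hta]
      · have : (t - a) ^ k ≠ 0 := pow_ne_zero _ (sub_ne_zero.2 hta)
        simp [hg, hta, ht, this]
    have hgne : ∀ t, t ≠ a → g =ᶠ[𝓝 t] fun t => f t / (t - a) ^ k := by
      intro t hta
      filter_upwards [isOpen_ne.mem_nhds hta] with s hs
      replace hs : s ≠ a := hs
      simp [hg, hs]
    have hgan : AnalyticOnNhd ℂ g (closedBall c R) := by
      intro t ht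
      by_cases hta : t = a
      · rw [hta]
        exact hg₀.congr hga.symm
      · refine AnalyticAt.congr ?_ (hgne t hta).symm
        exact (hf t ht).div ((analyticAt_id.sub analyticAt_const).pow k)
          (pow_ne_zero _ (sub_ne_zero.2 hta))
    have hk : k ≠ 0 := by
      rintro rfl
      have := hg₀e.self_of_nhds
      simp [hfa] at this
      exact hg₀a this.symm
    have hsa : ∀ t ∈ sphere c R, t ≠ a := by
      rintro t ht rfl
      exact h0 t ht hfa
    have hg0 : ∀ t ∈ sphere c R, g t ≠ 0 := by
      intro t ht h
      have := hfg t (sphere_subset_closedBall ht)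
      rw [h, mul_zero] at this
      exact h0 t ht this
    have hgS : ∀ t, t ∈ S ↔ t ∈ closedBall c R ∧ g t = 0 := by
      intro t
      constructor
      · intro ht
        have hta : t ≠ a := fun h => haS (h ▸ ht)
        obtain ⟨h1, h2⟩ := (hS t).1 (Finset.mem_insert_of_mem ht)
        exact ⟨h1, by simp [hg, hta, h2]⟩
      · rintro ⟨h1, h2⟩
        have hta : t ≠ a := by
          rintro rfl
          simp only [hg, if_true] at h2
          exact hg₀a h2
        have h3 : f t = 0 := by rw [hfg t h1, h2, mul_zero]
        exact (Finset.mem_insert.1 ((hS t).2 ⟨h1, h3⟩)).resolve_left hta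
    obtain ⟨Z, hZ, hZ'⟩ := ih g hgan hg0 hgS
    refine ⟨Multiset.replicate k a + Z, fun t => ?_, fun G hG => ?_⟩
    · simp [Multiset.mem_add, Multiset.mem_replicate, hk, hZ]
    · have e1 : EqOn (fun t => G t * (deriv f t / f t))
          (fun t => k * (G t * (t - a)⁻¹) + G t * (deriv g t / g t)) (sphere c R) := by
        intro t ht
        have hta := hsa t ht
        have hta' : t - a ≠ 0 := sub_ne_zero.2 hta
        have hfe : f =ᶠ[𝓝 t] fun t => (t - a) ^ k * g t := by
          filter_upwards [isOpen_ne.mem_nhds hta] with s hs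
          replace hs : s ≠ a := hs
          have : (s - a) ^ k ≠ 0 := pow_ne_zero _ (sub_ne_zero.2 hs)
          simp [hg, hs]
          field_simp
        have hgd : DifferentiableAt ℂ g t := (hgan t (sphere_subset_closedBall ht)).differentiableAt
        have hld : logDeriv f t = k * (t - a)⁻¹ + logDeriv g t := by
          have h1 : logDeriv f t = logDeriv (fun t => (t - a) ^ k * g t) t := by
            rw [logDeriv_apply, logDeriv_apply, hfe.deriv_eq, hfe.self_of_nhds]
          rw [h1, logDeriv_mul (f := fun t => (t - a) ^ k) t (pow_ne_zero k hta') (hg0 t ht)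
            (by fun_prop) hgd]
          congr 1
          rw [logDeriv_fun_pow (f := fun t => t - a) (by fun_prop)]
          simp [logDeriv_apply]
        simp only [logDeriv_apply] at hld
        simp only [hld]
        ring
      rw [circleIntegral.integral_congr hR.le e1, circleIntegral.integral_add,
        circleIntegral.integral_const_mul, circleIntegral_div_sub_of_analyticOnNhd hG hab, hZ' G hG]
      · simp
        ring
      · apply ContinuousOn.circleIntegrable hR.le
        intro t ht
        apply ContinuousAt.continuousWithinAt
        have h1 := (hG t (sphere_subset_closedBall ht)).continuousAt
        have h2 : t - a ≠ 0 := sub_ne_zero.2 (hsa t ht)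
        exact continuousAt_const.mul (h1.mul ((continuousAt_id.sub continuousAt_const).inv₀ h2))
      · apply ContinuousOn.circleIntegrable hR.le
        intro t ht
        apply ContinuousAt.continuousWithinAt
        have h1 := (hG t (sphere_subset_closedBall ht))
        have h2 := (hgan t (sphere_subset_closedBall ht))
        exact (h1.mul (h2.deriv.div h2 (hg0 t ht))).continuousAt

end ZerosInDisc

/-! ### Power sums and elementary symmetric functions -/

section SymmetricFunctions

variable {E : Type*} [NormedAddCommGroup E] [NormedSpace ℂ E]

/-- By the Newton identities, elementary symmetric functions are differentiable as soon as all
power sums are. -/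
theorem differentiableAt_esymm_of_psum {ι : Type*} [Fintype ι] {x : E → ι → ℂ} {y₀ : E}
    (h : ∀ l : ℕ, DifferentiableAt ℂ (fun y => ∑ i, x y i ^ l) y₀) (k : ℕ) :
    DifferentiableAt ℂ (fun y => MvPolynomial.aeval (x y) (MvPolynomial.esymm ι ℂ k)) y₀ := by
  classical
  induction k using Nat.strong_induction_on with
  | _ k ih =>
    rcases Nat.eq_zero_or_pos k with rfl | hk
    · simp [MvPolynomial.esymm_zero]
    have key : ∀ y, MvPolynomial.aeval (x y) (MvPolynomial.esymm ι ℂ k) =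
        (k : ℂ)⁻¹ * ((-1) ^ (k + 1) * ∑ a ∈ Finset.HasAntidiagonal.antidiagonal k with a.1 < k,
          (-1) ^ a.1 * MvPolynomial.aeval (x y) (MvPolynomial.esymm ι ℂ a.1) *
            ∑ i, x y i ^ a.2) := by
      intro y
      have := congrArg (MvPolynomial.aeval (x y)) (MvPolynomial.mul_esymm_eq_sum ι ℂ k)
      simp only [map_mul, map_natCast, map_pow, map_neg, map_one, map_sum, MvPolynomial.psum,
        MvPolynomial.aeval_X] at this
      have hk0 : (k : ℂ) ≠ 0 := Nat.cast_ne_zero.2 hk.ne'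
      rw [← this, inv_mul_cancel_left₀ hk0]
    simp only [key]
    refine DifferentiableAt.const_mul (DifferentiableAt.const_mul ?_ _) _
    refine DifferentiableAt.fun_sum fun a ha => ?_
    have ha' := (Finset.mem_filter.1 ha).2
    exact ((ih a.1 ha').const_mul _).mul (h a.2)

theorem differentiableAt_prod_of_psum {ι : Type*} [Fintype ι] {x : E → ι → ℂ} {y₀ : E}
    (h : ∀ l : ℕ, DifferentiableAt ℂ (fun y => ∑ i, x y i ^ l) y₀) :
    DifferentiableAt ℂ (fun y => ∏ i, x y i) y₀ := by
  have := differentiableAt_esymm_of_psum h (Fintype.card ι)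
  simp only [MvPolynomial.esymm, ← Finset.card_univ, Finset.powersetCard_self,
    Finset.sum_singleton, map_prod, MvPolynomial.aeval_X] at this
  exact this

theorem Multiset.exists_fin_map_eq {α : Type*} {d : ℕ} (M : Multiset α) (h : M.card = d) :
    ∃ z : Fin d → α, (Finset.univ.val.map z) = M := by
  subst h
  induction M using Quotient.inductionOn with
  | _ l => exact ⟨l.get, (Fin.univ_val_map l.get).trans (congrArg _ (List.ofFn_get l))⟩

end SymmetricFunctions

/-! ### Zeros depending on parameters -/

section ZeroFunctions

variable {E : Type*} [NormedAddCommGroup E] [NormedSpace ℂ E]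

/-- If `f (y₀, ·)` has no zero on a circle, then for `y` near `y₀` the zeros of `f (y, ·)` in the
disc, listed with multiplicity, have constant number, and the sum over them of any holomorphic
function is holomorphic in `y`. -/
theorem exists_zero_functions {f : E × ℂ → ℂ} {U : Set (E × ℂ)} (hU : IsOpen U)
    (hf : DifferentiableOn ℂ f U) {y₀ : E} {c : ℂ} {R : ℝ} (hR : 0 < R)
    (hK : ∀ t ∈ closedBall c R, (y₀, t) ∈ U) (h0 : ∀ t ∈ sphere c R, f (y₀, t) ≠ 0) :
    ∃ B, IsOpen B ∧ y₀ ∈ B ∧ (∀ y ∈ B, ∀ t ∈ closedBall c R, (y, t) ∈ U) ∧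
      (∀ y ∈ B, ∀ t ∈ sphere c R, f (y, t) ≠ 0) ∧
      ∃ (d : ℕ) (Z : E → Fin d → ℂ),
        (∀ y ∈ B, ∀ t, (∃ i, Z y i = t) ↔ t ∈ closedBall c R ∧ f (y, t) = 0) ∧
        ∀ (V : Set (E × ℂ)) (G : E × ℂ → ℂ), IsOpen V → DifferentiableOn ℂ G V →
          ∀ y₁ ∈ B, (∀ t ∈ closedBall c R, (y₁, t) ∈ V) →
            DifferentiableAt ℂ (fun y => ∑ i, G (y, Z y i)) y₁ := by
  classical
  have hpi : (2 * Real.pi * Complex.I : ℂ) ≠ 0 := Complex.two_pi_I_ne_zero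
  have tube : ∀ (W : Set (E × ℂ)) (K : Set ℂ) (y₁ : E), IsOpen W → IsCompact K →
      (∀ t ∈ K, (y₁, t) ∈ W) → ∀ᶠ y in 𝓝 y₁, ∀ t ∈ K, (y, t) ∈ W :=
    fun W K y₁ hW hKc hsub => eventually_forall_mem_of_isCompact hW hKc hsub
  have hW0 : IsOpen (U ∩ {p | f p ≠ 0}) := hf.continuousOn.isOpen_inter_preimage hU isOpen_ne
  obtain ⟨B₁, hB₁, hB₁o, hyB₁⟩ := _root_.eventually_nhds_iff.1
    ((tube U _ y₀ hU (isCompact_closedBall c R) hK).and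
      (tube _ _ y₀ hW0 (isCompact_sphere c R) fun t ht =>
        ⟨hK t (sphere_subset_closedBall ht), h0 t ht⟩))
  have slice : ∀ (V : Set (E × ℂ)) (G : E × ℂ → ℂ), IsOpen V → DifferentiableOn ℂ G V →
      ∀ y, (∀ t ∈ closedBall c R, (y, t) ∈ V) →
        AnalyticOnNhd ℂ (fun t => G (y, t)) (closedBall c R) := by
    intro V G hV hG y hy t ht
    have hopen : IsOpen {t : ℂ | (y, t) ∈ V} := hV.preimage (by fun_prop)
    have : DifferentiableOn ℂ (fun t => G (y, t)) {t : ℂ | (y, t) ∈ V} := fun s hs =>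
      (DifferentiableAt.comp s (hG.differentiableAt (hV.mem_nhds hs))
        (by fun_prop : DifferentiableAt ℂ (fun t : ℂ => (y, t)) s)).differentiableWithinAt
    exact this.analyticAt (hopen.mem_nhds (hy t ht))
  have hex : ∀ y ∈ B₁, ∃ Z : Multiset ℂ, (∀ t, t ∈ Z ↔ t ∈ closedBall c R ∧ f (y, t) = 0) ∧
      ∀ G : ℂ → ℂ, AnalyticOnNhd ℂ G (closedBall c R) →
        ∮ t in C(c, R), G t * (deriv (fun t => f (y, t)) t / f (y, t)) =
          2 * Real.pi * Complex.I * (Z.map G).sum := fun y hy =>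
    exists_zeros_multiset hR (slice U f hU hf y (hB₁ y hy).1) fun t ht => ((hB₁ y hy).2 t ht).2
  choose! M hM hMG using hex
  -- the `t`-derivative of `f`, jointly holomorphic in both variables
  set D : E × ℂ → ℂ := fun p => deriv (fun s : ℂ => f (p + s • ((0 : E), (1 : ℂ)))) 0 with hDdef
  have hD : DifferentiableOn ℂ D U := differentiableOn_deriv_direction hU hf _
  have hDs : ∀ y t, deriv (fun t => f (y, t)) t = D (y, t) := by
    intro y t
    simp only [hDdef, Prod.smul_mk, smul_zero, Prod.mk_add_mk, add_zero, smul_eq_mul, mul_one]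
    rw [deriv_comp_const_add (f := fun t => f (y, t)), add_zero]
  have hsum : ∀ (V : Set (E × ℂ)) (G : E × ℂ → ℂ), IsOpen V → DifferentiableOn ℂ G V →
      ∀ y₁ ∈ B₁, (∀ t ∈ closedBall c R, (y₁, t) ∈ V) →
        DifferentiableAt ℂ (fun y => ((M y).map fun t => G (y, t)).sum) y₁ := by
    intro V G hV hG y₁ hy₁ hy₁V
    have hdiff :
        DifferentiableAt ℂ (fun y => ∮ t in C(c, R), G (y, t) * (D (y, t) * (f (y, t))⁻¹)) y₁ := by
      refine differentiableAt_circleIntegral (f := fun p => G p * (D p * (f p)⁻¹))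
        (hV.inter hW0) ?_ hR.le fun t ht =>
        ⟨hy₁V t (sphere_subset_closedBall ht), (hB₁ y₁ hy₁).2 t ht⟩
      rintro p ⟨hp, hpU, hp0⟩
      exact (((hG p hp).mono inter_subset_left).mul
        (((hD p hpU).mono (inter_subset_right.trans inter_subset_left)).mul
          (((hf p hpU).mono (inter_subset_right.trans inter_subset_left)).inv hp0)))
    refine (hdiff.const_mul (2 * Real.pi * Complex.I : ℂ)⁻¹).congr_of_eventuallyEq ?_
    filter_upwards [hB₁o.mem_nhds hy₁, tube V _ y₁ hV (isCompact_closedBall c R) hy₁V] with y hy hyV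
    have := hMG y hy (fun t => G (y, t)) (slice V G hV hG y hyV)
    simp only [hDs, div_eq_mul_inv] at this
    rw [this, inv_mul_cancel_left₀ hpi]
  set d := (M y₀).card with hd
  -- the number of zeros is continuous and an integer, hence locally constant
  have hcard : ∀ᶠ y in 𝓝 y₀, (M y).card = d := by
    have h1 := (hsum univ (fun _ => 1) isOpen_univ (by fun_prop) y₀ hyB₁ (by simp)).continuousAt
    simp only [Multiset.map_const', Multiset.sum_replicate, nsmul_eq_mul, mul_one] at h1
    have h2 := (Metric.tendsto_nhds.1 h1.tendsto) 1 one_pos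
    filter_upwards [h2] with y hy
    rw [← hd, Complex.dist_eq] at hy
    have h3 : |((M y).card : ℤ) - (d : ℤ)| < 1 := by
      have : (((M y).card : ℂ) - (d : ℂ)) = (((((M y).card : ℤ) - (d : ℤ) : ℤ)) : ℂ) :=
          by push_cast; ring
      rw [this, Complex.norm_intCast] at hy
      exact_mod_cast hy
    have := Int.abs_lt_one_iff.1 h3
    omega
  obtain ⟨B, hB, hBo, hyB⟩ := _root_.eventually_nhds_iff.1 (hcard.and (hB₁o.mem_nhds hyB₁))
  have hz : ∀ y ∈ B, ∃ z : Fin d → ℂ, (Finset.univ.val.map z) = M y := fun y hy =>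
    Multiset.exists_fin_map_eq _ (hB y hy).1
  choose! Z hZ using hz
  refine ⟨B, hBo, hyB, fun y hy => (hB₁ y (hB y hy).2).1, fun y hy t ht =>
    ((hB₁ y (hB y hy).2).2 t ht).2, d, Z, fun y hy t => ?_, fun V G hV hG y₁ hy₁ hyV => ?_⟩
  · rw [← hM y (hB y hy).2, ← hZ y hy]
    simp
  · refine (hsum V G hV hG y₁ (hB y₁ hy₁).2 hyV).congr_of_eventuallyEq ?_
    filter_upwards [hBo.mem_nhds hy₁] with y hy
    rw [← hZ y hy, Multiset.map_map]
    rfl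

end ZeroFunctions

/-! ### Riemann's extension theorem -/

section RiemannExtension

variable {E : Type*} [NormedAddCommGroup E] [NormedSpace ℂ E]

/-- Cauchy's integral formula for a function which is holomorphic and bounded off a finite set. -/
theorem circleIntegral_eq_of_bounded_off_finset {φ : ℂ → ℂ} {c w : ℂ} {R M : ℝ} (S : Finset ℂ)
    (hd : ∀ t ∈ closedBall c R, t ∉ S → DifferentiableAt ℂ φ t)
    (hM : ∀ t ∈ closedBall c R, t ∉ S → ‖φ t‖ ≤ M) (hS : ∀ t ∈ sphere c R, t ∉ S)
    (hw : w ∈ ball c R) (hwS : w ∉ S) :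
    ∮ t in C(c, R), φ t * (t - w)⁻¹ = 2 * Real.pi * Complex.I * φ w := by
  have hR : 0 < R := pos_of_mem_ball hw
  induction S using Finset.induction_on generalizing φ M with
  | empty =>
    have := DifferentiableOn.circleIntegral_sub_inv_smul (f := φ) (c := c) (R := R)
      (fun t ht => (hd t ht (by simp)).differentiableWithinAt) hw
    simpa [smul_eq_mul, mul_comm] using this
  | insert s S hsS ih =>
    by_cases hs : s ∈ ball c R
    · set V : Set ℂ := ball c R ∩ ((S : Set ℂ))ᶜ with hV
      have hVo : IsOpen V := isOpen_ball.inter S.finite_toSet.isClosed.isOpen_compl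
      have hVs : V ∈ 𝓝 s := hVo.mem_nhds ⟨hs, by simpa using hsS⟩
      set φ' := Function.update φ s (limUnder (𝓝[≠] s) φ) with hφ'
      have h1 : DifferentiableOn ℂ φ' V := by
        refine Complex.differentiableOn_update_limUnder_of_bddAbove hVs (fun t ht => ?_)
          ⟨M, ?_⟩
        · refine (hd t (ball_subset_closedBall ht.1.1) ?_).differentiableWithinAt
          have h2 := ht.1.2
          have h3 := ht.2
          simp_all
        · rintro _ ⟨t, ht, rfl⟩
          refine hM t (ball_subset_closedBall ht.1.1) ?_
          have h2 := ht.1.2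
          have h3 := ht.2
          simp_all
      have hne : ∀ t, t ≠ s → φ' t = φ t := fun t ht => by simp [hφ', ht]
      have hws : w ≠ s := fun h => hwS (by simp [h])
      have key := ih (φ := φ') (M := max M ‖φ' s‖) (fun t ht htS => by
          by_cases hts : t = s
          · exact h1.differentiableAt (by rw [hts]; exact hVs)
          · refine (hd t ht (by simp [hts, htS])).congr_of_eventuallyEq ?_
            filter_upwards [isOpen_ne.mem_nhds hts] with u hu using hne u hu)
        (fun t ht htS => by
          by_cases hts : t = s
          · rw [hts]; exact le_max_right _ _
          · rw [hne t hts]; exact (hM t ht (by simp [hts, htS])).trans (le_max_left _ _))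
        (fun t ht htS => hS t ht (Finset.mem_insert_of_mem htS))
        (fun h => hwS (Finset.mem_insert_of_mem h))
      rw [hne w hws] at key
      rw [← key]
      refine circleIntegral.integral_congr hR.le fun t ht => ?_
      have : t ≠ s := fun h => hS t ht (by simp [h])
      simp only [hne t this]
    · have hs' : s ∉ closedBall c R := by
        intro h
        rcases (mem_closedBall.1 h).lt_or_eq with h' | h'
        · exact hs h'
        · exact hS s h' (Finset.mem_insert_self _ _)
      have hne : ∀ t ∈ closedBall c R, t ∉ S → t ∉ insert s S := by
        intro t ht htS h
        rcases Finset.mem_insert.1 h with rfl | h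
        · exact hs' ht
        · exact htS h
      exact ih (fun t ht htS => hd t ht (hne t ht htS)) (fun t ht htS => hM t ht (hne t ht htS))
        (fun t ht htS => hS t ht (Finset.mem_insert_of_mem htS))
        (fun h => hwS (Finset.mem_insert_of_mem h))

theorem eq_of_continuousAt_of_frequently_eq {X Y : Type*} [TopologicalSpace X] [TopologicalSpace Y]
    [T2Space Y] {f g : X → Y} {x : X} (hf : ContinuousAt f x) (hg : ContinuousAt g x)
    (h : ∃ᶠ z in 𝓝 x, f z = g z) : f x = g x := by
  by_contra hne
  obtain ⟨u, v, hu, hv, hfu, hgv, huv⟩ := t2_separation hne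
  refine h (mem_of_superset (inter_mem (hf (hu.mem_nhds hfu)) (hg (hv.mem_nhds hgv)))
      fun z hz e => ?_)
  exact disjoint_left.1 huv hz.1 (by rw [e]; exact hz.2)

/-- The local form of Riemann's extension theorem. On a complex line through `y₀` in a direction `v`
along which `δ` does not vanish identically, the zeros of `δ` avoid a small circle around `y₀`; the
extension is the Cauchy integral of `f` over the circles of this radius in direction `v`, which are
disjoint from `T` for all centres near `y₀`. -/
theorem exists_local_extension {f : E → ℂ} {G T : Set E} {M : ℝ} (hG : IsOpen G)
    (hf : ∀ y ∈ G, y ∉ T → DifferentiableAt ℂ f y) (hM : ∀ y ∈ G, y ∉ T → ‖f y‖ ≤ M)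
    {y₀ : E} (hy₀ : y₀ ∈ G) (hT : ∃ r > 0, ∃ δ : E → ℂ, DifferentiableOn ℂ δ (ball y₀ r) ∧
      (∃ p ∈ ball y₀ r, δ p ≠ 0) ∧ ∀ z ∈ ball y₀ r, z ∈ T → δ z = 0) :
    ∃ (F : E → ℂ) (B : Set E), IsOpen B ∧ y₀ ∈ B ∧ B ⊆ G ∧ DifferentiableOn ℂ F B ∧
      ∀ y ∈ B, y ∉ T → F y = f y := by
  obtain ⟨r₁, hr₁, δ, hδ, ⟨p₁, hp₁, hp₁0⟩, hδT⟩ := hT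
  obtain ⟨r₂, hr₂, hr₂G⟩ := Metric.isOpen_iff.1 hG y₀ hy₀
  set r := min r₁ r₂
  have hr : 0 < r := lt_min hr₁ hr₂
  have hsub₁ : ball y₀ r ⊆ ball y₀ r₁ := ball_subset_ball (min_le_left _ _)
  have hsub₂ : ball y₀ r ⊆ G := (ball_subset_ball (min_le_right _ _)).trans hr₂G
  have hfreq : ∀ y ∈ ball y₀ r, ∃ᶠ z in 𝓝 y, δ z ≠ 0 := fun y hy =>
    dense_ne_zero_of_ne_zero hδ hp₁ hp₁0 (hsub₁ hy)
  obtain ⟨p, hp0, hp⟩ := ((hfreq y₀ (mem_ball_self hr)).and_eventually (ball_mem_nhds y₀ hr)).exists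
  set v := p - y₀ with hv
  set ℓ : ℂ → E := fun t => y₀ + t • v with hℓ
  have hℓc : Continuous ℓ := by fun_prop
  -- on the complex line from `y₀` to `p`, the zeros of `δ` are isolated
  have hne : ∀ᶠ t in 𝓝[≠] (0 : ℂ), δ (ℓ t) ≠ 0 := by
    have hdb : DifferentiableOn ℂ (δ ∘ ℓ) (ℓ ⁻¹' ball y₀ r) :=
      (hδ.mono hsub₁).comp (by fun_prop) fun t ht => ht
    have hopen : IsOpen (ℓ ⁻¹' ball y₀ r) := isOpen_ball.preimage hℓc
    have h00 : (0 : ℂ) ∈ ℓ ⁻¹' ball y₀ r := by simp [hℓ, hr]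
    rcases (hdb.analyticAt (hopen.mem_nhds h00)).eventually_eq_zero_or_eventually_ne_zero with h | h
    · exfalso
      by_cases hv0 : ‖v‖ = 0
      · rw [norm_eq_zero, hv, sub_eq_zero] at hv0
        have := h.self_of_nhds
        simp only [hℓ, Function.comp, zero_smul, add_zero] at this
        exact hp0 (hv0 ▸ this)
      have hvp : 0 < ‖v‖ := lt_of_le_of_ne (norm_nonneg v) (Ne.symm hv0)
      have hball : ball (0 : ℂ) (r / ‖v‖) ⊆ ℓ ⁻¹' ball y₀ r := by
        intro t ht
        rw [mem_ball_zero_iff, lt_div_iff₀ hvp] at ht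
        simpa [hℓ, norm_smul] using ht
      have h1 : (1 : ℂ) ∈ ball (0 : ℂ) (r / ‖v‖) := by
        rw [mem_ball_zero_iff, lt_div_iff₀ hvp, norm_one, one_mul, hv, ← dist_eq_norm]
        exact hp
      have := eqOn_zero_ball_of_eventuallyEq_zero (hdb.mono hball)
        (mem_ball_self (by positivity)) h 1 h1
      apply hp0
      simpa [hℓ, hv] using this
    · exact h
  obtain ⟨ρ, hρ, hρ'⟩ : ∃ ρ > 0, ∀ t ∈ closedBall (0 : ℂ) ρ,
      ℓ t ∈ ball y₀ r ∧ (t ≠ 0 → δ (ℓ t) ≠ 0) := by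
    have h1 : ∀ᶠ t in 𝓝 (0 : ℂ), ℓ t ∈ ball y₀ r :=
      hℓc.continuousAt.preimage_mem_nhds (by simpa [hℓ] using ball_mem_nhds y₀ hr)
    obtain ⟨ρ, hρ, h⟩ := Metric.eventually_nhds_iff_ball.1
        (h1.and (eventually_nhdsWithin_iff.1 hne))
    exact ⟨ρ / 2, by positivity, fun t ht => h t (closedBall_subset_ball (by linarith) ht)⟩
  have hUo : IsOpen {q : E × ℂ | q.1 + q.2 • v ∈ ball y₀ r} := isOpen_ball.preimage (by fun_prop)
  have hWo : IsOpen (ball y₀ r ∩ {z | δ z ≠ 0}) :=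
    (hδ.mono hsub₁).continuousOn.isOpen_inter_preimage isOpen_ball isOpen_ne
  have hU'o : IsOpen {q : E × ℂ | q.1 + q.2 • v ∈ ball y₀ r ∩ {z | δ z ≠ 0}} :=
    hWo.preimage (by fun_prop)
  have htube := (eventually_forall_mem_of_isCompact (y₀ := y₀) hUo
    (isCompact_closedBall (0 : ℂ) ρ) (fun t ht => (hρ' t ht).1)).and
    (eventually_forall_mem_of_isCompact (y₀ := y₀) hU'o (isCompact_sphere (0 : ℂ) ρ) (fun t ht =>
      ⟨(hρ' t (sphere_subset_closedBall ht)).1, (hρ' t (sphere_subset_closedBall ht)).2 (by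
        rintro rfl
        simp at ht
        linarith)⟩))
  obtain ⟨B, hB, hBo, hyB⟩ := _root_.eventually_nhds_iff.1 htube
  have hBball : ∀ y ∈ B, y ∈ ball y₀ r := fun y hy => by
    simpa using (hB y hy).1 0 (mem_closedBall_self hρ.le)
  have hfδ : ∀ z ∈ ball y₀ r, δ z ≠ 0 → DifferentiableAt ℂ f z ∧ ‖f z‖ ≤ M := fun z hz h0 =>
    ⟨hf z (hsub₂ hz) fun hT => h0 (hδT z (hsub₁ hz) hT),
      hM z (hsub₂ hz) fun hT => h0 (hδT z (hsub₁ hz) hT)⟩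
  have hpi : (2 * Real.pi * Complex.I : ℂ) ≠ 0 := Complex.two_pi_I_ne_zero
  set F : E → ℂ := fun y => (2 * Real.pi * Complex.I : ℂ)⁻¹ *
    ∮ t in C(0, ρ), f (y + t • v) * (t - 0)⁻¹ with hF
  have hFd : ∀ y ∈ B, DifferentiableAt ℂ F y := by
    intro y hy
    refine DifferentiableAt.const_mul ?_ _
    refine differentiableAt_circleIntegral (f := fun q : E × ℂ => f (q.1 + q.2 • v) * (q.2 - 0)⁻¹)
      (hU'o.inter (isOpen_ne_fun continuous_snd continuous_const : IsOpen {q : E × ℂ | q.2 ≠ 0}))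
      ?_ hρ.le fun t ht => ⟨(hB y hy).2 t ht, by
        rintro rfl
        simp at ht
        linarith⟩
    rintro q ⟨hq, hq0⟩
    have h1 : DifferentiableAt ℂ (fun q : E × ℂ => f (q.1 + q.2 • v)) q :=
      DifferentiableAt.comp q (hfδ _ hq.1 hq.2).1 (by fun_prop)
    have h2 : DifferentiableAt ℂ (fun q : E × ℂ => (q.2 - 0)⁻¹) q :=
      DifferentiableAt.inv (by fun_prop) (by simpa using hq0)
    exact (h1.mul h2).differentiableWithinAt
  -- on the line through `y`, the set `T` meets the disc in finitely many points
  have hFf : ∀ y ∈ B, δ y ≠ 0 → F y = f y := by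
    intro y hy hy0
    have hcont : Continuous fun t : ℂ => y + t • v := by fun_prop
    have hδan : AnalyticOnNhd ℂ (fun t : ℂ => δ (y + t • v)) (closedBall 0 ρ) := by
      intro t ht
      have hd : DifferentiableOn ℂ (fun t : ℂ => δ (y + t • v))
          ((fun t : ℂ => y + t • v) ⁻¹' ball y₀ r) :=
        (hδ.mono hsub₁).comp (by fun_prop) fun t ht => ht
      exact hd.analyticAt ((isOpen_ball.preimage hcont).mem_nhds ((hB y hy).1 t ht))
    have hfin := finite_zeros_closedBall hρ hδan fun t ht => ((hB y hy).2 t ht).2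
    have := circleIntegral_eq_of_bounded_off_finset (φ := fun t => f (y + t • v)) (c := 0) (w := 0)
      (R := ρ) (M := M) hfin.toFinset
      (fun t ht htS => by
        have h0 : δ (y + t • v) ≠ 0 := fun h => htS (by simpa using ⟨by simpa using ht, h⟩)
        exact DifferentiableAt.comp t (hfδ _ ((hB y hy).1 t ht) h0).1 (by fun_prop))
      (fun t ht htS => by
        have h0 : δ (y + t • v) ≠ 0 := fun h => htS (by simpa using ⟨by simpa using ht, h⟩)
        exact (hfδ _ ((hB y hy).1 t ht) h0).2)
      (fun t ht htS => by
        have := (hfin.mem_toFinset.1 htS).2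
        exact ((hB y hy).2 t ht).2 this)
      (mem_ball_self hρ) (by simp [hy0])
    simp only [hF]
    rw [this, inv_mul_cancel_left₀ hpi]
    simp
  refine ⟨F, B, hBo, hyB, fun y hy => hsub₂ (hBball y hy),
    fun y hy => (hFd y hy).differentiableWithinAt, fun y hy hyT => ?_⟩
  refine eq_of_continuousAt_of_frequently_eq (hFd y hy).continuousAt
    (hf y (hsub₂ (hBball y hy)) hyT).continuousAt ?_
  exact ((hfreq y (hBball y hy)).and_eventually (hBo.mem_nhds hy)).mono fun z hz => hFf z hz.2 hz.1

/-- Riemann's extension theorem in several variables: a bounded holomorphic function on the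
complement of a set which is locally contained in the zero set of a holomorphic function `δ ≢ 0`
extends holomorphically, with the same bound. -/
theorem exists_differentiableOn_extension {f : E → ℂ} {G T : Set E} {M : ℝ} (hG : IsOpen G)
    (hf : ∀ y ∈ G, y ∉ T → DifferentiableAt ℂ f y) (hM : ∀ y ∈ G, y ∉ T → ‖f y‖ ≤ M)
    (hT : ∀ y ∈ G, ∃ r > 0, ∃ δ : E → ℂ, DifferentiableOn ℂ δ (ball y r) ∧
      (∃ p ∈ ball y r, δ p ≠ 0) ∧ ∀ z ∈ ball y r, z ∈ T → δ z = 0) :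
    ∃ F : E → ℂ, DifferentiableOn ℂ F G ∧ (∀ y ∈ G, y ∉ T → F y = f y) ∧ ∀ y ∈ G, ‖F y‖ ≤ M := by
  have hdense : ∀ y ∈ G, ∃ᶠ z in 𝓝 y, z ∉ T := by
    intro y hy
    obtain ⟨r, hr, δ, hδ, ⟨p, hp, hp0⟩, h⟩ := hT y hy
    refine ((dense_ne_zero_of_ne_zero hδ hp hp0 (mem_ball_self hr)).and_eventually
      (ball_mem_nhds y hr)).mono fun z hz hzT => hz.1 (h z hz.2 hzT)
  -- the local extensions agree, since the complement of `T` is dense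
  choose! F₀ B hBo hyB hBG hFd hFf using fun y hy => exists_local_extension hG hf hM hy (hT y hy)
  have hagree : ∀ y ∈ G, ∀ z ∈ B y, F₀ z z = F₀ y z := by
    intro y hy z hz
    have hzG := hBG y hy hz
    refine eq_of_continuousAt_of_frequently_eq
      ((hFd z hzG).differentiableAt ((hBo z hzG).mem_nhds (hyB z hzG))).continuousAt
      ((hFd y hy).differentiableAt ((hBo y hy).mem_nhds hz)).continuousAt ?_
    refine ((hdense z hzG).and_eventually (inter_mem ((hBo z hzG).mem_nhds (hyB z hzG))
      ((hBo y hy).mem_nhds hz))).mono fun x hx => ?_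
    rw [hFf z hzG x hx.2.1 hx.1, hFf y hy x hx.2.2 hx.1]
  have hD : ∀ y ∈ G, DifferentiableAt ℂ (fun z => F₀ z z) y := by
    intro y hy
    refine ((hFd y hy).differentiableAt ((hBo y hy).mem_nhds (hyB y hy))).congr_of_eventuallyEq ?_
    filter_upwards [(hBo y hy).mem_nhds (hyB y hy)] with z hz using hagree y hy z hz
  have hE : ∀ y ∈ G, y ∉ T → F₀ y y = f y := fun y hy hyT => hFf y hy y (hyB y hy) hyT
  refine ⟨fun y => F₀ y y, fun y hy => (hD y hy).differentiableWithinAt, hE, fun y hy => ?_⟩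
  by_contra! hlt
  have h1 : ∀ᶠ z in 𝓝 y, M < ‖F₀ z z‖ := (hD y hy).continuousAt.norm.eventually_const_lt hlt
  obtain ⟨z, hzT, hz1, hzG⟩ := ((hdense y hy).and_eventually (h1.and (hG.mem_nhds hy))).exists
  rw [hE z hzG hzT] at hz1
  exact absurd (hM z hzG hzT) (not_le.2 hz1)

end RiemannExtension

/-! ### Analytic sets and elimination of variables -/

section AnalyticSets

variable {E : Type*} [NormedAddCommGroup E] [NormedSpace ℂ E]

/-- Near the point `p`, the set `Y` is the common zero set of finitely many holomorphic functions.
The point `p` need not belong to `Y`. -/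
def IsAnalyticSetAt (Y : Set E) (p : E) : Prop :=
  ∃ U, IsOpen U ∧ p ∈ U ∧ ∃ (ι : Type) (_ : Fintype ι) (f : ι → E → ℂ),
    (∀ i, DifferentiableOn ℂ (f i) U) ∧ ∀ x ∈ U, x ∈ Y ↔ ∀ i, f i x = 0

theorem IsAnalyticSetAt.congr {Y Y' : Set E} {p : E} (h : IsAnalyticSetAt Y p)
    (he : ∀ᶠ x in 𝓝 p, x ∈ Y ↔ x ∈ Y') : IsAnalyticSetAt Y' p := by
  obtain ⟨U, hU, hpU, ι, _, f, hf, hY⟩ := h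
  obtain ⟨V, hV, hVo, hpV⟩ := _root_.eventually_nhds_iff.1 he
  exact ⟨U ∩ V, hU.inter hVo, ⟨hpU, hpV⟩, ι, inferInstance, f,
    fun i => (hf i).mono inter_subset_left, fun x hx => (hV x hx.2).symm.trans (hY x hx.1)⟩

theorem isAnalyticSetAt_empty (p : E) : IsAnalyticSetAt (∅ : Set E) p :=
  ⟨univ, isOpen_univ, mem_univ p, Unit, inferInstance, fun _ _ => 1, by simp, by simp⟩

theorem IsAnalyticSetAt.union {Y Y' : Set E} {p : E} (h : IsAnalyticSetAt Y p)
    (h' : IsAnalyticSetAt Y' p) : IsAnalyticSetAt (Y ∪ Y') p := by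
  obtain ⟨U, hU, hpU, ι, _, f, hf, hY⟩ := h
  obtain ⟨V, hV, hpV, κ, _, g, hg, hY'⟩ := h'
  refine ⟨U ∩ V, hU.inter hV, ⟨hpU, hpV⟩, ι × κ, inferInstance, fun i x => f i.1 x * g i.2 x,
    fun i => ((hf i.1).mono inter_subset_left).mul ((hg i.2).mono inter_subset_right),
    fun x hx => ?_⟩
  rw [mem_union, hY x hx.1, hY' x hx.2]
  constructor
  · rintro (h | h) i
    · simp [h i.1]
    · simp [h i.2]
  · intro h
    by_contra! hne
    obtain ⟨⟨i, hi⟩, j, hj⟩ := hne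
    exact mul_ne_zero hi hj (h (i, j))

theorem isAnalyticSetAt_biUnion {α : Type*} {S : Finset α} {Y : α → Set E} {p : E}
    (h : ∀ s ∈ S, IsAnalyticSetAt (Y s) p) : IsAnalyticSetAt (⋃ s ∈ S, Y s) p := by
  classical
  induction S using Finset.induction_on with
  | empty => simpa using isAnalyticSetAt_empty p
  | insert a S _ ih =>
    rw [Finset.set_biUnion_insert]
    exact (h a (Finset.mem_insert_self _ _)).union
      (ih fun s hs => h s (Finset.mem_insert_of_mem hs))

theorem IsAnalyticSetAt.eventually_notMem {Y : Set E} {p : E} (h : IsAnalyticSetAt Y p)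
    (hp : p ∉ Y) : ∀ᶠ x in 𝓝 p, x ∉ Y := by
  obtain ⟨U, hU, hpU, ι, _, f, hf, hY⟩ := h
  rw [hY p hpU] at hp
  push Not at hp
  obtain ⟨i, hi⟩ := hp
  have hc : ContinuousAt (f i) p := (hf i).continuousOn.continuousAt (hU.mem_nhds hpU)
  filter_upwards [hU.mem_nhds hpU, hc.eventually_ne hi] with x hx hxi hxY
  exact hxi ((hY x hx).1 hxY i)

theorem IsAnalyticSetAt.preimage {F : Type*} [NormedAddCommGroup F] [NormedSpace ℂ F]
    {Y : Set E} {φ : F → E} (hφ : Differentiable ℂ φ) {q : F} (h : IsAnalyticSetAt Y (φ q)) :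
    IsAnalyticSetAt (φ ⁻¹' Y) q := by
  obtain ⟨U, hU, hpU, ι, _, f, hf, hY⟩ := h
  exact ⟨φ ⁻¹' U, hU.preimage hφ.continuous, hpU, ι, inferInstance, fun i => f i ∘ φ,
    fun i => (hf i).comp hφ.differentiableOn fun _ hx => hx, fun x hx => hY (φ x) hx⟩

/-- If `r` numbers `v i` are not all zero, then `∑ nⁱ v i` vanishes for at most `r` values
of `n`. -/
theorem eq_zero_of_sum_pow_eq_zero {r : ℕ} {v : Fin r → ℂ} {S : Finset ℕ} (hS : r < S.card)
    (h : ∀ n ∈ S, ∑ i : Fin r, (n : ℂ) ^ (i : ℕ) * v i = 0) : v = 0 := by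
  have hp : (∑ i : Fin r, Polynomial.C (v i) * Polynomial.X ^ (i : ℕ) : Polynomial ℂ) = 0 := by
    refine Polynomial.eq_zero_of_degree_lt_of_eval_index_eq_zero (s := S)
        (v := fun n : ℕ => (n : ℂ))
      (fun a _ b _ hab => Nat.cast_injective hab) ?_ fun n hn => ?_
    · refine lt_of_lt_of_le (b := ((r : ℕ) : WithBot ℕ)) ?_ (by exact_mod_cast hS.le)
      refine (Polynomial.degree_sum_fin_lt v)
    · rw [Polynomial.eval_finsetSum]
      rw [← h n hn]
      refine Finset.sum_congr rfl fun i _ => ?_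
      rw [Polynomial.eval_mul, Polynomial.eval_C, Polynomial.eval_pow, Polynomial.eval_X, mul_comm]
  funext i
  have := congrArg (fun p => p.coeff (i : ℕ)) hp
  simpa [Polynomial.finsetSum_coeff, Polynomial.coeff_X_pow, Fin.val_inj] using this

/-- The part of an analytic set lying over a small disc, on whose boundary one of the defining
functions has no zero: its projection is analytic, and it is contained in the zeros `Z y` of that
function. The projection is cut out by the norms `∏ (∑ nⁱ fᵢ (y, Z y a))` for sufficiently many
`n`. -/
theorem disc_projection {U : Set (E × ℂ)} (hU : IsOpen U) {ι : Type} [Fintype ι]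
    {f : ι → E × ℂ → ℂ} (hf : ∀ i, DifferentiableOn ℂ (f i) U) {Y : Set (E × ℂ)}
    (hY : ∀ x ∈ U, x ∈ Y ↔ ∀ i, f i x = 0) {y₀ : E} {c : ℂ} {R : ℝ} (hR : 0 < R)
    (hK : ∀ t ∈ closedBall c R, (y₀, t) ∈ U) (i₀ : ι) (h0 : ∀ t ∈ sphere c R, f i₀ (y₀, t) ≠ 0) :
    IsAnalyticSetAt {y | ∃ t ∈ closedBall c R, (y, t) ∈ Y} y₀ ∧
    ∃ (d : ℕ) (Z : E → Fin d → ℂ), ∀ᶠ y in 𝓝 y₀,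
      (∀ t ∈ closedBall c R, (y, t) ∈ Y → ∃ i, Z y i = t) ∧
      ∀ l : ℕ, DifferentiableAt ℂ (fun y => ∑ i, Z y i ^ l) y := by
  obtain ⟨B, hBo, hyB, hBU, hBs, d, Z, hZ, hZG⟩ := exists_zero_functions hU (hf i₀) hR hK h0
  have hZc : ∀ y ∈ B, ∀ a, Z y a ∈ closedBall c R := fun y hy a => ((hZ y hy _).1 ⟨a, rfl⟩).1
  constructor
  · set r := Fintype.card ι
    set e := Fintype.equivFin ι
    set g : ℕ → E × ℂ → ℂ := fun n p => ∑ i : Fin r, (n : ℂ) ^ (i : ℕ) * f (e.symm i) p with hg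
    have hgd : ∀ n, DifferentiableOn ℂ (g n) U := fun n => by
      refine DifferentiableOn.fun_sum fun i _ => ?_
      exact (hf _).const_mul _
    refine ⟨B, hBo, hyB, Fin (d * r + 1), inferInstance, fun n y => ∏ a, g n (y, Z y a),
      fun n y hy => ?_, fun y hy => ?_⟩
    · refine (differentiableAt_prod_of_psum fun l => ?_).differentiableWithinAt
      exact hZG U (fun p => g n p ^ l) hU ((hgd n).pow l) y hy (hBU y hy)
    · constructor
      · rintro ⟨t, ht, hty⟩ n
        rw [hY _ (hBU y hy t ht)] at hty
        obtain ⟨a, ha⟩ := (hZ y hy t).2 ⟨ht, hty i₀⟩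
        refine Finset.prod_eq_zero (Finset.mem_univ a) ?_
        simp [hg, ha, hty]
      · intro h
        have h1 : ∀ n : Fin (d * r + 1), ∃ a, g n (y, Z y a) = 0 := fun n => by
          simpa [Finset.prod_eq_zero_iff] using h n
        -- of the `d * r + 1` values of `n`, at least `r + 1` share the same zero `Z y b`
        choose a ha using h1
        obtain ⟨b, -, hb⟩ := Finset.exists_lt_card_fiber_of_mul_lt_card_of_maps_to
          (s := (Finset.univ : Finset (Fin (d * r + 1)))) (t := (Finset.univ : Finset (Fin d)))
          (f := a) (n := r) (fun _ _ => Finset.mem_univ _) (by simp)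
        have hv := eq_zero_of_sum_pow_eq_zero (v := fun i => f (e.symm i) (y, Z y b))
          (S := (Finset.univ.filter fun n => a n = b).map Fin.valEmbedding) (by simpa using hb) (by
            intro n hn
            simp only [Finset.mem_map, Finset.mem_filter, Finset.mem_univ, true_and] at hn
            obtain ⟨n', hn', rfl⟩ := hn
            have := ha n'
            rw [hn'] at this
            exact this)
        refine ⟨Z y b, hZc y hy b, (hY _ (hBU y hy _ (hZc y hy b))).2 fun i => ?_⟩
        have := congrFun hv (e i)
        simpa using this
  · refine ⟨d, Z, ?_⟩
    filter_upwards [hBo.mem_nhds hyB] with y hy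
    refine ⟨fun t ht hty => (hZ y hy t).2 ⟨ht, (hY _ (hBU y hy t ht)).1 hty i₀⟩, fun l => ?_⟩
    exact hZG univ (fun p => p.2 ^ l) isOpen_univ (by fun_prop) y hy (by simp)

/-- `Y ⊆ E × F` is analytic at all points over the open set `G ⊆ E`, and locally bounded over `G`,
so that its projection to `G` is proper. -/
structure IsProperOver {F : Type*} [NormedAddCommGroup F] [NormedSpace ℂ F] (G : Set E)
    (Y : Set (E × F)) : Prop where
  isOpen : IsOpen G
  analytic : ∀ y ∈ G, ∀ w, IsAnalyticSetAt Y (y, w)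
  bounded : ∀ y₀ ∈ G, ∃ R, ∀ᶠ y in 𝓝 y₀, ∀ w, (y, w) ∈ Y → ‖w‖ ≤ R

theorem IsProperOver.isClosed_fiber {F : Type*} [NormedAddCommGroup F] [NormedSpace ℂ F]
    {G : Set E} {Y : Set (E × F)} (h : IsProperOver G Y) {y : E} (hy : y ∈ G) :
    IsClosed {w | (y, w) ∈ Y} := by
  rw [← isOpen_compl_iff, isOpen_iff_mem_nhds]
  intro w hw
  have hc : ContinuousAt (fun w : F => (y, w)) w := by fun_prop
  exact hc.eventually ((h.analytic y hy w).eventually_notMem hw)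

/-- An analytic set which is proper over `G` with fibres in `ℂ` is near each point of a fibre
contained in a small disc as in `disc_projection`: a fibre is compact and analytic in `ℂ`, so it
has no interior point. -/
theorem IsProperOver.exists_disc {G : Set E} {Y : Set (E × ℂ)} (h : IsProperOver G Y) {y₀ : E}
    (hy₀ : y₀ ∈ G) {t : ℂ} (ht : (y₀, t) ∈ Y) :
    ∃ R > 0, IsAnalyticSetAt {y | ∃ s ∈ closedBall t R, (y, s) ∈ Y} y₀ ∧
      ∃ (d : ℕ) (Z : E → Fin d → ℂ), ∀ᶠ y in 𝓝 y₀,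
        (∀ s ∈ closedBall t R, (y, s) ∈ Y → ∃ i, Z y i = s) ∧
        ∀ l : ℕ, DifferentiableAt ℂ (fun y => ∑ i, Z y i ^ l) y := by
  set F : Set ℂ := {t | (y₀, t) ∈ Y} with hF
  have hFc : IsClosed F := h.isClosed_fiber hy₀
  obtain ⟨R, hR⟩ := h.bounded y₀ hy₀
  have hFb : ∀ s ∈ F, ‖s‖ ≤ R := hR.self_of_nhds
  have hloc : ∀ s, ∀ {U : Set (E × ℂ)} (_ : IsOpen U) (_ : (y₀, s) ∈ U) {g : E × ℂ → ℂ}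
      (_ : DifferentiableOn ℂ g U), AnalyticAt ℂ (fun t => g (y₀, t)) s := by
    intro s U hU hs g hg
    have hc : Continuous fun t : ℂ => (y₀, t) := by fun_prop
    have : DifferentiableOn ℂ (fun t => g (y₀, t)) ((fun t : ℂ => (y₀, t)) ⁻¹' U) :=
      hg.comp (by fun_prop) fun t ht => ht
    exact this.analyticAt ((hU.preimage hc).mem_nhds hs)
  -- near a point, either the fibre is a neighbourhood of it, or one of the functions defining `Y`
  -- has no other zero in the fibre
  have hdich : ∀ s, ∀ {U : Set (E × ℂ)} (_ : IsOpen U) (_ : (y₀, s) ∈ U) {ι : Type} [Fintype ι]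
      {f : ι → E × ℂ → ℂ} (_ : ∀ i, DifferentiableOn ℂ (f i) U)
      (_ : ∀ x ∈ U, x ∈ Y ↔ ∀ i, f i x = 0),
      (∀ᶠ u in 𝓝 s, u ∈ F) ∨ ∃ i, ∀ᶠ u in 𝓝[≠] s, f i (y₀, u) ≠ 0 := by
    intro s U hU hs ι _ f hf hYU
    by_cases hex : ∃ i, ∀ᶠ u in 𝓝[≠] s, f i (y₀, u) ≠ 0
    · exact Or.inr hex
    · left
      push Not at hex
      have hall : ∀ i, ∀ᶠ u in 𝓝 s, f i (y₀, u) = 0 := fun i =>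
        ((hloc s hU hs (hf i)).eventually_eq_zero_or_eventually_ne_zero).resolve_right
          (fun h' => hex i (h'.mono fun _ h => h))
      have hc : ContinuousAt (fun t : ℂ => (y₀, t)) s := by fun_prop
      filter_upwards [eventually_all.2 hall, hc.preimage_mem_nhds (hU.mem_nhds hs)] with u hu huU
      exact (hYU _ huU).2 hu
  -- by the dichotomy the interior of the fibre is closed; as the fibre is bounded, it is empty
  have hclopen : IsClopen {s | ∀ᶠ u in 𝓝 s, u ∈ F} := by
    constructor
    · rw [← closure_subset_iff_isClosed]
      intro s hs
      obtain ⟨U, hU, hsU, ι, _, f, hf, hYU⟩ := h.analytic y₀ hy₀ s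
      rcases hdich s hU hsU hf hYU with h1 | ⟨i, hi⟩
      · exact h1
      · by_contra hsN
        have hfr := mem_closure_iff_frequently.1 hs
        have hc : ContinuousAt (fun t : ℂ => (y₀, t)) s := by fun_prop
        obtain ⟨u, hu, huU, hui⟩ := (hfr.and_eventually (inter_mem
          (hc.preimage_mem_nhds (hU.mem_nhds hsU)) (eventually_nhdsWithin_iff.1 hi))).exists
        have hne : u ≠ s := fun e => hsN (e ▸ hu)
        replace hu : ∀ᶠ w in 𝓝 u, w ∈ F := hu
        exact hui hne ((hYU _ huU).1 hu.self_of_nhds i)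
    · rw [isOpen_iff_mem_nhds]
      intro s hs
      exact eventually_eventually_nhds.2 hs
  have hempty : {s | ∀ᶠ u in 𝓝 s, u ∈ F} = ∅ := by
    rcases isClopen_iff.1 hclopen with h1 | h1
    · exact h1
    · exfalso
      have h2 : ((|R| + 1 : ℝ) : ℂ) ∈ {s | ∀ᶠ u in 𝓝 s, u ∈ F} := h1 ▸ mem_univ _
      have h3 := hFb _ (Eventually.self_of_nhds h2)
      rw [Complex.norm_real, Real.norm_eq_abs, abs_of_pos (by positivity)] at h3
      linarith [le_abs_self R]
  obtain ⟨U, hU, htU, ι, _, f, hf, hYU⟩ := h.analytic y₀ hy₀ t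
  rcases hdich t hU htU hf hYU with h1 | ⟨i, hi⟩
  · have : t ∈ {s | ∀ᶠ u in 𝓝 s, u ∈ F} := h1
    rw [hempty] at this
    exact this.elim
  · have hc : ContinuousAt (fun t : ℂ => (y₀, t)) t := by fun_prop
    obtain ⟨ρ, hρ, hρ'⟩ := Metric.eventually_nhds_iff_ball.1
      ((eventually_nhdsWithin_iff.1 hi).and (hc.preimage_mem_nhds (hU.mem_nhds htU)))
    have hsub : closedBall t (ρ / 2) ⊆ ball t ρ := closedBall_subset_ball (by linarith)
    refine ⟨ρ / 2, by positivity, disc_projection hU hf hYU (by positivity)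
      (fun s hs => (hρ' s (hsub hs)).2) i fun s hs => ?_⟩
    refine (hρ' s (hsub (sphere_subset_closedBall hs))).1 ?_
    rintro rfl
    simp at hs
    linarith

/-- The fibres in `ℂ` near a given one are covered by finitely many small discs. -/
theorem IsProperOver.exists_disc_cover {G : Set E} {Y : Set (E × ℂ)} (h : IsProperOver G Y) {y₀ : E}
    (hy₀ : y₀ ∈ G) : ∃ (S : Finset ℂ) (R : ℂ → ℝ),
      (∀ t ∈ S, IsAnalyticSetAt {y | ∃ s ∈ closedBall t (R t), (y, s) ∈ Y} y₀ ∧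
        ∃ (d : ℕ) (Z : E → Fin d → ℂ), ∀ᶠ y in 𝓝 y₀,
          (∀ s ∈ closedBall t (R t), (y, s) ∈ Y → ∃ i, Z y i = s) ∧
          ∀ l : ℕ, DifferentiableAt ℂ (fun y => ∑ i, Z y i ^ l) y) ∧
      ∀ᶠ y in 𝓝 y₀, ∀ s, (y, s) ∈ Y → ∃ t ∈ S, s ∈ closedBall t (R t) := by
  choose! R hR hRd using fun t (ht : (y₀, t) ∈ Y) => h.exists_disc hy₀ ht
  obtain ⟨C, hC⟩ := h.bounded y₀ hy₀
  have hcomp : IsCompact {t | (y₀, t) ∈ Y} := by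
    refine (isCompact_closedBall (0 : ℂ) C).of_isClosed_subset (h.isClosed_fiber hy₀) fun t ht => ?_
    simpa using hC.self_of_nhds t ht
  obtain ⟨S, hS, hSc⟩ := hcomp.elim_nhds_subcover (fun t => ball t (R t))
    fun t ht => ball_mem_nhds t (hR t ht)
  refine ⟨S, R, fun t ht => hRd t (hS t ht), ?_⟩
  have hev : ∀ᶠ y in 𝓝 y₀, ∀ s ∈ closedBall (0 : ℂ) C, (y, s) ∈ Y →
      ∃ t ∈ S, s ∈ closedBall t (R t) := by
    refine (isCompact_closedBall (0 : ℂ) C).eventually_forall_of_forall_eventually fun s _ => ?_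
    by_cases hs : (y₀, s) ∈ Y
    · obtain ⟨t, ht, hst⟩ := mem_iUnion₂.1 (hSc hs)
      have hc : ContinuousAt (fun p : E × ℂ => p.2) (y₀, s) := by fun_prop
      filter_upwards [hc.preimage_mem_nhds (isOpen_ball.mem_nhds hst)] with p hp _
      exact ⟨t, ht, ball_subset_closedBall hp⟩
    · filter_upwards [(h.analytic y₀ hy₀ s).eventually_notMem hs] with p hp hp'
      exact (hp hp').elim
  filter_upwards [hev, hC] with y hy hyC s hs
  exact hy s (by simpa using hyC s hs) hs

/-- Elimination of one variable: the projection of a proper analytic set is analytic. -/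
theorem IsProperOver.isAnalyticSetAt_image_fst {G : Set E} {Y : Set (E × ℂ)}
    (h : IsProperOver G Y) {y₀ : E} (hy₀ : y₀ ∈ G) : IsAnalyticSetAt (Prod.fst '' Y) y₀ := by
  obtain ⟨S, R, hS, hcov⟩ := h.exists_disc_cover hy₀
  refine (isAnalyticSetAt_biUnion fun t ht => (hS t ht).1).congr ?_
  filter_upwards [hcov] with y hy
  simp only [mem_iUnion, mem_image, Prod.exists, exists_and_right, exists_eq_right]
  constructor
  · rintro ⟨t, _, s, _, hs⟩
    exact ⟨s, hs⟩
  · rintro ⟨s, hs⟩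
    obtain ⟨t, ht, hst⟩ := hy s hs
    exact ⟨t, ht, s, hst, hs⟩

/-- Locally over the base, a proper analytic set in `E × ℂ` is contained in the graphs of the
members of a finite family `Z` whose power sums are holomorphic. -/
theorem IsProperOver.exists_root_functions {G : Set E} {Y : Set (E × ℂ)} (h : IsProperOver G Y)
    {y₀ : E} (hy₀ : y₀ ∈ G) : ∃ (ι : Type) (_ : Fintype ι) (Z : E → ι → ℂ), ∀ᶠ y in 𝓝 y₀,
      (∀ t, (y, t) ∈ Y → ∃ i, Z y i = t) ∧
      ∀ l : ℕ, DifferentiableAt ℂ (fun y => ∑ i, Z y i ^ l) y := by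
  obtain ⟨S, R, hS, hcov⟩ := h.exists_disc_cover hy₀
  choose d Z hZ using fun t : S => (hS t t.2).2
  refine ⟨Σ t : S, Fin (d t), inferInstance, fun y i => Z i.1 y i.2, ?_⟩
  filter_upwards [hcov, eventually_all.2 hZ] with y hy hyZ
  constructor
  · intro s hs
    obtain ⟨t, ht, hst⟩ := hy s hs
    obtain ⟨i, hi⟩ := (hyZ ⟨t, ht⟩).1 s hst hs
    exact ⟨⟨⟨t, ht⟩, i⟩, hi⟩
  · intro l
    simp only [Fintype.sum_sigma]
    exact DifferentiableAt.fun_sum fun t _ => (hyZ t).2 l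

theorem differentiable_insertNth {k : ℕ} (j : Fin (k + 1)) {a : E → ℂ} {b : E → Fin k → ℂ}
    (ha : Differentiable ℂ a) (hb : Differentiable ℂ b) :
    Differentiable ℂ fun x => (j.insertNth (a x) (b x) : Fin (k + 1) → ℂ) := by
  refine differentiable_pi.2 fun i => ?_
  rcases Fin.eq_self_or_eq_succAbove j i with rfl | ⟨i', rfl⟩
  · simpa using ha
  · simpa using differentiable_pi.1 hb i'

theorem norm_le_norm_insertNth {k : ℕ} (j : Fin (k + 1)) (t : ℂ) (w : Fin k → ℂ) :
    ‖t‖ ≤ ‖(j.insertNth t w : Fin (k + 1) → ℂ)‖ ∧ ‖w‖ ≤ ‖(j.insertNth t w : Fin (k + 1) → ℂ)‖ := by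
  constructor
  · simpa using norm_le_pi_norm (j.insertNth t w : Fin (k + 1) → ℂ) j
  · refine (pi_norm_le_iff_of_nonneg (norm_nonneg _)).2 fun i => ?_
    simpa using norm_le_pi_norm (j.insertNth t w : Fin (k + 1) → ℂ) (j.succAbove i)

/-- Elimination of `k` variables, one at a time. -/
theorem IsProperOver.isAnalyticSetAt_image_fst_pi {k : ℕ} {E : Type*} [NormedAddCommGroup E]
    [NormedSpace ℂ E] {G : Set E} {Y : Set (E × (Fin k → ℂ))}
    (h : IsProperOver G Y) {y₀ : E} (hy₀ : y₀ ∈ G) : IsAnalyticSetAt (Prod.fst '' Y) y₀ := by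
  induction k with
  | zero =>
    have : Prod.fst '' Y = (fun y : E => (y, (0 : Fin 0 → ℂ))) ⁻¹' Y := by
      ext y
      simp only [mem_image, Prod.exists, exists_and_right, exists_eq_right, mem_preimage]
      exact ⟨fun ⟨w, hw⟩ => Subsingleton.elim w 0 ▸ hw, fun hw => ⟨0, hw⟩⟩
    rw [this]
    exact IsAnalyticSetAt.preimage (φ := fun y : E => (y, (0 : Fin 0 → ℂ))) (by fun_prop)
      (h.analytic y₀ hy₀ 0)
  | succ k ih =>
    set φ : (E × (Fin k → ℂ)) × ℂ → E × (Fin (k + 1) → ℂ) :=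
      fun p => (p.1.1, (0 : Fin (k + 1)).insertNth p.2 p.1.2) with hφ
    have hφd : Differentiable ℂ φ :=
      Differentiable.prodMk (by fun_prop) (differentiable_insertNth 0 (by fun_prop) (by fun_prop))
    have h1 : IsProperOver (G ×ˢ (univ : Set (Fin k → ℂ))) (φ ⁻¹' Y) := by
      refine ⟨h.isOpen.prod isOpen_univ, fun p hp t => (h.analytic p.1 hp.1 _).preimage hφd,
        fun p hp => ?_⟩
      obtain ⟨C, hC⟩ := h.bounded p.1 hp.1
      refine ⟨C, ?_⟩
      filter_upwards [continuousAt_fst.eventually hC] with q hq t ht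
      exact (norm_le_norm_insertNth 0 t q.2).1.trans (hq _ ht)
    have h2 : IsProperOver G (Prod.fst '' (φ ⁻¹' Y)) := by
      refine ⟨h.isOpen, fun y hy w => h1.isAnalyticSetAt_image_fst (mk_mem_prod hy (mem_univ w)),
        fun y hy => ?_⟩
      obtain ⟨C, hC⟩ := h.bounded y hy
      refine ⟨C, ?_⟩
      filter_upwards [hC] with z hz
      rintro w ⟨⟨⟨z', w'⟩, t⟩, ht, hzw⟩
      obtain ⟨rfl, rfl⟩ := Prod.mk.inj hzw
      exact (norm_le_norm_insertNth 0 t w').2.trans (hz _ ht)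
    have h3 := ih h2
    convert! h3 using 1
    ext y
    simp only [mem_image, Prod.exists, exists_and_right, exists_eq_right, mem_preimage, hφ]
    constructor
    · rintro ⟨w, hw⟩
      refine ⟨fun i => w ((0 : Fin (k + 1)).succAbove i), w 0, ?_⟩
      have : (0 : Fin (k + 1)).insertNth (w 0) (fun i => w ((0 : Fin (k + 1)).succAbove i)) = w :=
        Fin.insertNth_self_removeNth 0 w
      rwa [this]
    · rintro ⟨w, t, hw⟩
      exact ⟨_, hw⟩

/-- The image of a proper analytic set in `E × ℂᵏ` under a coordinate `wⱼ` is a proper analytic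
set in `E × ℂ`. -/
theorem IsProperOver.image_coord {k : ℕ} {G : Set E} {Y : Set (E × (Fin k → ℂ))}
    (h : IsProperOver G Y) (j : Fin k) :
    IsProperOver G ((fun p : E × (Fin k → ℂ) => (p.1, p.2 j)) '' Y) := by
  obtain ⟨k, rfl⟩ : ∃ k', k = k' + 1 := ⟨k - 1, by have := j.pos; omega⟩
  set φ : (E × ℂ) × (Fin k → ℂ) → E × (Fin (k + 1) → ℂ) :=
    fun p => (p.1.1, j.insertNth p.1.2 p.2) with hφ
  have hφd : Differentiable ℂ φ :=
    Differentiable.prodMk (by fun_prop) (differentiable_insertNth j (by fun_prop) (by fun_prop))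
  have h1 : IsProperOver (G ×ˢ (univ : Set ℂ)) (φ ⁻¹' Y) := by
    refine ⟨h.isOpen.prod isOpen_univ, fun p hp t => (h.analytic p.1 hp.1 _).preimage hφd,
      fun p hp => ?_⟩
    obtain ⟨C, hC⟩ := h.bounded p.1 hp.1
    refine ⟨C, ?_⟩
    filter_upwards [continuousAt_fst.eventually hC] with q hq w hw
    exact (norm_le_norm_insertNth j q.2 w).2.trans (hq _ hw)
  refine ⟨h.isOpen, fun y hy t => ?_, fun y hy => ?_⟩
  · have h2 := h1.isAnalyticSetAt_image_fst_pi (mk_mem_prod hy (mem_univ t))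
    convert! h2 using 1
    ext ⟨y, t⟩
    simp only [mem_image, Prod.exists, Prod.mk.injEq, exists_and_right, exists_eq_right,
      mem_preimage, hφ]
    constructor
    · rintro ⟨y', w, hw, rfl, rfl⟩
      refine ⟨fun i => w (j.succAbove i), ?_⟩
      have : j.insertNth (w j) (fun i => w (j.succAbove i)) = w := Fin.insertNth_self_removeNth j w
      rwa [this]
    · rintro ⟨w, hw⟩
      exact ⟨y, _, hw, rfl, by simp⟩
  · obtain ⟨C, hC⟩ := h.bounded y hy
    refine ⟨C, ?_⟩
    filter_upwards [hC] with z hz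
    rintro t ⟨⟨z', w⟩, hw, hzw⟩
    obtain ⟨rfl, rfl⟩ := Prod.mk.inj hzw
    exact (norm_le_pi_norm w j).trans (hz w hw)

end AnalyticSets

/-! ### Hankel determinants of power sums -/

section Hankel

/-- The Hankel determinant of size `ν` of the power sums of a finite family of numbers. It is
nonzero when the family has exactly `ν` distinct members, and zero when it has fewer. -/
noncomputable def hankelDet {ι : Type*} [Fintype ι] (ν : ℕ) (Z : ι → ℂ) : ℂ :=
  Matrix.det (Matrix.of fun a b : Fin ν => ∑ i, Z i ^ ((a : ℕ) + b))

theorem hankelDet_eq_zero {ι : Type*} [Fintype ι] [DecidableEq ι] {ν : ℕ} {Z : ι → ℂ}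
    (h : (Finset.univ.image Z).card < ν) : hankelDet ν Z = 0 := by
  -- the coefficients of `∏ (X - s)`, over the distinct members `s`, are in the kernel
  set p : Polynomial ℂ := ∏ s ∈ Finset.univ.image Z, (Polynomial.X - Polynomial.C s) with hp
  have hmon : p.Monic := Polynomial.monic_prod_of_monic _ _ fun s _ => Polynomial.monic_X_sub_C s
  have hdeg : p.natDegree = (Finset.univ.image Z).card := by
    rw [hp, Polynomial.natDegree_prod_of_monic _ _ fun s _ => Polynomial.monic_X_sub_C s]
    simp
  rw [hankelDet, ← Matrix.exists_mulVec_eq_zero_iff]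
  refine ⟨fun b => p.coeff b, fun h0 => ?_, ?_⟩
  · have := congrFun h0 ⟨p.natDegree, hdeg ▸ h⟩
    simp [hmon.coeff_natDegree] at this
  · funext a
    simp only [Matrix.mulVec, dotProduct, Matrix.of_apply, Pi.zero_apply]
    have h1 : ∀ i, ∑ b : Fin ν, Z i ^ (b : ℕ) * p.coeff b = 0 := by
      intro i
      have h2 : p.eval (Z i) = 0 := by
        rw [hp, Polynomial.eval_prod]
        exact Finset.prod_eq_zero (Finset.mem_image_of_mem Z (Finset.mem_univ i)) (by simp)
      rw [Polynomial.eval_eq_sum_range' (hdeg ▸ h : p.natDegree < ν), Finset.sum_range] at h2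
      simpa [mul_comm] using h2
    calc ∑ b : Fin ν, (∑ i, Z i ^ ((a : ℕ) + b)) * p.coeff b
        = ∑ i, Z i ^ (a : ℕ) * ∑ b : Fin ν, Z i ^ (b : ℕ) * p.coeff b := by
          simp only [Finset.sum_mul, Finset.mul_sum]
          rw [Finset.sum_comm]
          refine Finset.sum_congr rfl fun i _ => Finset.sum_congr rfl fun b _ => ?_
          rw [pow_add, mul_assoc]
      _ = 0 := by simp [h1]

theorem hankelDet_ne_zero {ι : Type*} [Fintype ι] [DecidableEq ι] {ν : ℕ} {Z : ι → ℂ}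
    (h : (Finset.univ.image Z).card = ν) : hankelDet ν Z ≠ 0 := by
  -- the matrix is `Vᵀ * diag * V`, with the Vandermonde matrix `V` of the distinct members and the
  -- diagonal matrix of their multiplicities
  set e := (Finset.univ.image Z).equivFinOfCardEq h with he
  set v : Fin ν → ℂ := fun a => (e.symm a : ℂ) with hv
  have hinj : Function.Injective v := fun a b hab => e.symm.injective (Subtype.ext hab)
  set mult : Fin ν → ℂ := fun a => ((Finset.univ.filter fun i => Z i = v a).card : ℂ) with hm
  have hmult : ∀ a, mult a ≠ 0 := by
    intro a
    obtain ⟨i, -, hi⟩ := Finset.mem_image.1 (e.symm a).2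
    simp only [hm, ne_eq, Nat.cast_eq_zero, Finset.card_eq_zero]
    exact Finset.Nonempty.ne_empty ⟨i, by simpa using hi⟩
  have hsum : ∀ F : ℂ → ℂ, ∑ i, F (Z i) = ∑ a, mult a * F (v a) := by
    intro F
    have hfib : ∀ i, ∃ a, Z i = v a := fun i =>
      ⟨e ⟨Z i, Finset.mem_image_of_mem Z (Finset.mem_univ i)⟩, by simp [hv]⟩
    choose α hα using hfib
    rw [← Finset.sum_fiberwise (s := Finset.univ) (g := α)]
    refine Finset.sum_congr rfl fun a _ => ?_
    have : (Finset.univ.filter fun i => α i = a) = Finset.univ.filter fun i => Z i = v a := by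
      ext i
      simp only [Finset.mem_filter, Finset.mem_univ, true_and]
      exact ⟨fun h => h ▸ hα i, fun h => hinj ((hα i).symm.trans h)⟩
    rw [this, Finset.sum_congr rfl (g := fun _ => F (v a)) fun i hi => by
      rw [(Finset.mem_filter.1 hi).2]]
    simp [hm]
  have hM : (Matrix.of fun a b : Fin ν => ∑ i, Z i ^ ((a : ℕ) + b)) =
      (Matrix.vandermonde v).transpose * Matrix.diagonal mult * Matrix.vandermonde v := by
    ext a b
    rw [Matrix.of_apply, hsum fun t => t ^ ((a : ℕ) + b), Matrix.mul_apply]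
    refine Finset.sum_congr rfl fun c _ => ?_
    rw [Matrix.mul_diagonal, Matrix.transpose_apply, Matrix.vandermonde_apply,
      Matrix.vandermonde_apply, pow_add]
    ring
  rw [hankelDet, hM, Matrix.det_mul, Matrix.det_mul, Matrix.det_transpose, Matrix.det_diagonal]
  have h1 := Matrix.det_vandermonde_ne_zero_iff.2 hinj
  exact mul_ne_zero (mul_ne_zero h1 (Finset.prod_ne_zero_iff.2 fun a _ => hmult a)) h1

end Hankel

/-! ### Local structure of proper analytic sets -/

section LocalStructure

variable {E : Type*} [NormedAddCommGroup E] [NormedSpace ℂ E]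

theorem differentiableAt_fun_prod {α : Type*} {S : Finset α} {f : α → E → ℂ} {y : E}
    (h : ∀ a ∈ S, DifferentiableAt ℂ (f a) y) : DifferentiableAt ℂ (fun y => ∏ a ∈ S, f a y) y := by
  classical
  induction S using Finset.induction_on with
  | empty => simp
  | insert a S ha ih =>
    simp only [Finset.prod_insert ha]
    exact (h a (Finset.mem_insert_self _ _)).mul (ih fun b hb => h b (Finset.mem_insert_of_mem hb))

theorem differentiableAt_hankelDet {ι : Type*} [Fintype ι] {Z : E → ι → ℂ} {y : E} (ν : ℕ)
    (h : ∀ l : ℕ, DifferentiableAt ℂ (fun y => ∑ i, Z y i ^ l) y) :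
    DifferentiableAt ℂ (fun y => hankelDet ν (Z y)) y := by
  simp only [hankelDet, Matrix.det_apply, Matrix.of_apply]
  refine DifferentiableAt.fun_sum fun σ _ => ?_
  refine DifferentiableAt.const_smul ?_ _
  exact differentiableAt_fun_prod fun a _ => h _

theorem differentiableAt_prod_sub {ι : Type*} [Fintype ι] {Z : E → ι → ℂ} {p : E × ℂ}
    (h : ∀ l : ℕ, DifferentiableAt ℂ (fun y => ∑ i, Z y i ^ l) p.1) :
    DifferentiableAt ℂ (fun p : E × ℂ => ∏ i, (p.2 - Z p.1 i)) p := by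
  refine differentiableAt_prod_of_psum (x := fun (p : E × ℂ) i => p.2 - Z p.1 i) fun l => ?_
  have : ∀ p : E × ℂ, ∑ i, (p.2 - Z p.1 i) ^ l =
      ∑ m ∈ Finset.range (l + 1), p.2 ^ m * ((-1) ^ (l - m) * ∑ i, Z p.1 i ^ (l - m)) *
          (l.choose m) := by
    intro p
    simp only [sub_eq_add_neg, add_pow]
    rw [Finset.sum_comm]
    refine Finset.sum_congr rfl fun m _ => ?_
    simp only [neg_pow (Z p.1 _) (l - m)]
    rw [← Finset.sum_mul, ← Finset.mul_sum, ← Finset.mul_sum]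
  simp only [this]
  refine DifferentiableAt.fun_sum fun m _ => ?_
  refine DifferentiableAt.mul_const (DifferentiableAt.mul (by fun_prop)
    (DifferentiableAt.const_mul ?_ _)) _
  exact DifferentiableAt.comp (g := fun y => ∑ i, Z y i ^ (l - m)) p (h (l - m))
      differentiableAt_fst

/-- Where the number of distinct members of the family `Z y`, whose power sums are holomorphic,
is maximal, these members are given by holomorphic functions: by the logarithmic residue formula
for `∏ (t - Z y i)` in a small disc, in which all the roots coincide. -/
theorem exists_root_branches {ι : Type} [Fintype ι] [DecidableEq ι] {Z : E → ι → ℂ} {y₁ : E} {ν : ℕ}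
    (hd : ∀ᶠ y in 𝓝 y₁, ∀ l : ℕ, DifferentiableAt ℂ (fun y => ∑ i, Z y i ^ l) y)
    (hν : ∀ᶠ y in 𝓝 y₁, (Finset.univ.image (Z y)).card ≤ ν)
    (hν₁ : ν ≤ (Finset.univ.image (Z y₁)).card) :
    ∃ (κ : Type) (_ : Fintype κ) (ρ : κ → E → ℂ), ∀ᶠ y in 𝓝 y₁,
      (∀ a, DifferentiableAt ℂ (ρ a) y) ∧ (∀ i, ∃ a, Z y i = ρ a y) ∧
      Function.Injective fun a => ρ a y := by
  classical
  obtain ⟨B₀, hB₀, hB₀o, hyB₀⟩ := _root_.eventually_nhds_iff.1 hd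
  set S := Finset.univ.image (Z y₁) with hS
  set q : E × ℂ → ℂ := fun p => ∏ i, (p.2 - Z p.1 i) with hq
  have hqd : DifferentiableOn ℂ q (B₀ ×ˢ univ) := fun p hp =>
    (differentiableAt_prod_sub (hB₀ p.1 hp.1)).differentiableWithinAt
  have hq0 : ∀ y t, q (y, t) = 0 ↔ ∃ i, Z y i = t := by
    intro y t
    simp only [hq, Finset.prod_eq_zero_iff, Finset.mem_univ, true_and, sub_eq_zero]
    exact exists_congr fun i => eq_comm
  -- disjoint discs around the distinct members at `y₁`
  obtain ⟨ε, hε, hdisj⟩ : ∃ ε > 0, ∀ s ∈ S, ∀ t ∈ S, s ≠ t → 2 * ε < dist s t := by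
    have : ∀ᶠ ε in 𝓝[>] (0 : ℝ), ∀ s ∈ S, ∀ t ∈ S, s ≠ t → 2 * ε < dist s t := by
      simp only [Finset.eventually_all]
      intro s _ t _
      by_cases hst : s = t
      · simp [hst]
      · have h1 : 0 < dist s t := dist_pos.2 hst
        filter_upwards [Ioo_mem_nhdsGT (show (0 : ℝ) < dist s t / 2 by positivity)] with x hx _
        linarith [hx.2]
    obtain ⟨ε, hε, hε0⟩ := (this.and self_mem_nhdsWithin).exists
    exact ⟨ε, hε0, hε⟩
  have hdj : ∀ s ∈ S, ∀ t ∈ S, ∀ x, x ∈ closedBall s ε → x ∈ closedBall t ε → s = t := by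
    intro s hs t ht x hxs hxt
    by_contra hst
    have h1 := hdisj s hs t ht hst
    have h2 := dist_triangle_left s t x
    rw [mem_closedBall] at hxs hxt
    linarith
  have hsph : ∀ s ∈ S, ∀ t ∈ sphere s ε, q (y₁, t) ≠ 0 := by
    intro s hs t ht h0
    obtain ⟨i, hi⟩ := (hq0 y₁ t).1 h0
    have htS : t ∈ S := hi ▸ Finset.mem_image_of_mem _ (Finset.mem_univ i)
    have hst : s = t := hdj s hs t htS t (sphere_subset_closedBall ht) (mem_closedBall_self hε.le)
    subst hst
    simp at ht
    linarith
  -- each disc contains at least one root; the mean of its roots is the branch in question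
  choose B hBo hyB _ _ d Zs hZs hZG using fun s : S =>
    exists_zero_functions (hB₀o.prod isOpen_univ) hqd hε
      (fun t _ => mk_mem_prod hyB₀ (mem_univ t)) (hsph s s.2)
  have hdpos : ∀ s : S, 0 < d s := by
    intro s
    obtain ⟨i, -, hi⟩ := Finset.mem_image.1 s.2
    obtain ⟨a, -⟩ := (hZs s y₁ (hyB s) s).2 ⟨mem_closedBall_self hε.le, (hq0 y₁ s).2 ⟨i, hi⟩⟩
    exact a.pos
  refine ⟨S, inferInstance, fun s y => (d s : ℂ)⁻¹ * ∑ i, Zs s y i, ?_⟩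
  have hBall : ∀ᶠ y in 𝓝 y₁, ∀ s : S, y ∈ B s :=
    eventually_all.2 fun s => (hBo s).mem_nhds (hyB s)
  filter_upwards [hBall, hν, eventually_eventually_nhds.2 hBall] with y hy hyν hyev
  -- one root chosen in each disc already exhausts the family
  set r : S → ℂ := fun s => Zs s y ⟨0, hdpos s⟩ with hr
  have hroot : ∀ s : S, ∀ i,
      Zs s y i ∈ closedBall (s : ℂ) ε ∧ Zs s y i ∈ Finset.univ.image (Z y) := by
    intro s i
    obtain ⟨h1, h2⟩ := (hZs s y (hy s) _).1 ⟨i, rfl⟩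
    obtain ⟨j, hj⟩ := (hq0 _ _).1 h2
    exact ⟨h1, Finset.mem_image.2 ⟨j, Finset.mem_univ j, hj⟩⟩
  have hrinj : Function.Injective r := by
    intro s t hst
    refine Subtype.ext (hdj s s.2 t t.2 (r s) (hroot s _).1 ?_)
    rw [hst]
    exact (hroot t _).1
  have himg : Finset.univ.image r = Finset.univ.image (Z y) := by
    refine Finset.eq_of_subset_of_card_le ?_ ?_
    · intro x hx
      obtain ⟨s, -, rfl⟩ := Finset.mem_image.1 hx
      exact (hroot s _).2
    · rw [Finset.card_image_of_injective _ hrinj, Finset.card_univ, Fintype.card_coe]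
      exact hyν.trans hν₁
  have hall : ∀ s i, Zs s y i = r s := by
    intro s i
    have h1 := (hroot s i).2
    rw [← himg] at h1
    obtain ⟨t, -, ht⟩ := Finset.mem_image.1 h1
    have : t = s := Subtype.ext (hdj t t.2 s s.2 (r t) (hroot t _).1 (ht ▸ (hroot s i).1))
    rw [← ht, this]
  have hρ : ∀ s : S, (d s : ℂ)⁻¹ * ∑ i, Zs s y i = r s := by
    intro s
    have : (d s : ℂ) ≠ 0 := Nat.cast_ne_zero.2 (hdpos s).ne'
    simp only [hall, Finset.sum_const, Finset.card_univ, Fintype.card_fin, nsmul_eq_mul]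
    rw [inv_mul_cancel_left₀ this]
  refine ⟨fun s => ?_, fun i => ?_, ?_⟩
  · refine DifferentiableAt.const_mul ?_ _
    exact hZG s univ (fun p => p.2) isOpen_univ (by fun_prop) y (hy s) (by simp)
  · have h1 : Z y i ∈ Finset.univ.image (Z y) := Finset.mem_image_of_mem _ (Finset.mem_univ i)
    rw [← himg] at h1
    obtain ⟨s, -, hs⟩ := Finset.mem_image.1 h1
    exact ⟨s, by rw [hρ s, hs]⟩
  · intro s t hst
    simp only [hρ] at hst
    exact hrinj hst

/-- Off the zero set of a holomorphic `δ ≢ 0`, the members of a finite family with holomorphic power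
sums are given by holomorphic functions. Here `δ` is the Hankel determinant whose size `ν` is the
largest number of distinct members: it is nonzero exactly where this number is attained. -/
theorem exists_ball_discriminant {ι : Type} [Fintype ι] {Z : E → ι → ℂ} {y₀ : E}
    (hd : ∀ᶠ y in 𝓝 y₀, ∀ l : ℕ, DifferentiableAt ℂ (fun y => ∑ i, Z y i ^ l) y) :
    ∃ r > 0, ∃ δ : E → ℂ, DifferentiableOn ℂ δ (ball y₀ r) ∧ (∃ p ∈ ball y₀ r, δ p ≠ 0) ∧
      ∀ z ∈ ball y₀ r, δ z ≠ 0 → ∃ (κ : Type) (_ : Fintype κ) (ρ : κ → E → ℂ), ∀ᶠ y in 𝓝 z,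
        (∀ a, DifferentiableAt ℂ (ρ a) y) ∧ (∀ i, ∃ a, Z y i = ρ a y) ∧
        Function.Injective fun a => ρ a y := by
  classical
  obtain ⟨r, hr, hball⟩ := Metric.eventually_nhds_iff_ball.1 hd
  have hbd : BddAbove (range fun y : ball y₀ r => (Finset.univ.image (Z y)).card) :=
    ⟨Fintype.card ι, by
      rintro _ ⟨y, rfl⟩
      exact Finset.card_image_le⟩
  have : Nonempty (ball y₀ r) := ⟨⟨y₀, mem_ball_self hr⟩⟩
  obtain ⟨p, hp⟩ := Nat.sSup_mem (range_nonempty _) hbd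
  set ν := sSup (range fun y : ball y₀ r => (Finset.univ.image (Z y)).card) with hν
  have hle : ∀ y ∈ ball y₀ r, (Finset.univ.image (Z y)).card ≤ ν := fun y hy =>
    le_csSup hbd ⟨⟨y, hy⟩, rfl⟩
  refine ⟨r, hr, fun y => hankelDet ν (Z y), fun y hy =>
    (differentiableAt_hankelDet ν (hball y hy)).differentiableWithinAt,
    ⟨p, p.2, hankelDet_ne_zero hp⟩, fun z hz hz0 => ?_⟩
  refine exists_root_branches (ν := ν) ?_ ?_ (not_lt.1 fun h => hz0 (hankelDet_eq_zero h))
  · filter_upwards [isOpen_ball.mem_nhds hz] with y hy using hball y hy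
  · filter_upwards [isOpen_ball.mem_nhds hz] with y hy using hle y hy

theorem exists_prod_ne_zero {α : Type*} {S : Finset α} {δ : α → E → ℂ} {x : E} {r : ℝ} (hr : 0 < r)
    (hδ : ∀ j ∈ S, DifferentiableOn ℂ (δ j) (ball x r)) (hne : ∀ j ∈ S, ∃ p ∈ ball x r, δ j p ≠ 0) :
    ∃ p ∈ ball x r, ∏ j ∈ S, δ j p ≠ 0 := by
  classical
  induction S using Finset.induction_on with
  | empty => exact ⟨x, mem_ball_self hr, by simp⟩
  | insert a S ha ih =>
    obtain ⟨p, hp, hp0⟩ := ih (fun j hj => hδ j (Finset.mem_insert_of_mem hj))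
      fun j hj => hne j (Finset.mem_insert_of_mem hj)
    obtain ⟨p', hp', hp'0⟩ := hne a (Finset.mem_insert_self _ _)
    have hprod : DifferentiableOn ℂ (fun y => ∏ j ∈ S, δ j y) (ball x r) :=
      fun y hy => (differentiableAt_fun_prod fun j hj => (hδ j
        (Finset.mem_insert_of_mem hj)).differentiableAt
            (isOpen_ball.mem_nhds hy)).differentiableWithinAt
    have h1 := (hprod.differentiableAt (isOpen_ball.mem_nhds hp)).continuousAt.eventually_ne hp0
    obtain ⟨z, hz0, hz, hzb⟩ := ((dense_ne_zero_of_ne_zero (hδ a (Finset.mem_insert_self _ _))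
      hp' hp'0 hp).and_eventually (h1.and (isOpen_ball.mem_nhds hp))).exists
    exact ⟨z, hzb, by rw [Finset.prod_insert ha]; exact mul_ne_zero hz0 hz⟩

/-- Over a neighbourhood of `z`, the set `Y` is a disjoint union of finitely many graphs of
holomorphic functions. -/
def IsUnionOfGraphsAt {F : Type*} [NormedAddCommGroup F] [NormedSpace ℂ F] (Y : Set (E × F))
    (z : E) : Prop :=
  ∃ (κ : Type) (_ : Fintype κ) (c : κ → E → F), ∀ᶠ y in 𝓝 z,
    (∀ a, DifferentiableAt ℂ (c a) y) ∧ (Function.Injective fun a => c a y) ∧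
    ∀ w, (y, w) ∈ Y ↔ ∃ a, c a y = w

/-- If finitely many disjoint holomorphic graphs cover `Y`, and `Y` has no part lying over a set
without interior, then `Y` is the union of some of these graphs. -/
theorem isUnionOfGraphsAt_of_cover {F : Type*} [NormedAddCommGroup F] [NormedSpace ℂ F]
    {G : Set E} {Y : Set (E × F)} (hY : IsProperOver G Y)
    (hC : ∀ p ∈ Y, p.1 ∈ G → ∀ O ∈ 𝓝 p, (interior (Prod.fst '' (Y ∩ O))).Nonempty)
    {z : E} (hz : z ∈ G) {κ : Type} [Fintype κ] {c : κ → E → F}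
    (hc : ∀ᶠ y in 𝓝 z, (∀ a, DifferentiableAt ℂ (c a) y) ∧ (Function.Injective fun a => c a y) ∧
      ∀ w, (y, w) ∈ Y → ∃ a, c a y = w) : IsUnionOfGraphsAt Y z := by
  classical
  obtain ⟨r, hr, hball⟩ := Metric.eventually_nhds_iff_ball.1 (hc.and (hY.isOpen.mem_nhds hz))
  -- A graph that meets `Y` is contained in `Y`: the interior `N` of the set of points over which
  -- this is the case is nonempty by `hC`, and closed in the ball by the identity theorem.
  have key : ∀ a, (∃ y ∈ ball z r, (y, c a y) ∈ Y) → ∀ y ∈ ball z r, (y, c a y) ∈ Y := by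
    rintro a ⟨y₁, hy₁, hy₁Y⟩
    have hcc : ∀ a, ∀ y ∈ ball z r, ContinuousAt (c a) y := fun a y hy =>
      ((hball y hy).1.1 a).continuousAt
    have hO : {p : E × F | p.1 ∈ ball z r ∧ ∀ a', a' ≠ a → p.2 ≠ c a' p.1} ∈ 𝓝 (y₁, c a y₁) := by
      refine inter_mem ((isOpen_ball.preimage continuous_fst).mem_nhds hy₁) ?_
      refine eventually_all.2 fun a' => ?_
      by_cases ha' : a' = a
      · simp [ha']
      · have h1 : ContinuousAt (fun p : E × F => p.2 - c a' p.1) (y₁, c a y₁) :=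
          continuousAt_snd.sub (ContinuousAt.comp (f := Prod.fst) (hcc a' y₁ hy₁) continuousAt_fst)
        have h2 : c a y₁ - c a' y₁ ≠ 0 := sub_ne_zero.2 fun h => ha' ((hball y₁ hy₁).1.2.1 h).symm
        filter_upwards [h1.eventually_ne h2] with p hp _ h3
        exact hp (sub_eq_zero.2 h3)
    obtain ⟨u, hu⟩ := hC _ hy₁Y (hball y₁ hy₁).2 _ hO
    have hsub : Prod.fst '' (Y ∩ {p : E × F | p.1 ∈ ball z r ∧ ∀ a', a' ≠ a → p.2 ≠ c a' p.1}) ⊆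
        {y | y ∈ ball z r ∧ (y, c a y) ∈ Y} := by
      rintro _ ⟨⟨y, w⟩, ⟨hyw, hy, hne⟩, rfl⟩
      obtain ⟨a', rfl⟩ := (hball y hy).1.2.2 w hyw
      by_cases ha' : a' = a
      · subst ha'
        exact ⟨hy, hyw⟩
      · exact (hne a' ha' rfl).elim
    set N : Set E := {y | ∀ᶠ x in 𝓝 y, (x, c a x) ∈ Y} with hN
    have huN : u ∈ N := by
      filter_upwards [mem_interior_iff_mem_nhds.1 hu] with x hx using (hsub hx).2
    have hub : u ∈ ball z r := (hsub (interior_subset hu)).1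
    have hNo : IsOpen N := by
      rw [isOpen_iff_mem_nhds]
      exact fun s hs => eventually_eventually_nhds.2 hs
    have hsubN : ball z r ⊆ N := by
      refine (convex_ball z r).isPreconnected.subset_of_closure_inter_subset hNo ⟨u, hub, huN⟩ ?_
      rintro y ⟨hyN, hy⟩
      -- the functions defining `Y` vanish on the graph over an open set close to `y`, hence near
      -- `y`
      obtain ⟨U, hU, hpU, ι, _, f, hf, hYU⟩ := hY.analytic y (hball y hy).2 (c a y)
      have hgc : ContinuousAt (fun x => (x, c a x)) y := continuousAt_id.prodMk (hcc a y hy)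
      obtain ⟨s, hs, hsb⟩ := Metric.eventually_nhds_iff_ball.1
        (inter_mem (hgc.preimage_mem_nhds (hU.mem_nhds hpU)) (isOpen_ball.mem_nhds hy))
      have hfd : ∀ i, DifferentiableOn ℂ (fun x => f i (x, c a x)) (ball y s) := fun i x hx =>
        (DifferentiableAt.comp x ((hf i).differentiableAt (hU.mem_nhds (hsb x hx).1))
          (differentiableAt_id.prodMk ((hball x (hsb x hx).2).1.1 a))).differentiableWithinAt
      obtain ⟨x, hxN, hx⟩ := ((mem_closure_iff_frequently.1 hyN).and_eventually
        (ball_mem_nhds y hs)).exists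
      have hzero : ∀ i, ∀ x ∈ ball y s, f i (x, c a x) = 0 := fun i => by
        refine eqOn_zero_ball_of_eventuallyEq_zero (hfd i) hx ?_
        filter_upwards [hxN, isOpen_ball.mem_nhds hx] with x' hx' hx'b
        exact (hYU _ (hsb x' hx'b).1).1 hx' i
      show ∀ᶠ x in 𝓝 y, (x, c a x) ∈ Y
      filter_upwards [ball_mem_nhds y hs] with x hx
      exact (hYU _ (hsb x hx).1).2 fun i => hzero i x hx
    intro y hy
    have : ∀ᶠ x in 𝓝 y, (x, c a x) ∈ Y := hsubN hy
    exact this.self_of_nhds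
  refine ⟨{a : κ // (z, c a z) ∈ Y}, inferInstance, fun a => c a.1, ?_⟩
  filter_upwards [ball_mem_nhds z hr] with y hy
  obtain ⟨⟨h1, h2, h3⟩, -⟩ := hball y hy
  refine ⟨fun a => h1 a, fun a b hab => Subtype.ext (h2 hab), fun w => ⟨fun hw => ?_, ?_⟩⟩
  · obtain ⟨a, rfl⟩ := h3 w hw
    exact ⟨⟨a, key a ⟨y, hy, hw⟩ z (mem_ball_self hr)⟩, rfl⟩
  · rintro ⟨⟨a, ha⟩, rfl⟩
    exact key a ⟨z, mem_ball_self hr, ha⟩ y hy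

/-- Off the zero set of a holomorphic `δ ≢ 0`, a proper analytic set without parts lying over sets
without interior is locally a disjoint union of holomorphic graphs. -/
theorem IsProperOver.exists_discriminant {k : ℕ} {G : Set E} {Y : Set (E × (Fin k → ℂ))}
    (hY : IsProperOver G Y)
    (hC : ∀ p ∈ Y, p.1 ∈ G → ∀ O ∈ 𝓝 p, (interior (Prod.fst '' (Y ∩ O))).Nonempty)
    {y₀ : E} (hy₀ : y₀ ∈ G) :
    ∃ r > 0, ∃ δ : E → ℂ, DifferentiableOn ℂ δ (ball y₀ r) ∧ (∃ p ∈ ball y₀ r, δ p ≠ 0) ∧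
      ∀ z ∈ ball y₀ r, δ z ≠ 0 → IsUnionOfGraphsAt Y z := by
  classical
  -- the graphs are the combinations of root branches for the single coordinates
  choose ι hι Z hZ using fun j => (hY.image_coord j).exists_root_functions hy₀
  choose r hr δ hδ hδ0 hδs using fun j =>
    exists_ball_discriminant ((hZ j).mono fun y hy => hy.2)
  obtain ⟨s, hs, hsb⟩ := Metric.eventually_nhds_iff_ball.1 (((eventually_all.2 hZ).and
    (eventually_all.2 fun j => ball_mem_nhds y₀ (hr j))).and (hY.isOpen.mem_nhds hy₀))
  have hsub : ∀ j, ball y₀ s ⊆ ball y₀ (r j) := fun j y hy => (hsb y hy).1.2 j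
  have hδd : ∀ j ∈ Finset.univ, DifferentiableOn ℂ (δ j) (ball y₀ s) := fun j _ =>
    (hδ j).mono (hsub j)
  refine ⟨s, hs, fun y => ∏ j, δ j y, fun y hy => (differentiableAt_fun_prod fun j hj =>
      (hδd j hj).differentiableAt (isOpen_ball.mem_nhds hy)).differentiableWithinAt,
    exists_prod_ne_zero hs hδd fun j _ => ?_, fun z hz hz0 => ?_⟩
  · obtain ⟨p, hp, hp0⟩ := hδ0 j
    obtain ⟨x, hx0, hx⟩ := ((dense_ne_zero_of_ne_zero (hδ j) hp hp0
      (mem_ball_self (hr j))).and_eventually (ball_mem_nhds y₀ hs)).exists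
    exact ⟨x, hx, hx0⟩
  · have hz0' : ∀ j, δ j z ≠ 0 := fun j => Finset.prod_ne_zero_iff.1 hz0 j (Finset.mem_univ j)
    choose κ hκ ρ hρ using fun j => hδs j z (hsub j hz) (hz0' j)
    refine isUnionOfGraphsAt_of_cover hY hC (hsb z hz).2 (κ := ∀ j, κ j)
      (c := fun a y j => ρ j (a j) y) ?_
    filter_upwards [eventually_all.2 hρ, isOpen_ball.mem_nhds hz] with y hy hyb
    refine ⟨fun a => differentiableAt_pi.2 fun j => (hy j).1 (a j), fun a b hab => ?_,
        fun w hw => ?_⟩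
    · funext j
      exact (hy j).2.2 (congrFun hab j)
    · have h1 : ∀ j, ∃ a, ρ j a y = w j := by
        intro j
        obtain ⟨i, hi⟩ := ((hsb y hyb).1.1 j).1 (w j) ⟨(y, w), hw, rfl⟩
        obtain ⟨a, ha⟩ := (hy j).2.1 i
        exact ⟨a, ha.symm.trans hi⟩
      choose a ha using h1
      exact ⟨a, funext ha⟩

/-- The fibres of a proper analytic set are finite, of locally bounded cardinality. -/
theorem IsProperOver.exists_ncard_fiber_le {k : ℕ} {G : Set E} {Y : Set (E × (Fin k → ℂ))}
    (hY : IsProperOver G Y) {y₀ : E} (hy₀ : y₀ ∈ G) :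
    ∃ C : ℕ, ∀ᶠ y in 𝓝 y₀, {w | (y, w) ∈ Y}.Finite ∧ {w | (y, w) ∈ Y}.ncard ≤ C := by
  classical
  choose ι hι Z hZ using fun j => (hY.image_coord j).exists_root_functions hy₀
  refine ⟨Fintype.card (∀ j, ι j), ?_⟩
  filter_upwards [eventually_all.2 hZ] with y hy
  have hsub : {w | (y, w) ∈ Y} ⊆ range fun (a : ∀ j, ι j) j => Z j y (a j) := by
    intro w hw
    have h1 : ∀ j, ∃ i, Z j y i = w j := fun j => (hy j).1 (w j) ⟨(y, w), hw, rfl⟩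
    choose a ha using h1
    exact ⟨a, funext ha⟩
  refine ⟨(finite_range _).subset hsub, (ncard_le_ncard hsub (finite_range _)).trans ?_⟩
  rw [← Nat.card_coe_set_eq, ← Nat.card_eq_fintype_card]
  exact Finite.card_range_le _

end LocalStructure

/-! ### Projection of submanifolds with finite fibres -/

section RegularPoints

/-- If the analytic set `Y ⊆ E × F` has finite fibres over `E` and is, near a point `p`, a
submanifold of the dimension of `E`, then the part of `Y` near `p` does not lie over a set without
interior. At a point `q` of `Y` near `p` where the kernel `K` of `(f', dπ)` has the smallest
dimension, either `K = 0` and `(f, π)` is a local isomorphism, or `π` is constant along a curve in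
`Y` in the direction of a vector of `K`, which the finiteness of the fibres excludes. -/
theorem nonempty_interior_image_of_submersion {E F V : Type*}
    [NormedAddCommGroup E] [NormedSpace ℂ E] [FiniteDimensional ℂ E]
    [NormedAddCommGroup F] [NormedSpace ℂ F] [FiniteDimensional ℂ F]
    [NormedAddCommGroup V] [NormedSpace ℂ V] [FiniteDimensional ℂ V]
    (hdim : Module.finrank ℂ V = Module.finrank ℂ F)
    {Y U : Set (E × F)} (hU : IsOpen U) {f : E × F → V} (hf : DifferentiableOn ℂ f U)
    (hsurj : ∀ x ∈ U, Function.Surjective (fderiv ℂ f x))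
    (hYU : ∀ x ∈ U, x ∈ Y ↔ f x = 0) (hfin : ∀ x ∈ Y ∩ U, {w | (x.1, w) ∈ Y}.Finite)
    (hne : (Y ∩ U).Nonempty) : (interior (Prod.fst '' (Y ∩ U))).Nonempty := by
  have : CompleteSpace E := FiniteDimensional.complete ℂ E
  have : CompleteSpace F := FiniteDimensional.complete ℂ F
  have : CompleteSpace V := FiniteDimensional.complete ℂ V
  set L : E × F → (E × F →ₗ[ℂ] V × E) := fun x =>
    ((fderiv ℂ f x).prod (ContinuousLinearMap.fst ℂ E F)).toLinearMap with hL
  have hLapp : ∀ x v, L x v = (fderiv ℂ f x v, v.1) := fun x v => rfl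
  have hmem := Nat.sInf_mem (hne.image fun x => Module.finrank ℂ (LinearMap.ker (L x)))
  obtain ⟨q, hq, hqmin⟩ := hmem
  have hmin : ∀ x ∈ Y ∩ U, Module.finrank ℂ (LinearMap.ker (L q)) ≤
      Module.finrank ℂ (LinearMap.ker (L x)) := fun x hx =>
    hqmin.le.trans (Nat.sInf_le (mem_image_of_mem _ hx))
  have hfq : f q = 0 := (hYU q hq.2).1 hq.1
  set K := LinearMap.ker (L q) with hK
  by_cases hK0 : K = ⊥
  · -- `(f, π)` is a local isomorphism
    have hstrict : HasStrictFDerivAt (fun x => (f x, x.1))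
        ((fderiv ℂ f q).prod (ContinuousLinearMap.fst ℂ E F)) q :=
      ((contDiffAt_one_of_differentiableOn hU hf hq.2).hasStrictFDerivAt one_ne_zero).prodMk
        hasStrictFDerivAt_fst
    have hrange : ((fderiv ℂ f q).prod (ContinuousLinearMap.fst ℂ E F)).range = ⊤ := by
      have h1 : Function.Injective (L q) := LinearMap.ker_eq_bot.1 hK0
      have h2 : Module.finrank ℂ (E × F) = Module.finrank ℂ (V × E) := by
        rw [Module.finrank_prod, Module.finrank_prod, hdim, add_comm]
      exact LinearMap.range_eq_top.2
          ((LinearMap.injective_iff_surjective_of_finrank_eq_finrank h2).1 h1)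
    have hmap := hstrict.map_nhds_eq_of_surj hrange
    have hUimg : (fun x => (f x, x.1)) '' U ∈ 𝓝 (f q, q.1) := by
      rw [← hmap]
      exact image_mem_map (hU.mem_nhds hq.2)
    refine ⟨q.1, mem_interior_iff_mem_nhds.2 ?_⟩
    have hc : ContinuousAt (fun y : E => ((0 : V), y)) q.1 := by fun_prop
    rw [hfq] at hUimg
    filter_upwards [hc.preimage_mem_nhds hUimg] with y hy
    obtain ⟨x, hx, hxy⟩ := hy
    obtain ⟨h1, h2⟩ := Prod.mk.inj hxy
    exact ⟨x, ⟨(hYU x hx).2 h1, hx⟩, h2⟩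
  · exfalso
    obtain ⟨k, hkK, hk0⟩ := (Submodule.ne_bot_iff K).1 hK0
    -- A local chart `Ψ = (f, P ∘ π, κ)` at `q`: `R` is the image of the kernel of `f'` under `π`,
    -- and `P`, `κ` are projections onto `R` and `K`.
    set A := fderiv ℂ f q with hA
    set R := (LinearMap.ker A.toLinearMap).map (LinearMap.fst ℂ E F) with hR
    obtain ⟨P₀, hP₀⟩ := R.subtype.exists_leftInverse_of_injective R.ker_subtype
    obtain ⟨κ₀, hκ₀⟩ := K.subtype.exists_leftInverse_of_injective K.ker_subtype
    set P : E →L[ℂ] R := LinearMap.toContinuousLinearMap P₀ with hPdef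
    set κ : E × F →L[ℂ] K := LinearMap.toContinuousLinearMap κ₀ with hκdef
    have hP : ∀ v : R, P v = v := fun v => LinearMap.congr_fun hP₀ v
    have hκ : ∀ v : K, κ v = v := fun v => LinearMap.congr_fun hκ₀ v
    set Ψ : E × F → (V × R) × K := fun x => ((f x, P x.1), κ x) with hΨ
    have hΨd : DifferentiableOn ℂ Ψ U := fun x hx =>
      (((hf x hx).prodMk (by fun_prop)).prodMk (by fun_prop))
    have hΨ' : ∀ x ∈ U, ∀ v, fderiv ℂ Ψ x v = ((fderiv ℂ f x v, P v.1), κ v) := by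
      intro x hx v
      have h1 : HasFDerivAt f (fderiv ℂ f x) x := (hf.differentiableAt (hU.mem_nhds hx)).hasFDerivAt
      have h2 : HasFDerivAt (fun x : E × F => P x.1) (P.comp (ContinuousLinearMap.fst ℂ E F)) x :=
        (P.comp (ContinuousLinearMap.fst ℂ E F)).hasFDerivAt
      have h3 : HasFDerivAt Ψ
          (((fderiv ℂ f x).prod (P.comp (ContinuousLinearMap.fst ℂ E F))).prod κ) x :=
        (h1.prodMk h2).prodMk κ.hasFDerivAt
      rw [h3.fderiv]
      rfl
    have hkerq : ∀ v, A v = 0 → P v.1 = 0 → v ∈ K := by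
      intro v h1 h2
      have h3 : v.1 ∈ R := ⟨v, h1, rfl⟩
      have h4 := hP ⟨v.1, h3⟩
      rw [h2] at h4
      rw [hK, LinearMap.mem_ker, hLapp]
      exact Prod.ext h1 (congrArg Subtype.val h4).symm
    have hKker : ∀ v ∈ K, A v = 0 ∧ v.1 = 0 := fun v hv => by
      rw [hK, LinearMap.mem_ker, hLapp] at hv
      exact Prod.mk.inj hv
    have hinj : Function.Injective (fderiv ℂ Ψ q) := by
      rw [injective_iff_map_eq_zero]
      intro v hv
      rw [hΨ' q hq.2] at hv
      obtain ⟨h12, h3⟩ := Prod.mk.inj hv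
      obtain ⟨h1, h2⟩ := Prod.mk.inj h12
      have h4 := hκ ⟨v, hkerq v h1 h2⟩
      rw [h3] at h4
      exact (congrArg Subtype.val h4).symm
    have hsur : Function.Surjective (fderiv ℂ Ψ q) := by
      rintro ⟨⟨a, b⟩, c⟩
      obtain ⟨v, hv⟩ := hsurj q hq.2 a
      obtain ⟨u, hu, huR⟩ := (b - P v.1).2
      have hu' : A u = 0 := hu
      have h1 : P u.1 = b - P v.1 := by
        have := hP (b - P v.1)
        rw [← huR] at this
        exact this
      refine ⟨v + u + (c - κ (v + u) : K), ?_⟩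
      have h2 := hKker _ (c - κ (v + u) : K).2
      rw [hΨ' q hq.2]
      refine Prod.ext (Prod.ext ?_ ?_) ?_
      · show A (v + u + (c - κ (v + u) : K)) = a
        rw [map_add, map_add, hu', h2.1, add_zero, add_zero]
        exact hv
      · show P (v + u + ((c - κ (v + u) : K) : E × F)).1 = b
        rw [Prod.fst_add, Prod.fst_add, h2.2, add_zero, map_add, h1]
        abel
      · show κ (v + u + (c - κ (v + u) : K)) = c
        rw [map_add, hκ]
        abel
    set e : (E × F) ≃L[ℂ] (V × R) × K := ContinuousLinearEquiv.ofBijective (fderiv ℂ Ψ q)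
      (LinearMap.ker_eq_bot.2 hinj) (LinearMap.range_eq_top.2 hsur) with he
    have hee : (e : E × F →L[ℂ] (V × R) × K) = fderiv ℂ Ψ q := by
      ext v <;> rfl
    have hCD : ContDiffAt ℂ 1 Ψ q := contDiffAt_one_of_differentiableOn hU hΨd hq.2
    have hFD : HasFDerivAt Ψ (e : E × F →L[ℂ] (V × R) × K) q := by
      rw [hee]
      exact (hΨd.differentiableAt (hU.mem_nhds hq.2)).hasFDerivAt
    -- near `q`, the derivative of `Ψ` stays injective, so the kernel does not grow
    have hinj' : ∀ᶠ x in 𝓝 q, Function.Injective (fderiv ℂ Ψ x) := by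
      have h1 := (continuousOn_fderiv_of_differentiableOn hU hΨd).continuousAt (hU.mem_nhds hq.2)
      have h2 := ContinuousLinearEquiv.nhds e
      rw [hee] at h2
      filter_upwards [h1.preimage_mem_nhds h2] with x hx
      obtain ⟨e', he'⟩ := hx
      rw [← he']
      exact e'.injective
    -- The kernel of `(f', P ∘ π)` at `x` embeds into `K` by `κ`. By minimality of `dim K` it is not
    -- larger than the kernel of `(f', π)`.
    have hker : ∀ᶠ x in 𝓝 q, x ∈ U ∧ (x ∈ Y → ∀ v, fderiv ℂ f x v = 0 → P v.1 = 0 → v.1 = 0) := by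
      filter_upwards [hinj', hU.mem_nhds hq.2] with x hx hxU
      refine ⟨hxU, fun hxY v hv1 hv2 => ?_⟩
      set N : Submodule ℂ (E × F) := LinearMap.ker
        ((fderiv ℂ f x).prod (P.comp (ContinuousLinearMap.fst ℂ E F))).toLinearMap with hN
      have hNmem : ∀ v, v ∈ N ↔ fderiv ℂ f x v = 0 ∧ P v.1 = 0 := fun v => by
        rw [hN, LinearMap.mem_ker]
        exact Prod.mk_eq_zero
      have hle : LinearMap.ker (L x) ≤ N := by
        intro v hv
        rw [LinearMap.mem_ker, hLapp] at hv
        obtain ⟨h1, h2⟩ := Prod.mk.inj hv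
        exact (hNmem v).2 ⟨h1, by rw [h2, map_zero]⟩
      have hNK : Module.finrank ℂ N ≤ Module.finrank ℂ K := by
        refine LinearMap.finrank_le_finrank_of_injective (f := κ.toLinearMap.comp N.subtype) ?_
        rw [injective_iff_map_eq_zero]
        rintro ⟨u, hu⟩ h0
        obtain ⟨h1, h2⟩ := (hNmem u).1 hu
        refine Subtype.ext ((injective_iff_map_eq_zero _).1 hx u ?_)
        rw [hΨ' x hxU, h1, h2]
        exact Prod.ext rfl h0
      have heq := Submodule.eq_of_le_of_finrank_le hle (hNK.trans (hmin x ⟨hxY, hxU⟩))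
      have hvN : v ∈ N := (hNmem v).2 ⟨hv1, hv2⟩
      rw [← heq, LinearMap.mem_ker, hLapp] at hvN
      exact (Prod.mk.inj hvN).2
    -- the curve on which `f` and `P ∘ π` are constant and `κ` moves in the direction of `k`
    set g := hCD.localInverse hFD one_ne_zero with hg
    have hgC : ContDiffAt ℂ 1 g (Ψ q) := hCD.to_localInverse hFD one_ne_zero
    have hgq : g (Ψ q) = q := hCD.localInverse_apply_image hFD one_ne_zero
    have hgd : ∀ᶠ z in 𝓝 (Ψ q), DifferentiableAt ℂ g z :=
      (hgC.eventually (by simp)).mono fun z hz => hz.differentiableAt one_ne_zero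
    have hright : ∀ᶠ z in 𝓝 (Ψ q), Ψ (g z) = z :=
      (hCD.hasStrictFDerivAt' hFD one_ne_zero).eventually_right_inverse
    have hgt : ∀ᶠ z in 𝓝 (Ψ q),
        g z ∈ U ∧ (g z ∈ Y → ∀ v, fderiv ℂ f (g z) v = 0 → P v.1 = 0 → v.1 = 0) := by
      have h1 : Tendsto g (𝓝 (Ψ q)) (𝓝 q) := by
        have := hgC.continuousAt.tendsto
        rwa [hgq] at this
      exact h1.eventually hker
    set ℓ : ℂ → (V × R) × K := fun t => Ψ q + t • ((0 : V × R), (⟨k, hkK⟩ : K)) with hℓ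
    have hℓd : Differentiable ℂ ℓ := by fun_prop
    have hℓ0 : ℓ 0 = Ψ q := by simp [hℓ]
    have hev : Tendsto ℓ (𝓝 0) (𝓝 (Ψ q)) := by
      have := hℓd.continuous.tendsto 0
      rwa [hℓ0] at this
    obtain ⟨ρ, hρ, hball⟩ := Metric.eventually_nhds_iff_ball.1
      (hev.eventually (hgd.and (hright.and hgt)))
    have hγY : ∀ t ∈ ball (0 : ℂ) ρ, g (ℓ t) ∈ Y ∧ P (g (ℓ t)).1 = P q.1 ∧
        κ (g (ℓ t)) = κ q + t • (⟨k, hkK⟩ : K) := by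
      intro t ht
      obtain ⟨-, h2, h3, -⟩ := hball t ht
      have h4 : f (g (ℓ t)) = f q := by
        have := congrArg (fun z => z.1.1) h2
        simpa [hΨ, hℓ] using this
      refine ⟨(hYU _ h3).2 (h4.trans hfq), ?_, ?_⟩
      · have := congrArg (fun z => z.1.2) h2
        simpa [hΨ, hℓ] using this
      · have := congrArg (fun z => z.2) h2
        simpa [hΨ, hℓ] using this
    have hγd : ∀ t ∈ ball (0 : ℂ) ρ, DifferentiableAt ℂ (fun t => g (ℓ t)) t := fun t ht =>
      DifferentiableAt.comp t (hball t ht).1 (hℓd t)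
    have hder : ∀ t ∈ ball (0 : ℂ) ρ, (deriv (fun t => g (ℓ t)) t).1 = 0 := by
      intro t ht
      have hY := (hγY t ht).1
      obtain ⟨-, -, h3, h4⟩ := hball t ht
      have hd := (hγd t ht).hasDerivAt
      refine h4 hY _ ?_ ?_
      · have h5 : HasFDerivAt f (fderiv ℂ f (g (ℓ t))) (g (ℓ t)) :=
          (hf.differentiableAt (hU.mem_nhds h3)).hasFDerivAt
        have h6 := h5.comp_hasDerivAt t hd
        have h7 : (f ∘ fun t => g (ℓ t)) =ᶠ[𝓝 t] fun _ => f q := by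
          filter_upwards [isOpen_ball.mem_nhds ht] with s hs
          exact ((hYU _ (hball s hs).2.2.1).1 (hγY s hs).1).trans hfq.symm
        exact h6.unique ((hasDerivAt_const t (f q)).congr_of_eventuallyEq h7)
      · have h5 : HasFDerivAt (fun x : E × F => P x.1)
            (P.comp (ContinuousLinearMap.fst ℂ E F)) (g (ℓ t)) :=
          (P.comp (ContinuousLinearMap.fst ℂ E F)).hasFDerivAt
        have h6 := h5.comp_hasDerivAt t hd
        have h7 : ((fun x : E × F => P x.1) ∘ fun t => g (ℓ t)) =ᶠ[𝓝 t] fun _ => P q.1 := by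
          filter_upwards [isOpen_ball.mem_nhds ht] with s hs using (hγY s hs).2.1
        exact h6.unique ((hasDerivAt_const t (P q.1)).congr_of_eventuallyEq h7)
    have hconst : ∀ t ∈ ball (0 : ℂ) ρ, (g (ℓ t)).1 = q.1 := by
      intro t ht
      have hd1 : DifferentiableOn ℂ (fun t => (g (ℓ t)).1) (ball 0 ρ) := fun s hs =>
        (hγd s hs).fst.differentiableWithinAt
      have := (convex_ball (0 : ℂ) ρ).is_const_of_fderivWithin_eq_zero (𝕜 := ℂ) hd1 (fun s hs => by
        rw [fderivWithin_of_isOpen isOpen_ball hs]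
        have h1 : HasDerivAt (fun t => (g (ℓ t)).1) (deriv (fun t => g (ℓ t)) s).1 s :=
          (hγd s hs).hasDerivAt.fst
        rw [hder s hs] at h1
        have h2 := h1.hasFDerivAt.fderiv
        rw [h2]
        ext
        simp) (mem_ball_self hρ) ht
      simp only [hℓ0, hgq] at this
      exact this.symm
    have hinf : (ball (0 : ℂ) ρ).Infinite := infinite_of_mem_nhds 0 (ball_mem_nhds 0 hρ)
    refine hinf (Set.Finite.of_injOn (f := fun t => (g (ℓ t)).2) (t := {w | (q.1, w) ∈ Y})
      (fun t ht => ?_) (fun s hs t ht hst => ?_) (hfin q hq))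
    · show (q.1, (g (ℓ t)).2) ∈ Y
      rw [← hconst t ht]
      exact (hγY t ht).1
    · have h1 : g (ℓ s) = g (ℓ t) := Prod.ext ((hconst s hs).trans (hconst t ht).symm) hst
      have h2 := (hγY s hs).2.2
      rw [h1, (hγY t ht).2.2] at h2
      have h3 := add_left_cancel h2
      have hk0' : (⟨k, hkK⟩ : K) ≠ 0 := fun h => hk0 (congrArg Subtype.val h)
      exact (smul_left_injective ℂ hk0' h3).symm

end RegularPoints

/-! ### The remainder of a power modulo a split polynomial -/

section PowerRemainder

open Polynomial

/-- The remainder of `X ^ q` modulo `∏ (X - x)`, `x ∈ L`, computed recursively in the roots. -/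
noncomputable def powRemainder : List ℂ → ℕ → ℂ[X]
  | [], _ => 0
  | x :: L, q => C (x ^ q) + (X - C x) *
      ∑ s ∈ Finset.range q, C (x ^ (q - 1 - s)) * powRemainder L s

theorem degree_powRemainder_lt (L : List ℂ) (q : ℕ) : (powRemainder L q).degree < L.length := by
  induction L generalizing q with
  | nil => simp [powRemainder]
  | cons x L ih =>
    rw [powRemainder, List.length_cons]
    have h1 : (∑ s ∈ Finset.range q, C (x ^ (q - 1 - s)) * powRemainder L s).degree <
        (L.length : WithBot ℕ) := by
      refine (degree_sum_le _ _).trans_lt ?_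
      rw [Finset.sup_lt_iff (WithBot.bot_lt_coe _)]
      intro s _
      rw [← smul_eq_C_mul]
      exact (degree_smul_le _ _).trans_lt (ih s)
    refine (degree_add_le _ _).trans_lt (max_lt ?_ ?_)
    · exact degree_C_le.trans_lt (by exact_mod_cast Nat.succ_pos _)
    · rw [degree_mul, degree_X_sub_C]
      rcases eq_or_ne (∑ s ∈ Finset.range q, C (x ^ (q - 1 - s)) * powRemainder L s) 0 with h0 | h0
      · rw [h0, degree_zero, WithBot.add_bot]
        exact WithBot.bot_lt_coe _
      · rw [degree_eq_natDegree h0] at h1 ⊢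
        have h2 : (∑ s ∈ Finset.range q, C (x ^ (q - 1 - s)) * powRemainder L s).natDegree <
            L.length := by
          exact_mod_cast h1
        have : 1 + (∑ s ∈ Finset.range q, C (x ^ (q - 1 - s)) * powRemainder L s).natDegree <
          L.length + 1 := by omega
        exact_mod_cast this

theorem prod_dvd_pow_sub_powRemainder (L : List ℂ) (q : ℕ) :
    (L.map fun x => X - C x).prod ∣ X ^ q - powRemainder L q := by
  induction L generalizing q with
  | nil => simp
  | cons x L ih =>
    rw [List.map_cons, List.prod_cons, powRemainder]
    have h1 : (X : ℂ[X]) ^ q - C (x ^ q) =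
        (X - C x) * ∑ s ∈ Finset.range q, C (x ^ (q - 1 - s)) * X ^ s := by
      rw [map_pow, ← (Commute.all (X : ℂ[X]) (C x)).mul_geom_sum₂ q]
      congr 1
      refine Finset.sum_congr rfl fun s _ => ?_
      rw [map_pow, mul_comm]
    rw [← sub_sub, h1, ← mul_sub, ← Finset.sum_sub_distrib]
    refine mul_dvd_mul_left _ (Finset.dvd_sum fun s _ => ?_)
    rw [← mul_sub]
    exact dvd_mul_of_dvd_right (ih s) _

theorem modByMonic_eq_powRemainder (L : List ℂ) (q : ℕ) :
    (X : ℂ[X]) ^ q %ₘ (L.map fun x => X - C x).prod = powRemainder L q := by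
  obtain ⟨Q, hQ⟩ := prod_dvd_pow_sub_powRemainder L q
  have hmon : ((L.map fun x => X - C x).prod : ℂ[X]).Monic :=
    monic_multiset_prod_of_monic (L : Multiset ℂ) _ fun x _ => monic_X_sub_C x
  have hdeg : ((L.map fun x => X - C x).prod : ℂ[X]).degree = L.length := by
    rw [degree_list_prod, List.map_map, Function.comp_def]
    simp only [degree_X_sub_C, List.map_const', List.sum_replicate, nsmul_one]
  refine (div_modByMonic_unique Q _ hmon ⟨?_, ?_⟩).2
  · rw [← hQ]
    ring
  · rw [hdeg]
    exact degree_powRemainder_lt L q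

/-- With roots in the unit disc, the coefficients of the remainder of `X ^ q` are at most `3 ^ q`,
whatever the number of roots: the recursion adds one root at the cost of
`1 + 2 * ∑ s < q, 3 ^ s = 3 ^ q`. -/
theorem norm_coeff_powRemainder_le {L : List ℂ} (hL : ∀ x ∈ L, ‖x‖ ≤ 1) (q i : ℕ) :
    ‖(powRemainder L q).coeff i‖ ≤ 3 ^ q := by
  induction L generalizing q i with
  | nil => simp [powRemainder]
  | cons x L ih =>
    have hx : ‖x‖ ≤ 1 := hL x (by simp)
    have hxp : ∀ n : ℕ, ‖x ^ n‖ ≤ 1 := fun n => by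
      rw [norm_pow]
      exact pow_le_one₀ (norm_nonneg x) hx
    have hS : ∀ i, ‖(∑ s ∈ Finset.range q, C (x ^ (q - 1 - s)) * powRemainder L s).coeff i‖ ≤
        ∑ s ∈ Finset.range q, (3 : ℝ) ^ s := by
      intro i
      rw [finsetSum_coeff]
      refine (norm_sum_le _ _).trans (Finset.sum_le_sum fun s _ => ?_)
      rw [coeff_C_mul, norm_mul]
      refine (mul_le_of_le_one_left (norm_nonneg _) (hxp _)).trans ?_
      exact ih (fun y hy => hL y (List.mem_cons_of_mem _ hy)) s i
    have hgeom : 2 * ∑ s ∈ Finset.range q, (3 : ℝ) ^ s + 1 = 3 ^ q := by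
      rw [geom_sum_eq (by norm_num)]
      ring
    have hnn : 0 ≤ ∑ s ∈ Finset.range q, (3 : ℝ) ^ s := Finset.sum_nonneg fun _ _ => by positivity
    rw [powRemainder]
    set S := ∑ s ∈ Finset.range q, C (x ^ (q - 1 - s)) * powRemainder L s
    rw [coeff_add, sub_mul, coeff_sub, coeff_C_mul]
    have h1 : ‖(C (x ^ q)).coeff i‖ ≤ 1 := by
      rw [coeff_C]
      split_ifs
      · exact hxp q
      · simp
    have h2 : ‖(X * S).coeff i‖ ≤ ∑ s ∈ Finset.range q, (3 : ℝ) ^ s := by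
      cases i with
      | zero => simpa using hnn
      | succ i => rw [coeff_X_mul]; exact hS i
    have h3 : ‖x * S.coeff i‖ ≤ ∑ s ∈ Finset.range q, (3 : ℝ) ^ s := by
      rw [norm_mul]
      exact (mul_le_of_le_one_left (norm_nonneg _) hx).trans (hS i)
    refine (norm_add_le _ _).trans ?_
    have := norm_sub_le ((X * S).coeff i) (x * S.coeff i)
    linarith

theorem differentiableAt_coeff_powRemainder {E : Type*} [NormedAddCommGroup E] [NormedSpace ℂ E]
    {l : List (E → ℂ)} {y : E} (hl : ∀ g ∈ l, DifferentiableAt ℂ g y) (q i : ℕ) :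
    DifferentiableAt ℂ (fun z => (powRemainder (l.map fun g => g z) q).coeff i) y := by
  induction l generalizing q i with
  | nil => simp [powRemainder]
  | cons g l ih =>
    have hg : DifferentiableAt ℂ g y := hl g (by simp)
    have hS : ∀ i, DifferentiableAt ℂ (fun z => (∑ s ∈ Finset.range q, C (g z ^ (q - 1 - s)) *
        powRemainder (l.map fun g => g z) s).coeff i) y := by
      intro i
      simp only [finsetSum_coeff, coeff_C_mul]
      refine DifferentiableAt.fun_sum fun s _ => ?_
      exact (hg.pow _).mul (ih (fun g' hg' => hl g' (List.mem_cons_of_mem _ hg')) s i)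
    simp only [List.map_cons, powRemainder, coeff_add, sub_mul, coeff_sub, coeff_C_mul]
    refine DifferentiableAt.add ?_ (DifferentiableAt.sub ?_ (hg.mul (hS i)))
    · simp only [coeff_C]
      split_ifs
      · exact hg.pow q
      · exact differentiableAt_const _
    · cases i with
      | zero => simp
      | succ i => simpa only [coeff_X_mul] using hS i

end PowerRemainder

/-! ### Reduction of powers of a coordinate -/

section PowerReduction

open Polynomial

variable {E : Type*} [NormedAddCommGroup E] [NormedSpace ℂ E]

/-- The monic polynomial of degree `e` whose roots are the `j`-th coordinates of the points of the
fibre of `Y` over `y`, and `0` with multiplicity `e - N` when the fibre has `N` points. -/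
noncomputable def fiberPolynomial {E : Type*} {k : ℕ} (Y : Set (E × (Fin k → ℂ)))
    (e : ℕ) (j : Fin k) (y : E) :
    ℂ[X] :=
  (∏ᶠ w ∈ {w | (y, w) ∈ Y}, (X - C (w j))) * X ^ (e - {w | (y, w) ∈ Y}.ncard)

theorem fiberPolynomial_eq_list_prod {E : Type*} {k : ℕ} {Y : Set (E × (Fin k → ℂ))}
    {e : ℕ} {j : Fin k} {y : E}
    {κ : Type} [Fintype κ] {c : κ → E → (Fin k → ℂ)} (hinj : Function.Injective fun a => c a y)
    (hY : ∀ w, (y, w) ∈ Y ↔ ∃ a, c a y = w) :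
    fiberPolynomial Y e j y =
        ((((Finset.univ : Finset κ).toList.map fun (a : κ) (z : E) => c a z j) ++
      List.replicate (e - Fintype.card κ) fun _ => 0).map fun g : E → ℂ => X - C (g y)).prod := by
  have hset : {w | (y, w) ∈ Y} = range fun a => c a y := by
    ext w
    exact hY w
  have hcard : (range fun a => c a y).ncard = Fintype.card κ := by
    rw [← Nat.card_coe_set_eq, Nat.card_range_of_injective hinj, Nat.card_eq_fintype_card]
  rw [fiberPolynomial, hset, hcard, finprod_mem_range hinj, finprod_eq_prod_of_fintype,
    List.map_append, List.prod_append, List.map_replicate, List.prod_replicate, List.map_map,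
    ← Finset.prod_map_toList]
  simp [Function.comp_def]

/-- On a proper analytic set over `G` whose fibres have at most `e` points and lie in the unit
polydisc, every power of a coordinate `wⱼ` is a combination of `1, wⱼ, …, wⱼᵉ⁻¹` with coefficients
holomorphic on `G`. Off the discriminant these are the coefficients of the remainder of `X ^ q`
modulo `fiberPolynomial Y e j y`; they are bounded, hence extend to `G`. -/
theorem IsProperOver.exists_power_reduction {k : ℕ} {G : Set E} {Y : Set (E × (Fin k → ℂ))}
    (hY : IsProperOver G Y)
    (hC : ∀ p ∈ Y, p.1 ∈ G → ∀ O ∈ 𝓝 p, (interior (Prod.fst '' (Y ∩ O))).Nonempty)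
    {e : ℕ} (he : ∀ y ∈ G, {w | (y, w) ∈ Y}.ncard ≤ e)
    (hb : ∀ y ∈ G, ∀ w, (y, w) ∈ Y → ‖w‖ ≤ 1) (j : Fin k) (q : ℕ) :
    ∃ c : Fin e → E → ℂ, (∀ i, DifferentiableOn ℂ (c i) G) ∧ (∀ i, ∀ y ∈ G, ‖c i y‖ ≤ 3 ^ q) ∧
      ∀ y ∈ G, ∀ w, (y, w) ∈ Y → w j ^ q = ∑ i, c i y * w j ^ (i : ℕ) := by
  classical
  set T : Set E := {y | ¬ IsUnionOfGraphsAt Y y} with hT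
  set φ : ℕ → E → ℂ := fun i y => ((X : ℂ[X]) ^ q %ₘ fiberPolynomial Y e j y).coeff i with hφ
  have hloc : ∀ y ∈ G, y ∉ T → (∀ i, DifferentiableAt ℂ (φ i) y) ∧ (∀ i, ‖φ i y‖ ≤ 3 ^ q) ∧
      ∀ w, (y, w) ∈ Y → w j ^ q = ∑ i : Fin e, φ i y * w j ^ (i : ℕ) := by
    intro y hy hyT
    obtain ⟨κ, _, c, hc⟩ := not_not.1 hyT
    -- near `y`, holomorphic functions listing the roots of `fiberPolynomial Y e j`
    set l : List (E → ℂ) := ((Finset.univ : Finset κ).toList.map fun a z => c a z j) ++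
      List.replicate (e - Fintype.card κ) fun _ => 0 with hl
    have hφl : ∀ᶠ z in 𝓝 y, (X : ℂ[X]) ^ q %ₘ fiberPolynomial Y e j z =
        powRemainder (l.map fun g => g z) q := by
      filter_upwards [hc] with z hz
      rw [fiberPolynomial_eq_list_prod hz.2.1 hz.2.2, ← modByMonic_eq_powRemainder, List.map_map]
      rfl
    obtain ⟨h1, h2, h3⟩ := hc.self_of_nhds
    have hcard : Fintype.card κ ≤ e := by
      have hset : {w | (y, w) ∈ Y} = range fun a => c a y := by
        ext w
        exact h3 w
      have := he y hy
      rwa [hset, ← Nat.card_coe_set_eq, Nat.card_range_of_injective h2,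
        Nat.card_eq_fintype_card] at this
    have hlen : (l.map fun g => g y).length = e := by
      simp [hl]
      omega
    refine ⟨fun i => ?_, fun i => ?_, fun w hw => ?_⟩
    · have hld : ∀ g ∈ l, DifferentiableAt ℂ g y := by
        intro g hg
        rcases List.mem_append.1 hg with hg | hg
        · obtain ⟨a, -, rfl⟩ := List.mem_map.1 hg
          exact differentiableAt_pi.1 (h1 a) j
        · rw [List.eq_of_mem_replicate hg]
          exact differentiableAt_const _
      refine (differentiableAt_coeff_powRemainder hld q i).congr_of_eventuallyEq ?_
      filter_upwards [hφl] with z hz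
      simp only [hφ, hz]
    · simp only [hφ, hφl.self_of_nhds]
      refine norm_coeff_powRemainder_le (fun x hx => ?_) q i
      obtain ⟨g, hg, rfl⟩ := List.mem_map.1 hx
      rcases List.mem_append.1 hg with hg | hg
      · obtain ⟨a, -, rfl⟩ := List.mem_map.1 hg
        exact (norm_le_pi_norm (c a y) j).trans (hb y hy _ ((h3 _).2 ⟨a, rfl⟩))
      · rw [List.eq_of_mem_replicate hg]
        simp
    · have hdeg : (powRemainder (l.map fun g => g y) q).degree < e := by
        have := degree_powRemainder_lt (l.map fun g => g y) q
        rwa [hlen] at this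
      have heval : (powRemainder (l.map fun g => g y) q).eval (w j) = w j ^ q := by
        obtain ⟨Q, hQ⟩ := prod_dvd_pow_sub_powRemainder (l.map fun g => g y) q
        have h0 : (((l.map fun g => g y).map fun x => X - C x).prod : ℂ[X]).eval (w j) = 0 := by
          obtain ⟨a, rfl⟩ := (h3 w).1 hw
          rw [eval_list_prod]
          refine List.prod_eq_zero ?_
          simp only [List.map_map, List.mem_map, hl, List.mem_append]
          refine ⟨fun z => c a z j, Or.inl ⟨a, by simp, rfl⟩, by simp⟩
        have h4 := congrArg (eval (w j)) hQ
        rw [eval_mul, h0, zero_mul, eval_sub, eval_pow, eval_X, sub_eq_zero] at h4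
        exact h4.symm
      have he0 : 0 < e := by
        obtain ⟨a, -⟩ := (h3 w).1 hw
        exact (Fintype.card_pos_iff.2 ⟨a⟩).trans_le hcard
      have hnd : (powRemainder (l.map fun g => g y) q).natDegree < e := by
        by_cases h0 : powRemainder (l.map fun g => g y) q = 0
        · rw [h0, natDegree_zero]
          exact he0
        · exact (natDegree_lt_iff_degree_lt h0).2 hdeg
      simp only [hφ, hφl.self_of_nhds]
      rw [eval_eq_sum_range' hnd, Finset.sum_range] at heval
      exact heval.symm
  have hThin : ∀ y ∈ G, ∃ r > 0, ∃ δ : E → ℂ, DifferentiableOn ℂ δ (ball y r) ∧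
      (∃ p ∈ ball y r, δ p ≠ 0) ∧ ∀ z ∈ ball y r, z ∈ T → δ z = 0 := by
    intro y hy
    obtain ⟨r, hr, δ, hδ, hδ0, h⟩ := hY.exists_discriminant hC hy
    exact ⟨r, hr, δ, hδ, hδ0, fun z hz hzT => by_contra fun h0 => hzT (h z hz h0)⟩
  choose c hcd hcφ hcb using fun i : Fin e =>
    exists_differentiableOn_extension (f := φ i) (M := 3 ^ q) hY.isOpen
      (fun y hy hyT => (hloc y hy hyT).1 i) (fun y hy hyT => (hloc y hy hyT).2.1 i) hThin
  refine ⟨c, hcd, hcb, fun y hy w hw => ?_⟩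
  -- the relation holds over the complement of `T`, and extends by continuity
  by_contra hne
  have hcont : ContinuousAt
      (fun p : E × (Fin k → ℂ) => p.2 j ^ q - ∑ i, c i p.1 * p.2 j ^ (i : ℕ)) (y, w) := by
    have h1 : ContinuousAt (fun p : E × (Fin k → ℂ) => p.2 j) (y, w) := by fun_prop
    have h2 : ∀ i, ContinuousAt (fun p : E × (Fin k → ℂ) => c i p.1) (y, w) := fun i =>
      ContinuousAt.comp (f := Prod.fst) (g := c i)
        ((hcd i).differentiableAt (hY.isOpen.mem_nhds hy)).continuousAt continuousAt_fst
    refine (h1.pow q).sub (tendsto_finsetSum _ fun i _ => ?_)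
    exact (h2 i).mul (h1.pow _)
  have hO := inter_mem (hcont.eventually_ne (sub_ne_zero.2 hne))
    ((hY.isOpen.preimage continuous_fst).mem_nhds (show (y, w) ∈ Prod.fst ⁻¹' G from hy))
  obtain ⟨u, hu⟩ := hC (y, w) hw hy _ hO
  obtain ⟨⟨u', w'⟩, ⟨-, -, huG⟩, rfl⟩ := interior_subset hu
  obtain ⟨r, hr, δ, hδ, ⟨p, hp, hp0⟩, hδT⟩ := hThin u' huG
  obtain ⟨z, hz0, hz, hzr⟩ :=
      ((dense_ne_zero_of_ne_zero hδ hp hp0 (mem_ball_self hr)).and_eventually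
    (inter_mem (isOpen_interior.mem_nhds hu) (ball_mem_nhds u' hr))).exists
  obtain ⟨⟨z', v⟩, ⟨hzv, hzne, hzG⟩, rfl⟩ := interior_subset hz
  have hzT : z' ∉ T := fun h => hz0 (hδT z' hzr h)
  refine hzne (sub_eq_zero.2 ?_)
  have := (hloc z' hzG hzT).2.2 v hzv
  simp only [← hcφ _ z' hzG hzT] at this
  exact this

end PowerReduction

/-! ### Taylor expansion with holomorphic parameters -/

section Taylor

variable {E : Type*} [NormedAddCommGroup E] [NormedSpace ℂ E]

/-- The Taylor expansion of order `N` in one variable on the unit disc, with holomorphic dependence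
on parameters: the remainder is small on the disc of radius `1 / 2`. -/
theorem exists_taylor_one {U : Set E} (hU : IsOpen U) {f : E × ℂ → ℂ}
    (hf : DifferentiableOn ℂ f (U ×ˢ ball 0 1)) {M : ℝ} (hM : ∀ p ∈ U ×ˢ ball 0 1, ‖f p‖ ≤ M)
    (N : ℕ) :
    ∃ b : Fin N → E → ℂ, (∀ a, DifferentiableOn ℂ (b a) U) ∧
      (∀ a, ∀ y ∈ U, ‖b a y‖ ≤ M * (4 / 3) ^ (a : ℕ)) ∧
      ∀ y ∈ U, ∀ x : ℂ, ‖x‖ ≤ 1 / 2 →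
        ‖f (y, x) - ∑ a, b a y * x ^ (a : ℕ)‖ ≤ 3 * M * (2 / 3) ^ N := by
  have hsph : ∀ t ∈ sphere (0 : ℂ) (3 / 4), t ∈ ball (0 : ℂ) 1 := fun t ht => by
    rw [mem_sphere_zero_iff_norm] at ht
    rw [mem_ball_zero_iff, ht]
    norm_num
  have hne : ∀ t ∈ sphere (0 : ℂ) (3 / 4), t ≠ 0 := fun t ht h0 => by
    rw [mem_sphere_zero_iff_norm, h0, norm_zero] at ht
    norm_num at ht
  have hft : ∀ y ∈ U, ContinuousOn (fun t => f (y, t)) (sphere (0 : ℂ) (3 / 4)) := fun y hy =>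
    hf.continuousOn.comp (by fun_prop) fun t ht => ⟨hy, hsph t ht⟩
  refine ⟨fun a y => (2 * Real.pi * Complex.I)⁻¹ • ∮ t in C(0, 3 / 4),
      (t ^ ((a : ℕ) + 1))⁻¹ * f (y, t),
    fun a y hy => ?_, fun a y hy => ?_, fun y hy x hx => ?_⟩
  · refine DifferentiableAt.differentiableWithinAt (DifferentiableAt.fun_const_smul ?_ _)
    have hO : IsOpen (U ×ˢ (ball (0 : ℂ) 1 ∩ {0}ᶜ)) :=
      hU.prod (isOpen_ball.inter isOpen_compl_singleton)
    refine differentiableAt_circleIntegral (f := fun p => (p.2 ^ ((a : ℕ) + 1))⁻¹ * f p)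
        hO ?_ (by norm_num)
      fun t ht => ⟨hy, hsph t ht, hne t ht⟩
    refine DifferentiableOn.mul (DifferentiableOn.inv (by fun_prop) fun p hp => ?_)
      (hf.mono fun p hp => ⟨hp.1, hp.2.1⟩)
    exact pow_ne_zero _ hp.2.2
  · refine (circleIntegral.norm_two_pi_i_inv_smul_integral_le_of_norm_le_const
      (C := M * (4 / 3) ^ ((a : ℕ) + 1)) (by norm_num) fun t ht => ?_).trans (le_of_eq (by ring))
    rw [norm_mul, norm_inv, norm_pow, mem_sphere_zero_iff_norm.1 ht, mul_comm, ← inv_pow]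
    norm_num
    exact hM _ ⟨hy, hsph t ht⟩
  · have hxt : ∀ t ∈ sphere (0 : ℂ) (3 / 4), 1 / 4 ≤ ‖t - x‖ := fun t ht => by
      have h1 := norm_sub_norm_le t x
      rw [mem_sphere_zero_iff_norm.1 ht] at h1
      linarith
    have hne' : ∀ t ∈ sphere (0 : ℂ) (3 / 4), t - x ≠ 0 := fun t ht h0 => by
      have := hxt t ht
      rw [h0, norm_zero] at this
      norm_num at this
    have hd : DifferentiableOn ℂ (fun t => f (y, t)) (closedBall 0 (3 / 4)) :=
      hf.comp (by fun_prop) fun t ht => ⟨hy, closedBall_subset_ball (by norm_num) ht⟩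
    have hcauchy := DiffContOnCl.two_pi_i_inv_smul_circleIntegral_sub_inv_smul
      (w := x) (hd.diffContOnCl_ball subset_rfl) (by rw [mem_ball_zero_iff]; linarith)
    have hint : ∀ a : Fin N, CircleIntegrable
        (fun t => (t ^ ((a : ℕ) + 1))⁻¹ * f (y, t) * x ^ (a : ℕ)) 0 (3 / 4) := fun a =>
      ContinuousOn.circleIntegrable (by norm_num) (((ContinuousOn.inv₀ (by fun_prop) fun t ht =>
        pow_ne_zero _ (hne t ht)).mul (hft y hy)).mul continuousOn_const)
    have hint0 : CircleIntegrable (fun t => (t - x)⁻¹ • f (y, t)) 0 (3 / 4) :=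
      ContinuousOn.circleIntegrable (by norm_num) ((ContinuousOn.inv₀ (by fun_prop) fun t ht =>
        hne' t ht).smul (hft y hy))
    -- the geometric series for the Cauchy kernel, summed up to its `N`-th term
    have hsum : f (y, x) - ∑ a : Fin N, ((2 * Real.pi * Complex.I)⁻¹ •
        ∮ t in C(0, 3 / 4), (t ^ ((a : ℕ) + 1))⁻¹ * f (y, t)) * x ^ (a : ℕ) =
        (2 * Real.pi * Complex.I)⁻¹ • ∮ t in C(0, 3 / 4), (t - x)⁻¹ * (x / t) ^ N * f (y, t) := by
      have h1 : ∀ t ∈ sphere (0 : ℂ) (3 / 4), (t - x)⁻¹ * (x / t) ^ N * f (y, t) =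
          (t - x)⁻¹ • f (y, t) - ∑ a : Fin N, (t ^ ((a : ℕ) + 1))⁻¹ * f (y, t) * x ^ (a : ℕ) := by
        intro t ht
        have ht0 := hne t ht
        have htx := hne' t ht
        have hgeom : (∑ a : Fin N, (t ^ ((a : ℕ) + 1))⁻¹ * x ^ (a : ℕ)) * (t - x) =
            1 - (x / t) ^ N := by
          rw [← mul_neg_geom_sum, Finset.sum_range, mul_comm (∑ a : Fin N, _) _, Finset.mul_sum,
            Finset.mul_sum]
          refine Finset.sum_congr rfl fun a _ => ?_
          rw [div_pow]
          field_simp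
          ring
        have h2 : ∑ a : Fin N, (t ^ ((a : ℕ) + 1))⁻¹ * f (y, t) * x ^ (a : ℕ) =
            (1 - (x / t) ^ N) * (t - x)⁻¹ * f (y, t) := by
          rw [← hgeom, mul_assoc _ (t - x), mul_inv_cancel₀ htx, mul_one, Finset.sum_mul]
          exact Finset.sum_congr rfl fun a _ => by ring
        rw [h2, smul_eq_mul]
        ring
      rw [circleIntegral.integral_congr (by norm_num) h1,
        circleIntegral.integral_sub hint0 (CircleIntegrable.fun_sum _ fun a _ => hint a),
        circleIntegral.integral_fun_sum fun a _ => hint a, smul_sub, hcauchy, Finset.smul_sum]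
      congr 1
      refine Finset.sum_congr rfl fun a _ => ?_
      rw [smul_mul_assoc, mul_comm (∮ t in C(0, 3 / 4), _), ← circleIntegral.integral_const_mul]
      simp only [mul_comm]
    rw [hsum]
    refine (circleIntegral.norm_two_pi_i_inv_smul_integral_le_of_norm_le_const
      (C := 4 * (2 / 3) ^ N * M) (by norm_num) fun t ht => ?_).trans (le_of_eq (by ring))
    rw [norm_mul, norm_mul, norm_inv, norm_pow, norm_div, mem_sphere_zero_iff_norm.1 ht]
    have hinv : ‖t - x‖⁻¹ ≤ 4 := by
      rw [inv_le_comm₀ (lt_of_lt_of_le (by norm_num) (hxt t ht)) (by norm_num)]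
      exact (by norm_num : (4 : ℝ)⁻¹ = 1 / 4) ▸ hxt t ht
    have h3 : ‖x‖ / (3 / 4) ≤ 2 / 3 := by
      rw [div_le_iff₀ (by norm_num)]
      linarith
    gcongr
    exact hM _ ⟨hy, hsph t ht⟩

/-- The Taylor expansion of order `N` in each of `n` variables on the unit polydisc, with
holomorphic dependence on parameters. -/
theorem exists_taylor (n : ℕ) {E : Type*} [NormedAddCommGroup E] [NormedSpace ℂ E]
    {U : Set E} (hU : IsOpen U) {f : E × (Fin n → ℂ) → ℂ}
    (hf : DifferentiableOn ℂ f (U ×ˢ ball 0 1)) {M : ℝ} (hM : ∀ p ∈ U ×ˢ ball 0 1, ‖f p‖ ≤ M)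
    (N : ℕ) :
    ∃ b : (Fin n → Fin N) → E → ℂ, (∀ a, DifferentiableOn ℂ (b a) U) ∧
      (∀ a, ∀ y ∈ U, ‖b a y‖ ≤ M * ∏ i, (4 / 3) ^ (a i : ℕ)) ∧
      ∀ y ∈ U, ∀ x : Fin n → ℂ, ‖x‖ ≤ 1 / 2 →
        ‖f (y, x) - ∑ a, b a y * ∏ i, x i ^ (a i : ℕ)‖ ≤ (2 * 3 ^ n - 2) * M * (2 / 3) ^ N := by
  induction n generalizing E M with
  | zero =>
    refine ⟨fun _ y => f (y, 0), fun _ => ?_, fun _ y hy => ?_, fun y hy x hx => ?_⟩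
    · exact hf.comp (by fun_prop) fun y hy => ⟨hy, mem_ball_self one_pos⟩
    · simpa using hM (y, 0) ⟨hy, mem_ball_self one_pos⟩
    · simp [Subsingleton.elim x 0]
  | succ n ih =>
    let φ : (E × (Fin n → ℂ)) × ℂ → E × (Fin (n + 1) → ℂ) := fun p => (p.1.1, Fin.cons p.2 p.1.2)
    have hφ : Differentiable ℂ φ := by
      refine differentiable_fst.fst.prodMk (differentiable_pi.2 fun i => ?_)
      refine Fin.cases ?_ (fun i => ?_) i
      · simp
      · simp only [Fin.cons_succ]
        fun_prop
    have hmaps : MapsTo φ ((U ×ˢ ball 0 1) ×ˢ ball 0 1) (U ×ˢ ball 0 1) := by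
      rintro ⟨⟨y, x⟩, t⟩ ⟨⟨hy, hx⟩, ht⟩
      refine ⟨hy, mem_ball_zero_iff.2 ((pi_norm_lt_iff one_pos).2 fun i => ?_)⟩
      refine Fin.cases ?_ (fun i => ?_) i
      · simpa [φ] using ht
      · simpa [φ] using (norm_le_pi_norm x i).trans_lt (mem_ball_zero_iff.1 hx)
    obtain ⟨b, hbd, hbM, hb⟩ := exists_taylor_one (hU.prod isOpen_ball)
      (hf.comp hφ.differentiableOn hmaps) (fun p hp => hM _ (hmaps hp)) N
    choose c hcd hcM hc using fun a => ih hU (hbd a) (hbM a)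
    refine ⟨fun a => c (a 0) (Fin.tail a), fun a => hcd _ _, fun a y hy => ?_, fun y hy x hx => ?_⟩
    · rw [Fin.prod_univ_succ, ← mul_assoc]
      exact hcM _ _ y hy
    · have hM0 : 0 ≤ M := (norm_nonneg _).trans (hM (y, 0) ⟨hy, mem_ball_self one_pos⟩)
      have hx0 : ‖x 0‖ ≤ 1 / 2 := (norm_le_pi_norm x 0).trans hx
      have hxt : ‖Fin.tail x‖ ≤ 1 / 2 := (pi_norm_le_iff_of_nonneg (by norm_num)).2 fun i =>
        (norm_le_pi_norm x i.succ).trans hx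
      have h1 := hb (y, Fin.tail x) ⟨hy, mem_ball_zero_iff.2 (hxt.trans_lt (by norm_num))⟩ (x 0) hx0
      simp only [Function.comp_apply, φ, Fin.cons_self_tail] at h1
      have h2 : ‖∑ a : Fin N, (b a (y, Fin.tail x) - ∑ α : Fin n → Fin N, c a α y *
          ∏ i, Fin.tail x i ^ (α i : ℕ)) * x 0 ^ (a : ℕ)‖ ≤
              3 * ((2 * 3 ^ n - 2) * M * (2 / 3) ^ N) := by
        have hn : (0 : ℝ) ≤ 2 * 3 ^ n - 2 := by
          have : (1 : ℝ) ≤ 3 ^ n := one_le_pow₀ (by norm_num)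
          linarith
        have hgeom : ∑ a : Fin N, (2 / 3 : ℝ) ^ (a : ℕ) ≤ 3 := by
          have h0 : (0 : ℝ) ≤ (2 / 3) ^ N := by positivity
          rw [← Finset.sum_range (fun a => (2 / 3 : ℝ) ^ a), geom_sum_eq (by norm_num),
            div_le_iff_of_neg (by norm_num)]
          linarith
        calc _ ≤ ∑ a : Fin N, (2 / 3 : ℝ) ^ (a : ℕ) * ((2 * 3 ^ n - 2) * M * (2 / 3) ^ N) := by
              refine (norm_sum_le _ _).trans (Finset.sum_le_sum fun a _ => ?_)
              rw [norm_mul, norm_pow]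
              calc _ ≤ ((2 * 3 ^ n - 2) * (M * (4 / 3) ^ (a : ℕ)) * (2 / 3) ^ N) *
                  (1 / 2) ^ (a : ℕ) := by
                    gcongr
                    exact hc a y hy _ hxt
                _ = _ := by
                    rw [show (2 / 3 : ℝ) ^ (a : ℕ) = (4 / 3) ^ (a : ℕ) * (1 / 2) ^ (a : ℕ) by
                      rw [← mul_pow]; norm_num]
                    ring
          _ ≤ _ := by
              rw [← Finset.sum_mul]
              gcongr
      have h3 : ∑ a : Fin (n + 1) → Fin N, c (a 0) (Fin.tail a) y * ∏ i, x i ^ (a i : ℕ) =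
          ∑ a : Fin N, (∑ α : Fin n → Fin N, c a α y * ∏ i, Fin.tail x i ^ (α i : ℕ)) *
            x 0 ^ (a : ℕ) := by
        rw [← (Fin.consEquiv fun _ : Fin (n + 1) => Fin N).sum_comp, Fintype.sum_prod_type]
        refine Finset.sum_congr rfl fun a _ => ?_
        rw [Finset.sum_mul]
        refine Finset.sum_congr rfl fun α _ => ?_
        simp only [Fin.consEquiv_apply, Fin.cons_zero, Fin.prod_univ_succ, Fin.cons_succ]
        have ht : Fin.tail (Fin.consEquiv (fun _ : Fin (n + 1) => Fin N) (a, α)) = α :=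
          Fin.tail_cons _ _
        rw [ht]
        simp only [Fin.tail]
        ring
      rw [h3]
      have h4 := norm_add_le_of_le h1 h2
      simp only [sub_mul, Finset.sum_sub_distrib, sub_add_sub_cancel] at h4
      refine h4.trans ?_
      have : (0 : ℝ) ≤ M * (2 / 3) ^ N := by positivity
      rw [pow_succ]
      nlinarith

end Taylor

/-! ### Approximation by few monomials -/

section Approximation

/-- If powers of the coordinates `wⱼ` reduce, on `Y`, to combinations of the powers below `e` with
controlled holomorphic coefficients, then every bounded holomorphic function on the unit polydisc
is approximated, on the part of `Y` in the polydisc of radius `1 / 2`, by combinations of the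
`N' ^ m * e ^ k` monomials `z ^ α * w ^ ι`. -/
theorem exists_monomial_approximation {m k e : ℕ} {Y : Set ((Fin m → ℂ) × (Fin k → ℂ))}
    (hred : ∀ (j : Fin k) (q : ℕ), ∃ c : Fin e → (Fin m → ℂ) → ℂ,
      (∀ i, DifferentiableOn ℂ (c i) (ball 0 1)) ∧ (∀ i, ∀ z ∈ ball 0 1, ‖c i z‖ ≤ 3 ^ q) ∧
        ∀ z ∈ ball 0 1, ∀ w, (z, w) ∈ Y → w j ^ q = ∑ i, c i z * w j ^ (i : ℕ))
    {F : (Fin m → ℂ) × (Fin k → ℂ) → ℂ} (hF : DifferentiableOn ℂ F (ball 0 1 ×ˢ ball 0 1)) {M : ℝ}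
    (hM : ∀ p ∈ ball 0 1 ×ˢ ball 0 1, ‖F p‖ ≤ M) (N N' : ℕ) :
    ∃ a : (Fin m → Fin N') × (Fin k → Fin e) → ℂ,
      (∀ α, ‖a α‖ ≤ M * 4 ^ (k * N) * (4 / 3) ^ (m * N')) ∧
      ∀ z w, (z, w) ∈ Y → ‖z‖ ≤ 1 / 2 → ‖w‖ ≤ 1 / 2 →
        ‖F (z, w) - ∑ α, a α * ((∏ i, z i ^ (α.1 i : ℕ)) * ∏ j, w j ^ (α.2 j : ℕ))‖ ≤
          2 * 3 ^ k * M * (2 / 3) ^ N + e ^ k * (2 * 3 ^ m * (M * 4 ^ (k * N)) * (2 / 3) ^ N') := by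
  have hM0 : 0 ≤ M :=
    (norm_nonneg _).trans (hM (0, 0) ⟨mem_ball_self one_pos, mem_ball_self one_pos⟩)
  choose c hcd hcM hc using hred
  obtain ⟨A, hAd, hAM, hA⟩ := exists_taylor k isOpen_ball hF hM N
  -- the coefficient of `w ^ ι` after the reduction
  let B : (Fin k → Fin e) → (Fin m → ℂ) → ℂ := fun ι z =>
    ∑ β : Fin k → Fin N, A β z * ∏ j, c j (β j) (ι j) z
  have hBd : ∀ ι, DifferentiableOn ℂ (B ι) (ball 0 1) := by
    intro ι z hz
    have hat : ∀ {f : (Fin m → ℂ) → ℂ}, DifferentiableOn ℂ f (ball 0 1) → DifferentiableAt ℂ f z :=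
      fun hf => hf.differentiableAt (isOpen_ball.mem_nhds hz)
    refine DifferentiableAt.differentiableWithinAt (DifferentiableAt.fun_sum fun β _ => ?_)
    exact (hat (hAd β)).mul (differentiableAt_fun_prod fun j _ => hat (hcd _ _ _))
  have hBM : ∀ ι, ∀ z ∈ ball 0 1, ‖B ι z‖ ≤ M * 4 ^ (k * N) := by
    intro ι z hz
    calc ‖B ι z‖ ≤ ∑ β : Fin k → Fin N, M * ∏ j, (4 : ℝ) ^ (β j : ℕ) := by
          refine (norm_sum_le _ _).trans (Finset.sum_le_sum fun β _ => ?_)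
          rw [norm_mul, norm_prod]
          calc _ ≤ (M * ∏ j, (4 / 3 : ℝ) ^ (β j : ℕ)) * ∏ j, (3 : ℝ) ^ (β j : ℕ) := by
                gcongr with j
                · exact hAM β z hz
                · exact hcM _ _ _ z hz
            _ = _ := by
                rw [mul_assoc, ← Finset.prod_mul_distrib]
                congr 1
                refine Finset.prod_congr rfl fun j _ => ?_
                rw [← mul_pow]
                norm_num
      _ = M * ∏ _j : Fin k, ∑ b : Fin N, (4 : ℝ) ^ (b : ℕ) := by
          rw [← Finset.mul_sum, Finset.prod_univ_sum, Fintype.piFinset_univ]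
      _ ≤ M * ∏ _j : Fin k, (4 : ℝ) ^ N := by
          have : ∑ b : Fin N, (4 : ℝ) ^ (b : ℕ) ≤ 4 ^ N := by
            rw [← Finset.sum_range (fun b => (4 : ℝ) ^ b), geom_sum_eq (by norm_num)]
            have : (0 : ℝ) ≤ 4 ^ N := by positivity
            linarith
          gcongr
      _ = _ := by
          rw [Finset.prod_const, Finset.card_univ, Fintype.card_fin, ← pow_mul, mul_comm N]
  have hBt : ∀ ι, ∃ b : (Fin m → Fin N') → ℂ,
      (∀ α, ‖b α‖ ≤ M * 4 ^ (k * N) * ∏ i, (4 / 3) ^ (α i : ℕ)) ∧ ∀ z : Fin m → ℂ, ‖z‖ ≤ 1 / 2 →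
        ‖B ι z - ∑ α, b α * ∏ i, z i ^ (α i : ℕ)‖ ≤
          (2 * 3 ^ m - 2) * (M * 4 ^ (k * N)) * (2 / 3) ^ N' := by
    intro ι
    obtain ⟨b, -, hbM, hb⟩ := exists_taylor m (isOpen_univ (X := ℂ)) (f := fun p => B ι p.2)
      ((hBd ι).comp (by fun_prop) fun p hp => hp.2) (fun p hp => hBM ι _ hp.2) N'
    exact ⟨fun α => b α 0, fun α => hbM α 0 (mem_univ _), hb 0 (mem_univ _)⟩
  choose b hbM hb using hBt
  refine ⟨fun α => b α.2 α.1, fun α => (hbM _ _).trans ?_, fun z w hzw hz hw => ?_⟩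
  · gcongr
    calc _ ≤ ∏ _i : Fin m, (4 / 3 : ℝ) ^ N' := by
          gcongr with i
          · norm_num
          · exact (α.1 i).is_lt.le
      _ = _ := by
          rw [Finset.prod_const, Finset.card_univ, Fintype.card_fin, ← pow_mul, mul_comm N']
  · have hz1 : z ∈ ball (0 : Fin m → ℂ) 1 := mem_ball_zero_iff.2 (hz.trans_lt (by norm_num))
    have h1 := hA z hz1 w hw
    have h2 : ∑ β : Fin k → Fin N, A β z * ∏ j, w j ^ (β j : ℕ) =
        ∑ ι, B ι z * ∏ j, w j ^ (ι j : ℕ) := by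
      simp only [B, Finset.sum_mul]
      rw [Finset.sum_comm]
      refine Finset.sum_congr rfl fun β _ => ?_
      have h3 : ∏ j, w j ^ (β j : ℕ) = ∏ j, ∑ i, c j (β j) i z * w j ^ (i : ℕ) :=
        Finset.prod_congr rfl fun j _ => hc j _ z hz1 w hzw
      rw [h3, Finset.prod_univ_sum, Fintype.piFinset_univ, Finset.mul_sum]
      refine Finset.sum_congr rfl fun ι _ => ?_
      rw [Finset.prod_mul_distrib, mul_assoc]
    have h4 : ‖∑ ι : Fin k → Fin e, (B ι z - ∑ α, b ι α * ∏ i, z i ^ (α i : ℕ)) *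
        ∏ j, w j ^ (ι j : ℕ)‖ ≤ e ^ k * ((2 * 3 ^ m - 2) * (M * 4 ^ (k * N)) * (2 / 3) ^ N') := by
      calc _ ≤ ∑ ι : Fin k → Fin e, (2 * 3 ^ m - 2) * (M * 4 ^ (k * N)) * (2 / 3) ^ N' := by
            refine (norm_sum_le _ _).trans (Finset.sum_le_sum fun ι _ => ?_)
            rw [norm_mul, norm_prod]
            refine (mul_le_of_le_one_right (norm_nonneg _) ?_).trans (hb ι z hz)
            refine Finset.prod_le_one (fun _ _ => norm_nonneg _) fun j _ => ?_
            rw [norm_pow]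
            exact pow_le_one₀ (norm_nonneg _)
              ((norm_le_pi_norm w j).trans (hw.trans (by norm_num)))
        _ = _ := by
            rw [Finset.sum_const, Finset.card_univ, Fintype.card_fun, Fintype.card_fin,
              Fintype.card_fin, nsmul_eq_mul, Nat.cast_pow]
    have h5 : ∑ α : (Fin m → Fin N') × (Fin k → Fin e),
        b α.2 α.1 * ((∏ i, z i ^ (α.1 i : ℕ)) * ∏ j, w j ^ (α.2 j : ℕ)) =
        ∑ ι, (∑ α, b ι α * ∏ i, z i ^ (α i : ℕ)) * ∏ j, w j ^ (ι j : ℕ) := by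
      rw [Fintype.sum_prod_type_right]
      refine Finset.sum_congr rfl fun ι _ => ?_
      rw [Finset.sum_mul]
      exact Finset.sum_congr rfl fun α _ => by ring
    rw [h5]
    rw [h2] at h1
    have h6 := norm_add_le_of_le h1 h4
    simp only [sub_mul, Finset.sum_sub_distrib, sub_add_sub_cancel] at h6
    refine h6.trans ?_
    have h7 : (0 : ℝ) ≤ M * (2 / 3) ^ N := by positivity
    have h8 : (0 : ℝ) ≤ e ^ k * ((M * 4 ^ (k * N)) * (2 / 3) ^ N') := by positivity
    linarith

end Approximation

/-! ### The box principle -/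

section Pigeonhole

theorem abs_sub_le_of_floor_eq {x₁ x₂ R : ℝ} {L : ℕ} (hL : 1 ≤ L) (h₁ : |x₁| ≤ R) (h₂ : |x₂| ≤ R)
    (h : ⌊x₁ * (L / R)⌋ = ⌊x₂ * (L / R)⌋) : |x₁ - x₂| ≤ R / L := by
  have hL0 : (0 : ℝ) < L := by exact_mod_cast hL
  rcases ((abs_nonneg x₁).trans h₁).eq_or_lt with hR | hR
  · rw [← hR, abs_nonpos_iff] at h₁ h₂
    rw [h₁, h₂, ← hR]
    simp
  · have := Int.abs_sub_lt_one_of_floor_eq_floor h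
    rw [← sub_mul, abs_mul, abs_of_pos (div_pos hL0 hR), ← lt_div_iff₀ (div_pos hL0 hR),
      one_div_div] at this
    exact this.le

theorem floor_mem_Icc {x R : ℝ} {L : ℕ} (h : |x| ≤ R) :
    ⌊x * (L / R)⌋ ∈ Finset.Icc (-(L : ℤ)) L := by
  have hR : 0 ≤ R := (abs_nonneg x).trans h
  have hx : |x * (L / R)| ≤ L := by
    rw [abs_mul, abs_of_nonneg (by positivity : (0 : ℝ) ≤ L / R), mul_div_left_comm]
    exact mul_le_of_le_one_right (Nat.cast_nonneg L) (div_le_one_of_le₀ h hR)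
  rw [abs_le] at hx
  rw [Finset.mem_Icc, Int.le_floor]
  refine ⟨by exact_mod_cast hx.1, ?_⟩
  exact_mod_cast (Int.floor_le _).trans hx.2

/-- The box principle: finitely many complex linear forms take small values simultaneously at a
nonzero integer vector with bounded coordinates. -/
theorem exists_int_vector_small_forms {Γ Λ : Type*} [Fintype Γ] [Fintype Λ] (A : Λ → Γ → ℂ) {T : ℝ}
    (hA : ∀ l γ, ‖A l γ‖ ≤ T) {H L : ℕ} (hL : 1 ≤ L)
    (hcard : (2 * L + 1) ^ (2 * Fintype.card Λ) < (H + 1) ^ Fintype.card Γ) :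
    ∃ p : Γ → ℤ, p ≠ 0 ∧ (∀ γ, |p γ| ≤ H) ∧
      ∀ l, ‖∑ γ, (p γ : ℂ) * A l γ‖ ≤ 2 * (Fintype.card Γ * H * T) / L := by
  classical
  set R : ℝ := Fintype.card Γ * H * T with hR
  let V : (Γ → Fin (H + 1)) → Λ → ℂ := fun q l => ∑ γ, ((q γ : ℕ) : ℂ) * A l γ
  have hV : ∀ q l, ‖V q l‖ ≤ R := by
    intro q l
    calc ‖V q l‖ ≤ ∑ _γ : Γ, (H : ℝ) * T := by
          refine (norm_sum_le _ _).trans (Finset.sum_le_sum fun γ _ => ?_)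
          rw [norm_mul, Complex.norm_natCast]
          have : ((q γ : ℕ) : ℝ) ≤ H := by exact_mod_cast Nat.lt_succ_iff.1 (q γ).is_lt
          gcongr
          exact hA l γ
      _ = R := by rw [Finset.sum_const, Finset.card_univ, nsmul_eq_mul, hR, mul_assoc]
  let cell : (Γ → Fin (H + 1)) → Λ → ℤ × ℤ := fun q l =>
    (⌊(V q l).re * (L / R)⌋, ⌊(V q l).im * (L / R)⌋)
  obtain ⟨q₁, -, q₂, -, hne, heq⟩ := Finset.exists_ne_map_eq_of_card_lt_of_maps_to
    (s := (Finset.univ : Finset (Γ → Fin (H + 1)))) (f := cell)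
    (t := Fintype.piFinset fun _ : Λ => Finset.Icc (-(L : ℤ)) L ×ˢ Finset.Icc (-(L : ℤ)) L)
    (by
      rw [Fintype.card_piFinset, Finset.prod_const, Finset.card_univ, Finset.card_product,
          Int.card_Icc, Finset.card_univ,
        Fintype.card_fun, Fintype.card_fin,
            show ((L : ℤ) + 1 - -(L : ℤ)).toNat = 2 * L + 1 by omega,
        ← sq, ← pow_mul]
      exact hcard)
    (fun q _ => by
      rw [Finset.mem_coe, Fintype.mem_piFinset]
      intro l
      exact Finset.mem_product.2 ⟨floor_mem_Icc ((Complex.abs_re_le_norm _).trans (hV q l)),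
        floor_mem_Icc ((Complex.abs_im_le_norm _).trans (hV q l))⟩)
  refine ⟨fun γ => (q₁ γ : ℤ) - q₂ γ, fun h0 => hne ?_, fun γ => ?_, fun l => ?_⟩
  · funext γ
    have := congrFun h0 γ
    simp only [Pi.zero_apply, sub_eq_zero] at this
    exact Fin.ext (by exact_mod_cast this)
  · have h1 := (q₁ γ).is_lt
    have h2 := (q₂ γ).is_lt
    refine abs_le.2 ⟨?_, ?_⟩ <;> dsimp only <;> omega
  · have hdiff : ∑ γ, (((q₁ γ : ℤ) - q₂ γ : ℤ) : ℂ) * A l γ = V q₁ l - V q₂ l := by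
      simp only [V]
      rw [← Finset.sum_sub_distrib]
      refine Finset.sum_congr rfl fun γ _ => ?_
      push_cast
      ring
    rw [hdiff]
    have hc := congrFun heq l
    simp only [cell, Prod.mk.injEq] at hc
    have hre := abs_sub_le_of_floor_eq hL ((Complex.abs_re_le_norm _).trans (hV q₁ l))
      ((Complex.abs_re_le_norm _).trans (hV q₂ l)) hc.1
    have him := abs_sub_le_of_floor_eq hL ((Complex.abs_im_le_norm _).trans (hV q₁ l))
      ((Complex.abs_im_le_norm _).trans (hV q₂ l)) hc.2
    refine (Complex.norm_le_abs_re_add_abs_im _).trans ?_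
    rw [Complex.sub_re, Complex.sub_im, mul_div_assoc, two_mul]
    exact add_le_add hre him

/-- A nonzero integer polynomial of degree at most `D` in each variable, with coefficients at most
`H`, whose composition with `Φ` is small on the part of `Y` in the polydisc of radius `1 / 2`. -/
theorem exists_int_polynomial_small {m k e : ℕ} {Y : Set ((Fin m → ℂ) × (Fin k → ℂ))}
    (hred : ∀ (j : Fin k) (q : ℕ), ∃ c : Fin e → (Fin m → ℂ) → ℂ,
      (∀ i, DifferentiableOn ℂ (c i) (ball 0 1)) ∧ (∀ i, ∀ z ∈ ball 0 1, ‖c i z‖ ≤ 3 ^ q) ∧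
        ∀ z ∈ ball 0 1, ∀ w, (z, w) ∈ Y → w j ^ q = ∑ i, c i z * w j ^ (i : ℕ))
    {l : ℕ} {Φ : (Fin m → ℂ) × (Fin k → ℂ) → Fin l → ℂ}
    (hΦ : DifferentiableOn ℂ Φ (ball 0 1 ×ˢ ball 0 1)) {M : ℝ} (hM1 : 1 ≤ M)
    (hM : ∀ p ∈ ball 0 1 ×ˢ ball 0 1, ‖Φ p‖ ≤ M) (D H N N' : ℕ) {L : ℕ} (hL : 1 ≤ L)
    (hcard : (2 * L + 1) ^ (2 * (N' ^ m * e ^ k)) < (H + 1) ^ ((D + 1) ^ l)) :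
    ∃ p : (Fin l → Fin (D + 1)) → ℤ, p ≠ 0 ∧ (∀ γ, |p γ| ≤ H) ∧
      ∀ z w, (z, w) ∈ Y → ‖z‖ ≤ 1 / 2 → ‖w‖ ≤ 1 / 2 →
        ‖∑ γ, (p γ : ℂ) * ∏ i, Φ (z, w) i ^ (γ i : ℕ)‖ ≤
          (D + 1) ^ l * H * (2 * 3 ^ k * M ^ (l * D) * (2 / 3) ^ N +
            e ^ k * (2 * 3 ^ m * (M ^ (l * D) * 4 ^ (k * N)) * (2 / 3) ^ N')) +
          N' ^ m * e ^ k * (2 * ((D + 1) ^ l * H *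
            (M ^ (l * D) * 4 ^ (k * N) * (4 / 3) ^ (m * N'))) / L) := by
  have hF : ∀ γ : Fin l → Fin (D + 1),
      DifferentiableOn ℂ (fun p => ∏ i, Φ p i ^ (γ i : ℕ)) (ball 0 1 ×ˢ ball 0 1) := by
    intro γ p hp
    have hat := hΦ.differentiableAt ((isOpen_ball.prod isOpen_ball).mem_nhds hp)
    refine DifferentiableAt.differentiableWithinAt (differentiableAt_fun_prod fun i _ => ?_)
    exact (differentiableAt_pi.1 hat i).pow _
  have hFM : ∀ γ : Fin l → Fin (D + 1), ∀ p ∈ ball 0 1 ×ˢ ball 0 1,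
      ‖∏ i, Φ p i ^ (γ i : ℕ)‖ ≤ M ^ (l * D) := by
    intro γ p hp
    rw [norm_prod]
    calc _ ≤ ∏ _i : Fin l, M ^ D := by
          refine Finset.prod_le_prod (fun _ _ => norm_nonneg _) fun i _ => ?_
          rw [norm_pow]
          calc _ ≤ M ^ (γ i : ℕ) := by
                gcongr
                exact (norm_le_pi_norm _ i).trans (hM p hp)
            _ ≤ M ^ D := pow_le_pow_right₀ hM1 (Nat.lt_succ_iff.1 (γ i).is_lt)
      _ = _ := by rw [Finset.prod_const, Finset.card_univ, Fintype.card_fin, ← pow_mul, mul_comm D]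
  choose a haM ha using fun γ => exists_monomial_approximation hred (hF γ) (hFM γ) N N'
  obtain ⟨p, hp0, hpH, hp⟩ := exists_int_vector_small_forms (fun α γ => a γ α)
    (fun α γ => haM γ α) (H := H) hL (by
      simpa only [Fintype.card_prod, Fintype.card_fun, Fintype.card_fin] using hcard)
  refine ⟨p, hp0, hpH, fun z w hzw hz hw => ?_⟩
  set μ : (Fin m → Fin N') × (Fin k → Fin e) → ℂ := fun α =>
    (∏ i, z i ^ (α.1 i : ℕ)) * ∏ j, w j ^ (α.2 j : ℕ) with hμ
  have hμ1 : ∀ α, ‖μ α‖ ≤ 1 := by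
    intro α
    have hpow : ∀ {x : ℂ} (n : ℕ), ‖x‖ ≤ 1 / 2 → ‖x ^ n‖ ≤ 1 := fun n hx => by
      rw [norm_pow]
      exact pow_le_one₀ (norm_nonneg _) (hx.trans (by norm_num))
    rw [hμ, norm_mul, norm_prod, norm_prod]
    refine mul_le_one₀ (Finset.prod_le_one (fun _ _ => norm_nonneg _) fun i _ => ?_)
      (Finset.prod_nonneg fun _ _ => norm_nonneg _)
      (Finset.prod_le_one (fun _ _ => norm_nonneg _) fun j _ => ?_)
    · exact hpow _ ((norm_le_pi_norm z i).trans hz)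
    · exact hpow _ ((norm_le_pi_norm w j).trans hw)
  have hsplit : ∑ γ, (p γ : ℂ) * ∏ i, Φ (z, w) i ^ (γ i : ℕ) =
      ∑ γ, (p γ : ℂ) * (∏ i, Φ (z, w) i ^ (γ i : ℕ) - ∑ α, a γ α * μ α) +
        ∑ α, (∑ γ, (p γ : ℂ) * a γ α) * μ α := by
    have : ∑ α, (∑ γ, (p γ : ℂ) * a γ α) * μ α = ∑ γ, (p γ : ℂ) * ∑ α, a γ α * μ α := by
      simp only [Finset.sum_mul, Finset.mul_sum, mul_assoc]
      exact Finset.sum_comm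
    rw [this, ← Finset.sum_add_distrib]
    exact Finset.sum_congr rfl fun γ _ => by ring
  rw [hsplit]
  refine norm_add_le_of_le ?_ ?_
  · refine (norm_sum_le _ _).trans ((Finset.sum_le_card_nsmul _ _
      (H * (2 * 3 ^ k * M ^ (l * D) * (2 / 3) ^ N +
        e ^ k * (2 * 3 ^ m * (M ^ (l * D) * 4 ^ (k * N)) * (2 / 3) ^ N')))
            fun γ _ => ?_).trans_eq ?_)
    · rw [norm_mul, Complex.norm_intCast]
      have : |(p γ : ℝ)| ≤ H := by exact_mod_cast hpH γ
      gcongr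
      exact ha γ z w hzw hz hw
    · rw [Finset.card_univ, Fintype.card_fun, Fintype.card_fin, Fintype.card_fin, nsmul_eq_mul]
      push_cast
      ring
  · refine (norm_sum_le _ _).trans ((Finset.sum_le_card_nsmul _ _
      (2 * ((D + 1) ^ l * H * (M ^ (l * D) * 4 ^ (k * N) * (4 / 3) ^ (m * N'))) / L)
      fun α _ => ?_).trans_eq ?_)
    · rw [norm_mul]
      refine (mul_le_of_le_one_right (norm_nonneg _) (hμ1 α)).trans ((hp α).trans_eq ?_)
      rw [Fintype.card_fun, Fintype.card_fin, Fintype.card_fin]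
      push_cast
      ring
    · rw [Finset.card_univ, Fintype.card_prod, Fintype.card_fun, Fintype.card_fun, Fintype.card_fin,
        Fintype.card_fin, Fintype.card_fin, Fintype.card_fin, nsmul_eq_mul]
      push_cast
      ring

end Pigeonhole

/-! ### Products over conjugates -/

section Liouville

open Polynomial IntermediateField

/-- If `f` has algebraic integers as coefficients and `x` is a root of `f`, then `f / (X - x)` also
has algebraic integers as coefficients. -/
theorem exists_integral_quotient (f : (integralClosure ℤ ℂ)[X]) (x : ℂ) (hx : aeval x f = 0) :
    ∃ q : (integralClosure ℤ ℂ)[X], f.map (algebraMap _ ℂ) =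
        (X - C x) * q.map (algebraMap _ ℂ) := by
  induction hn : f.natDegree using Nat.strong_induction_on generalizing f with
  | _ n ih =>
    by_cases hf : f = 0
    · exact ⟨0, by simp [hf]⟩
    have hn0 : n ≠ 0 := by
      rintro rfl
      rw [eq_C_of_natDegree_eq_zero hn, aeval_C, map_eq_zero_iff _ Subtype.val_injective] at hx
      exact hf (by rw [eq_C_of_natDegree_eq_zero hn, hx, C_0])
    have hint : IsIntegral ℤ ((f.leadingCoeff : ℂ) * x) := by
      have h1 := isIntegral_leadingCoeff_smul f x hx
      exact isIntegral_trans (R := ℤ) (A := integralClosure ℤ ℂ) _ h1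
    set b : integralClosure ℤ ℂ := ⟨(f.leadingCoeff : ℂ) * x, hint⟩ with hb
    set f' : (integralClosure ℤ ℂ)[X] :=
      f - (C f.leadingCoeff * X ^ n) + C b * X ^ (n - 1) with hf'
    have hx' : aeval x f' = 0 := by
      simp only [hf', map_add, map_sub, map_mul, aeval_C, map_pow, aeval_X, hx]
      have : x ^ n = x * x ^ (n - 1) := by
          rw [← pow_succ', Nat.sub_add_cancel (Nat.pos_of_ne_zero hn0)]
      rw [this, show (algebraMap (integralClosure ℤ ℂ) ℂ) b = (f.leadingCoeff : ℂ) * x from rfl,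
        show (algebraMap (integralClosure ℤ ℂ) ℂ) f.leadingCoeff = (f.leadingCoeff : ℂ) from rfl]
      ring
    have hdeg : f'.natDegree < n := by
      have h1 : (f - C f.leadingCoeff * X ^ n).degree < f.degree := by
        rw [← hn, C_mul_X_pow_eq_monomial]
        exact degree_sub_lt_left (by rw [degree_monomial _ (leadingCoeff_ne_zero.2 hf),
          degree_eq_natDegree hf]) hf (by simp)
      have h2 : f'.degree < n := by
        rw [degree_eq_natDegree hf, hn] at h1
        refine (degree_add_le _ _).trans_lt (max_lt h1 ((degree_C_mul_X_pow_le _ _).trans_lt ?_))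
        exact_mod_cast Nat.sub_lt (Nat.pos_of_ne_zero hn0) one_pos
      by_cases h0 : f' = 0
      · rw [h0, natDegree_zero]
        exact Nat.pos_of_ne_zero hn0
      · exact (natDegree_lt_iff_degree_lt h0).2 h2
    obtain ⟨q, hq⟩ := ih _ hdeg f' hx' rfl
    refine ⟨q + C f.leadingCoeff * X ^ (n - 1), ?_⟩
    have hX : (X : ℂ[X]) ^ n = X * X ^ (n - 1) := by
      rw [← pow_succ', Nat.sub_add_cancel (Nat.pos_of_ne_zero hn0)]
    have h3 : f.map (algebraMap (integralClosure ℤ ℂ) ℂ) = f'.map (algebraMap _ ℂ) +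
        C (f.leadingCoeff : ℂ) * X ^ n - C ((f.leadingCoeff : ℂ) * x) * X ^ (n - 1) := by
      simp only [hf', Polynomial.map_add, Polynomial.map_sub, Polynomial.map_mul, map_C,
        Polynomial.map_pow, map_X]
      rw [show (algebraMap (integralClosure ℤ ℂ) ℂ) b = (f.leadingCoeff : ℂ) * x from rfl,
        show (algebraMap (integralClosure ℤ ℂ) ℂ) f.leadingCoeff = (f.leadingCoeff : ℂ) from rfl]
      ring
    rw [h3, hq]
    simp only [Polynomial.map_add, Polynomial.map_mul, map_C, Polynomial.map_pow, map_X]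
    rw [show (algebraMap (integralClosure ℤ ℂ) ℂ) f.leadingCoeff = (f.leadingCoeff : ℂ) from rfl,
        hX,
      C_mul]
    ring

/-- If `a * ∏ (X - xₛ)` has algebraic integers as coefficients, then `a * ∏ xₛ` is an algebraic
integer, the product extending over any subset of the roots. -/
theorem isIntegral_mul_prod_roots {S : Type*} [DecidableEq S] (x : S → ℂ) (a : ℂ) (I J : Finset S)
    (hIJ : I ⊆ J) (f : (integralClosure ℤ ℂ)[X])
    (hf : f.map (algebraMap _ ℂ) = C a * ∏ s ∈ J, (X - C (x s))) :
    IsIntegral ℤ (a * ∏ s ∈ I, x s) := by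
  induction hJ : (J \ I).card generalizing J f with
  | zero =>
    rw [Finset.card_eq_zero, Finset.sdiff_eq_empty_iff_subset] at hJ
    obtain rfl := hIJ.antisymm hJ
    have h0 := congrArg (eval 0) hf
    simp only [eval_mul, eval_C, eval_prod, eval_sub, eval_X, zero_sub, Finset.prod_neg] at h0
    have h1 : a * ∏ s ∈ I, x s = (-1) ^ I.card * (f.map (algebraMap _ ℂ)).eval 0 := by
      rw [h0, mul_left_comm, ← mul_assoc ((-1) ^ I.card), ← mul_pow]
      simp
    rw [h1, ← coeff_zero_eq_eval_zero, coeff_map]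
    exact (isIntegral_one.neg.pow _).mul (f.coeff 0).2
  | succ n ih =>
    obtain ⟨s, hs⟩ := Finset.card_pos.1 (by omega : 0 < (J \ I).card)
    obtain ⟨hsJ, hsI⟩ := Finset.mem_sdiff.1 hs
    have hroot : aeval (x s) f = 0 := by
      rw [aeval_def, eval₂_eq_eval_map, hf, eval_mul, eval_prod,
        Finset.prod_eq_zero hsJ (by simp), mul_zero]
    obtain ⟨q, hq⟩ := exists_integral_quotient f (x s) hroot
    refine ih (J.erase s) (fun i hi => Finset.mem_erase.2 ⟨fun h => hsI (h ▸ hi), hIJ hi⟩) q ?_ ?_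
    · rw [← Finset.mul_prod_erase _ _ hsJ, mul_left_comm] at hf
      exact mul_left_cancel₀ (X_sub_C_ne_zero (x s)) (hq.symm.trans hf)
    · rw [Finset.erase_sdiff_comm, Finset.card_erase_of_mem hs, hJ]
      rfl

/-- The version of `isIntegral_mul_prod_roots` for monomials of degree at most `D` in each root. -/
theorem isIntegral_pow_mul_prod_pow {S : Type*} [Fintype S] {x : S → ℂ} {a : ℂ}
    {f : (integralClosure ℤ ℂ)[X]} (hf : f.map (algebraMap _ ℂ) = C a * ∏ s, (X - C (x s))) (D : ℕ)
    {n : S → ℕ} (hn : ∀ s, n s ≤ D) : IsIntegral ℤ (a ^ D * ∏ s, x s ^ n s) := by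
  classical
  -- split the monomial into `D` squarefree ones
  have h : a ^ D * ∏ s, x s ^ n s =
      ∏ t ∈ Finset.range D, (a * ∏ s with t < n s, x s) := by
    rw [Finset.prod_mul_distrib, Finset.prod_const, Finset.card_range]
    congr 1
    simp only [Finset.prod_filter]
    rw [Finset.prod_comm]
    refine Finset.prod_congr rfl fun s _ => ?_
    rw [← Finset.prod_filter, Finset.prod_const]
    congr 1
    rw [show (Finset.range D).filter (· < n s) = Finset.range (n s) by
      ext t
      simp only [Finset.mem_filter, Finset.mem_range]
      have := hn s
      omega, Finset.card_range]
  rw [h]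
  exact IsIntegral.prod _ fun t _ =>
    isIntegral_mul_prod_roots x a _ Finset.univ (Finset.subset_univ _) f hf

/-- The product of the conjugates of an integral polynomial expression becomes an algebraic integer
after multiplication with the `D`-th powers of the leading coefficients, where `D` bounds the
partial degrees. -/
theorem isIntegral_prod_conjugates {S : Type*} [Fintype S] {l D : ℕ} {x : Fin l → S → ℂ}
    {a : Fin l → ℂ}
    {f : Fin l → (integralClosure ℤ ℂ)[X]}
    (hf : ∀ i, (f i).map (algebraMap _ ℂ) = C (a i) * ∏ s, (X - C (x i s)))
    (p : (Fin l → Fin (D + 1)) → ℤ) :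
    IsIntegral ℤ ((∏ i, a i ^ D) * ∏ s, ∑ γ, (p γ : ℂ) * ∏ i, x i s ^ (γ i : ℕ)) := by
  classical
  rw [Finset.prod_univ_sum, Fintype.piFinset_univ, Finset.mul_sum]
  refine IsIntegral.sum _ fun γ _ => ?_
  rw [Finset.prod_mul_distrib, mul_left_comm, Finset.prod_comm, ← Finset.prod_mul_distrib]
  refine IsIntegral.mul (IsIntegral.prod _ fun s _ => ?_) (IsIntegral.prod _ fun i _ => ?_)
  · exact isIntegral_algebraMap (R := ℤ) (A := ℂ) (x := p (γ s))
  · exact isIntegral_pow_mul_prod_pow (hf i) D fun s => Nat.lt_succ_iff.1 (γ s i).is_lt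

/-- Every root of the minimal polynomial of `x` is the image of `x` under `[K : ℚ(x)]`
embeddings. -/
theorem prod_embeddings_eq_prod_roots_pow {K : Type*} [Field K] [NumberField K] {M : Type*}
    [CommMonoid M] (x : K) (f : ℂ → M) :
    ∏ σ : K →ₐ[ℚ] ℂ, f (σ x) =
      (((minpoly ℚ x).aroots ℂ).map f).prod ^ Module.finrank ℚ⟮x⟯ K := by
  classical
  have hx : IsIntegral ℚ x := Algebra.IsIntegral.isIntegral x
  let := fintypeOfAlgHomAdjoinIntegral ℚ hx (K := ℂ)
  have h1 : ∏ σ : K →ₐ[ℚ] ℂ, f (σ x) =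
      (∏ σ : ℚ⟮x⟯ →ₐ[ℚ] ℂ, f (σ (AdjoinSimple.gen ℚ x))) ^ Module.finrank ℚ⟮x⟯ K := by
    rw [Fintype.prod_equiv (algHomEquivSigma (B := ℚ⟮x⟯)) (fun σ : K →ₐ[ℚ] ℂ => _)
      fun σ => f (σ.1 (AdjoinSimple.gen ℚ x)),
      ← Finset.univ_sigma_univ, Finset.prod_sigma, ← Finset.prod_pow]
    · refine Finset.prod_congr rfl fun σ _ => ?_
      let : Algebra ℚ⟮x⟯ ℂ := σ.toRingHom.toAlgebra
      simp_rw [Finset.prod_const]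
      congr
      exact AlgHom.card ℚ⟮x⟯ K ℂ
    · intro σ
      simp only [algHomEquivSigma, Equiv.coe_fn_mk, AlgHom.domRestrict, AlgHom.comp_apply,
        IsScalarTower.coe_toAlgHom', AdjoinSimple.algebraMap_gen]
  rw [h1]
  congr 1
  have hnodup : ((minpoly ℚ x).aroots ℂ).Nodup :=
    nodup_roots ((minpoly.irreducible hx).separable.map)
  have hgen : ∀ σ : ℚ⟮x⟯ →ₐ[ℚ] ℂ, (algHomAdjoinIntegralEquiv ℚ hx σ : ℂ) =
      σ (AdjoinSimple.gen ℚ x) := fun σ => by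
    have := algHomAdjoinIntegralEquiv_symm_apply_gen ℚ hx (algHomAdjoinIntegralEquiv ℚ hx σ)
    exact this.symm.trans (congrArg (fun τ : ℚ⟮x⟯ →ₐ[ℚ] ℂ => τ (AdjoinSimple.gen ℚ x))
      ((algHomAdjoinIntegralEquiv ℚ hx).symm_apply_apply σ))
  have h2 : ∏ σ : ℚ⟮x⟯ →ₐ[ℚ] ℂ, f (σ (AdjoinSimple.gen ℚ x)) =
      ∏ t ∈ ((minpoly ℚ x).aroots ℂ).toFinset, f t := by
    refine Finset.prod_nbij (fun σ => σ (AdjoinSimple.gen ℚ x)) (fun σ _ => ?_) ?_ ?_ fun _ _ => rfl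
    · rw [Multiset.mem_toFinset, ← hgen]
      exact (algHomAdjoinIntegralEquiv ℚ hx σ).2
    · intro σ _ τ _ h
      refine (algHomAdjoinIntegralEquiv ℚ hx).injective (Subtype.ext ?_)
      rw [hgen, hgen]
      exact h
    · intro t ht
      rw [Finset.mem_coe, Multiset.mem_toFinset] at ht
      refine ⟨(algHomAdjoinIntegralEquiv ℚ hx).symm ⟨t, ht⟩,
          Finset.mem_coe.2 (Finset.mem_univ _), ?_⟩
      exact algHomAdjoinIntegralEquiv_symm_apply_gen ℚ hx ⟨t, ht⟩
  rw [h2, Finset.prod_eq_multiset_prod, Multiset.toFinset_val, Multiset.dedup_eq_self.mpr hnodup]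

end Liouville

/-! ### Weil heights and Liouville's inequality -/

section Heights

open Polynomial IntermediateField

/-- Clearing denominators and dividing by the content changes the minimal polynomial by a nonzero
rational factor only, which is the leading coefficient of the result. -/
theorem intMinpoly_map_rat {x : ℂ} (hx : IsAlgebraic ℚ x) :
    (intMinpoly x).leadingCoeff ≠ 0 ∧
      (intMinpoly x).map (Int.castRingHom ℚ) =
          C ((intMinpoly x).leadingCoeff : ℚ) * minpoly ℚ x := by
  set f := IsLocalization.integerNormalization (nonZeroDivisors ℤ) (minpoly ℚ x) with hf
  obtain ⟨b, hb, hfb⟩ := IsLocalization.integerNormalization_spec (nonZeroDivisors ℤ) (minpoly ℚ x)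
  have hmp : (minpoly ℚ x).Monic := minpoly.monic hx.isIntegral
  have hb0 : (b : ℚ) ≠ 0 := by exact_mod_cast nonZeroDivisors.ne_zero hb
  have hfb' : f.map (Int.castRingHom ℚ) = C (b : ℚ) * minpoly ℚ x := by
    rw [← smul_eq_C_mul, Int.cast_smul_eq_zsmul]
    exact hfb
  have hf0 : f ≠ 0 := by
    intro h0
    rw [h0, Polynomial.map_zero] at hfb'
    exact mul_ne_zero (C_ne_zero.2 hb0) hmp.ne_zero hfb'.symm
  have hc0 : (f.content : ℚ) ≠ 0 := by
    exact_mod_cast fun h => hf0 (content_eq_zero_iff.1 h)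
  have h1 : (intMinpoly x).map (Int.castRingHom ℚ) = C ((b : ℚ) / f.content) * minpoly ℚ x := by
    have h2 := congrArg (Polynomial.map (Int.castRingHom ℚ)) f.eq_C_content_mul_primPart
    rw [hfb', Polynomial.map_mul, map_C] at h2
    refine mul_left_cancel₀ (C_ne_zero.2 hc0) ?_
    rw [← mul_assoc, ← C_mul, mul_div_cancel₀ _ hc0]
    exact h2.symm
  have h3 : ((intMinpoly x).leadingCoeff : ℚ) = b / f.content := by
    have h4 := congrArg leadingCoeff h1
    rw [leadingCoeff_map_of_injective (RingHom.injective_int _), leadingCoeff_mul, leadingCoeff_C,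
      hmp.leadingCoeff, mul_one] at h4
    exact h4
  refine ⟨fun h0 => ?_, by rw [h3, h1]⟩
  rw [h0, Int.cast_zero] at h3
  exact div_ne_zero hb0 hc0 h3.symm

theorem intMinpoly_map_complex {x : ℂ} (hx : IsAlgebraic ℚ x) :
    (intMinpoly x).map (Int.castRingHom ℂ) =
      C ((intMinpoly x).leadingCoeff : ℂ) * (minpoly ℚ x).map (algebraMap ℚ ℂ) := by
  have h := congrArg (Polynomial.map (algebraMap ℚ ℂ)) (intMinpoly_map_rat hx).2
  rw [Polynomial.map_map, Polynomial.map_mul, map_C, map_intCast] at h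
  rw [← h]
  congr 1

/-- The multiplicative form of the definition of the height. -/
theorem exp_natDegree_mul_weilHeight {x : ℂ} (hx : IsAlgebraic ℚ x) :
    Real.exp ((minpoly ℚ x).natDegree * weilHeight x) =
      |((intMinpoly x).leadingCoeff : ℝ)| *
        (((minpoly ℚ x).aroots ℂ).map fun t => max 1 ‖t‖).prod := by
  have ha : ((intMinpoly x).leadingCoeff : ℂ) ≠ 0 := by exact_mod_cast (intMinpoly_map_rat hx).1
  have hdeg : (intMinpoly x).natDegree = (minpoly ℚ x).natDegree := by
    have h := congrArg natDegree (intMinpoly_map_rat hx).2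
    rw [natDegree_map_eq_of_injective (RingHom.injective_int _),
      natDegree_C_mul (by exact_mod_cast (intMinpoly_map_rat hx).1)] at h
    exact h
  have hd0 : ((minpoly ℚ x).natDegree : ℝ) ≠ 0 := by
    exact_mod_cast (minpoly.natDegree_pos hx.isIntegral).ne'
  have hroots : ((intMinpoly x).map (Int.castRingHom ℂ)).roots = (minpoly ℚ x).aroots ℂ := by
    rw [intMinpoly_map_complex hx, roots_C_mul _ ha]
  rw [weilHeight, hdeg, hroots, mul_div_cancel₀ _ hd0, Real.exp_add, Real.exp_log
    (abs_pos.2 (by exact_mod_cast (intMinpoly_map_rat hx).1))]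
  congr 1
  induction (minpoly ℚ x).aroots ℂ using Multiset.induction_on with
  | empty => simp
  | cons t s ih =>
    rw [Multiset.map_cons, Multiset.sum_cons, Real.exp_add, ih, Multiset.map_cons,
      Multiset.prod_cons, Real.posLog_eq_log_max_one (norm_nonneg t),
      Real.exp_log (lt_of_lt_of_le one_pos (le_max_left _ _))]

/-- Liouville's inequality: a nonzero value of an integer polynomial at a vector of algebraic
numbers is not too small. The product of the conjugates of the value, times suitable powers of the
leading coefficients of the minimal polynomials, is a nonzero integer. -/
theorem one_le_norm_mul_of_ne_zero {l D H : ℕ} {y : Fin l → ℂ} (hy : ∀ i, IsAlgebraic ℚ (y i))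
    {p : (Fin l → Fin (D + 1)) → ℤ} (hp : ∀ γ, |p γ| ≤ H)
    (hne : ∑ γ, (p γ : ℂ) * ∏ i, y i ^ (γ i : ℕ) ≠ 0) :
    1 ≤ ‖∑ γ, (p γ : ℂ) * ∏ i, y i ^ (γ i : ℕ)‖ *
      (((D + 1) ^ l * H : ℝ) ^ fieldDegree y *
        Real.exp (D * (fieldDegree y * ∑ i, weilHeight (y i)))) := by
  classical
  set K := IntermediateField.adjoin ℚ (range y) with hK
  have hfin : FiniteDimensional ℚ K :=
    finiteDimensional_adjoin (by rintro _ ⟨i, rfl⟩; exact (hy i).isIntegral)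
  have hNF : NumberField K := { to_finiteDimensional := hfin }
  set d := fieldDegree y with hd
  have hcardK : Fintype.card (K →ₐ[ℚ] ℂ) = d := AlgHom.card ℚ K ℂ
  let x : Fin l → K := fun i => ⟨y i, subset_adjoin ℚ _ ⟨i, rfl⟩⟩
  have hxy : ∀ i, minpoly ℚ (x i) = minpoly ℚ (y i) := fun i =>
    (minpoly.algebraMap_eq (algebraMap K ℂ).injective (x i)).symm
  -- each conjugate of `y i` is the image of `x i` under `c i` embeddings of `K`
  let c : Fin l → ℕ := fun i => Module.finrank ℚ⟮x i⟯ K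
  have hdc : ∀ i, (minpoly ℚ (y i)).natDegree * c i = d := by
    intro i
    rw [← hxy, ← adjoin.finrank (Algebra.IsIntegral.isIntegral (x i))]
    exact Module.finrank_mul_finrank ℚ ℚ⟮x i⟯ K
  let a : Fin l → ℂ := fun i => ((intMinpoly (y i)).leadingCoeff : ℂ) ^ c i
  have ha0 : ∀ i, a i ≠ 0 := fun i =>
    pow_ne_zero _ (by exact_mod_cast (intMinpoly_map_rat (hy i)).1)
  let f : Fin l → (integralClosure ℤ ℂ)[X] := fun i =>
    ((intMinpoly (y i)).map (algebraMap ℤ (integralClosure ℤ ℂ))) ^ c i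
  have hf : ∀ i, (f i).map (algebraMap _ ℂ) = C (a i) * ∏ σ : K →ₐ[ℚ] ℂ, (X - C (σ (x i))) := by
    intro i
    rw [prod_embeddings_eq_prod_roots_pow (x i) fun t => X - C t, hxy]
    have h1 : (((minpoly ℚ (y i)).aroots ℂ).map fun t => X - C t).prod =
        (minpoly ℚ (y i)).map (algebraMap ℚ ℂ) :=
      ((IsAlgClosed.splits _).eq_prod_roots_of_monic
        ((minpoly.monic (hy i).isIntegral).map _)).symm
    have h2 : ((intMinpoly (y i)).map (algebraMap ℤ (integralClosure ℤ ℂ))).map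
        (algebraMap _ ℂ) = (intMinpoly (y i)).map (Int.castRingHom ℂ) := by
      rw [Polynomial.map_map]
      congr 1
    rw [h1, Polynomial.map_pow, h2, intMinpoly_map_complex (hy i), mul_pow, ← C_pow]
  set α : K := ∑ γ, (p γ : K) * ∏ i, x i ^ (γ i : ℕ) with hα
  have hσα : ∀ σ : K →ₐ[ℚ] ℂ, σ α = ∑ γ, (p γ : ℂ) * ∏ i, σ (x i) ^ (γ i : ℕ) := by
    intro σ
    simp only [hα, map_sum, map_mul, map_intCast, map_prod, map_pow]
  set σ₀ : K →ₐ[ℚ] ℂ := K.val with hσ₀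
  have hval : ∑ γ, (p γ : ℂ) * ∏ i, y i ^ (γ i : ℕ) = σ₀ α := (hσα σ₀).symm
  have hα0 : α ≠ 0 := by
    rintro h0
    rw [hval, h0, map_zero] at hne
    exact hne rfl
  -- The product `W` of the conjugates of `α` and the numbers `aᵢ ^ D` is an algebraic integer, and
  -- rational, being a multiple of the norm of `α`. So it is a nonzero integer.
  have hint := isIntegral_prod_conjugates hf p
  simp only [← hσα] at hint
  obtain ⟨r, hr⟩ : ∃ r : ℚ, (algebraMap ℚ ℂ r) = (∏ i, a i ^ D) * ∏ σ : K →ₐ[ℚ] ℂ, σ α := by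
    refine ⟨(∏ i, (((intMinpoly (y i)).leadingCoeff : ℚ) ^ c i) ^ D) * Algebra.norm ℚ α, ?_⟩
    rw [map_mul, Algebra.norm_eq_prod_embeddings ℚ ℂ α, map_prod]
    simp [a]
  rw [← hr, isIntegral_algebraMap_iff (algebraMap ℚ ℂ).injective,
    IsIntegrallyClosed.isIntegral_iff] at hint
  obtain ⟨W, hW⟩ := hint
  have hprod0 : (∏ i, a i ^ D) * ∏ σ : K →ₐ[ℚ] ℂ, σ α ≠ 0 :=
    mul_ne_zero (Finset.prod_ne_zero_iff.2 fun i _ => pow_ne_zero _ (ha0 i))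
      (Finset.prod_ne_zero_iff.2 fun σ _ => (map_ne_zero σ).2 hα0)
  have hWn : 1 ≤ ‖(∏ i, a i ^ D) * ∏ σ : K →ₐ[ℚ] ℂ, σ α‖ := by
    rw [← hr, ← hW] at hprod0 ⊢
    simp only [eq_intCast, map_intCast, Complex.norm_intCast] at hprod0 ⊢
    have : W ≠ 0 := by exact_mod_cast hprod0
    exact_mod_cast Int.one_le_abs this
  -- the upper bound for the conjugates
  set B : ℝ := (D + 1) ^ l * H with hB
  have hbound : ∀ σ : K →ₐ[ℚ] ℂ, ‖σ α‖ ≤ B * ∏ i, max 1 ‖σ (x i)‖ ^ D := by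
    intro σ
    rw [hσα]
    refine (norm_sum_le _ _).trans ((Finset.sum_le_card_nsmul _ _
      (H * ∏ i, max 1 ‖σ (x i)‖ ^ D) fun γ _ => ?_).trans_eq ?_)
    · rw [norm_mul, Complex.norm_intCast, norm_prod]
      have h1 : |(p γ : ℝ)| ≤ H := by exact_mod_cast hp γ
      gcongr with i
      rw [norm_pow]
      calc _ ≤ max 1 ‖σ (x i)‖ ^ (γ i : ℕ) := by
            gcongr
            exact le_max_right _ _
        _ ≤ _ := pow_le_pow_right₀ (le_max_left _ _) (Nat.lt_succ_iff.1 (γ i).is_lt)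
    · rw [Finset.card_univ, Fintype.card_fun, Fintype.card_fin, Fintype.card_fin, nsmul_eq_mul]
      push_cast
      ring
  have hmax1 : ∀ σ : K →ₐ[ℚ] ℂ, 1 ≤ ∏ i, max 1 ‖σ (x i)‖ ^ D := fun σ =>
    (Finset.prod_const_one (s := (Finset.univ : Finset (Fin l)))).symm.trans_le
      (Finset.prod_le_prod (fun _ _ => zero_le_one) fun i _ => one_le_pow₀ (le_max_left _ _))
  have hB1 : 1 ≤ B := by
    have hH : 1 ≤ H := by
      by_contra hH
      refine hne (Finset.sum_eq_zero fun γ _ => ?_)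
      have h1 := hp γ
      rw [Nat.lt_one_iff.1 (not_le.1 hH), Nat.cast_zero, abs_nonpos_iff] at h1
      rw [h1, Int.cast_zero, zero_mul]
    have hH' : (1 : ℝ) ≤ H := by exact_mod_cast hH
    have hD : (1 : ℝ) ≤ D + 1 := le_add_of_nonneg_left (Nat.cast_nonneg D)
    exact one_le_mul_of_one_le_of_one_le (one_le_pow₀ hD) hH'
  have hexp : (∏ i, ‖a i‖ ^ D) * ∏ σ : K →ₐ[ℚ] ℂ, ∏ i, max 1 ‖σ (x i)‖ ^ D =
      Real.exp (D * (d * ∑ i, weilHeight (y i))) := by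
    rw [Finset.prod_comm, ← Finset.prod_mul_distrib, Finset.mul_sum, Finset.mul_sum, Real.exp_sum]
    refine Finset.prod_congr rfl fun i _ => ?_
    rw [Finset.prod_pow, ← mul_pow, prod_embeddings_eq_prod_roots_pow (x i) fun t => max 1 ‖t‖,
      hxy, norm_pow, Complex.norm_intCast, ← mul_pow, ← exp_natDegree_mul_weilHeight (hy i),
      ← Real.exp_nat_mul, ← Real.exp_nat_mul, ← hdc i]
    push_cast
    congr 1
    ring
  -- all conjugates but the value itself are estimated from above
  have hle : ∏ σ : K →ₐ[ℚ] ℂ, ‖σ α‖ ≤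
      ‖σ₀ α‖ * ∏ σ : K →ₐ[ℚ] ℂ, B * ∏ i, max 1 ‖σ (x i)‖ ^ D := by
    rw [← Finset.mul_prod_erase Finset.univ (fun σ : K →ₐ[ℚ] ℂ => ‖σ α‖) (Finset.mem_univ σ₀)]
    refine mul_le_mul_of_nonneg_left ?_ (norm_nonneg _)
    refine (Finset.prod_le_prod (fun _ _ => norm_nonneg _) fun σ _ => hbound σ).trans ?_
    rw [← Finset.mul_prod_erase Finset.univ
      (fun σ : K →ₐ[ℚ] ℂ => B * ∏ i, max 1 ‖σ (x i)‖ ^ D) (Finset.mem_univ σ₀)]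
    refine le_mul_of_one_le_left (Finset.prod_nonneg fun σ _ => ?_)
      (one_le_mul_of_one_le_of_one_le hB1 (hmax1 σ₀))
    exact (norm_nonneg _).trans (hbound σ)
  rw [hval]
  calc (1 : ℝ) ≤ (∏ i, ‖a i‖ ^ D) * ∏ σ : K →ₐ[ℚ] ℂ, ‖σ α‖ := by
        simpa only [norm_mul, norm_prod, norm_pow] using hWn
    _ ≤ (∏ i, ‖a i‖ ^ D) * (‖σ₀ α‖ * ∏ σ : K →ₐ[ℚ] ℂ, B * ∏ i, max 1 ‖σ (x i)‖ ^ D) :=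
        mul_le_mul_of_nonneg_left hle (Finset.prod_nonneg fun _ _ => by positivity)
    _ = _ := by
        rw [Finset.prod_mul_distrib, Finset.prod_const, Finset.card_univ, hcardK, ← hexp]
        ring

end Heights

/-! ### Weierstrass polydiscs in normalised coordinates -/

section Normalization

theorem IsProperOver.mono {E F : Type*} [NormedAddCommGroup E] [NormedSpace ℂ E]
    [NormedAddCommGroup F] [NormedSpace ℂ F] {G G' : Set E} {Y : Set (E × F)}
    (h : IsProperOver G Y) (hG' : IsOpen G') (hsub : G' ⊆ G) : IsProperOver G' Y :=
  ⟨hG', fun y hy => h.analytic y (hsub hy), fun y hy => h.bounded y (hsub hy)⟩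

/-- The number of points of the fibres is bounded over compact sets. -/
theorem IsProperOver.exists_ncard_fiber_le_of_isCompact {E : Type*} [NormedAddCommGroup E]
    [NormedSpace ℂ E] {k : ℕ} {G : Set E} {Y : Set (E × (Fin k → ℂ))} (hY : IsProperOver G Y)
    {K : Set E} (hK : IsCompact K) (hKG : K ⊆ G) :
    ∃ C : ℕ, ∀ y ∈ K, {w | (y, w) ∈ Y}.Finite ∧ {w | (y, w) ∈ Y}.ncard ≤ C := by
  refine hK.induction_on (p := fun K => ∃ C : ℕ, ∀ y ∈ K,
    {w | (y, w) ∈ Y}.Finite ∧ {w | (y, w) ∈ Y}.ncard ≤ C) ⟨0, by simp⟩ ?_ ?_ ?_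
  · rintro s t hst ⟨C, hC⟩
    exact ⟨C, fun y hy => hC y (hst hy)⟩
  · rintro s t ⟨C, hC⟩ ⟨C', hC'⟩
    refine ⟨max C C', fun y hy => ?_⟩
    rcases hy with hy | hy
    · exact ⟨(hC y hy).1, (hC y hy).2.trans (le_max_left _ _)⟩
    · exact ⟨(hC' y hy).1, (hC' y hy).2.trans (le_max_right _ _)⟩
  · intro y hy
    obtain ⟨C, hC⟩ := hY.exists_ncard_fiber_le (hKG hy)
    exact ⟨_, mem_nhdsWithin_of_mem_nhds hC, C, fun z hz => hz⟩

theorem IsAnalyticSubset.isAnalyticSetAt {n : ℕ} {Ω X : Set (EuclideanSpace ℂ (Fin n))}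
    (h : IsAnalyticSubset Ω X) {p : EuclideanSpace ℂ (Fin n)} (hp : p ∈ Ω) :
    IsAnalyticSetAt X p := by
  obtain ⟨U, hU, hpU, -, r, f, hf, hX⟩ := h.2 p hp
  refine ⟨U, hU, hpU, Fin r, inferInstance, fun i x => f x i, fun i x hx =>
    differentiableWithinAt_pi.1 (hf x hx) i, fun x hx => ?_⟩
  have : x ∈ X ∩ U ↔ x ∈ U ∧ f x = 0 := by rw [hX]; rfl
  rw [← funext_iff (g := fun _ => (0 : ℂ))]
  exact ⟨fun h => (this.1 ⟨h, hx⟩).2, fun h => (this.2 ⟨hx, h⟩).1⟩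

variable {n m k : ℕ}

namespace UnitaryPolydisc

/-- The affine parametrisation of `ℂⁿ` that maps the unit polydisc onto `Δ`. -/
noncomputable def param (Δ : UnitaryPolydisc n m k) (p : (Fin m → ℂ) × (Fin k → ℂ)) :
    EuclideanSpace ℂ (Fin n) :=
  Δ.coord.symm (WithLp.toLp 2 fun i => Δ.center i + Δ.radius i * Sum.elim p.1 p.2 i)

/-- The inverse of `UnitaryPolydisc.param`: the coordinates `z × w`, centred and rescaled. -/
noncomputable def unparam (Δ : UnitaryPolydisc n m k) (x : EuclideanSpace ℂ (Fin n)) :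
    (Fin m → ℂ) × (Fin k → ℂ) :=
  (fun i => (Δ.radius (Sum.inl i) : ℂ)⁻¹ * (Δ.coord x (Sum.inl i) - Δ.center (Sum.inl i)),
    fun j => (Δ.radius (Sum.inr j) : ℂ)⁻¹ * (Δ.coord x (Sum.inr j) - Δ.center (Sum.inr j)))

variable (Δ : UnitaryPolydisc n m k)

theorem radius_ne_zero (i : Fin m ⊕ Fin k) : (Δ.radius i : ℂ) ≠ 0 := by
  exact_mod_cast (Δ.radius_pos i).ne'

theorem coord_param (p : (Fin m → ℂ) × (Fin k → ℂ)) (i : Fin m ⊕ Fin k) :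
    Δ.coord (Δ.param p) i = Δ.center i + Δ.radius i * Sum.elim p.1 p.2 i := by
  simp [param]

theorem norm_coord_param_sub (p : (Fin m → ℂ) × (Fin k → ℂ)) (i : Fin m ⊕ Fin k) :
    ‖Δ.coord (Δ.param p) i - Δ.center i‖ = Δ.radius i * ‖Sum.elim p.1 p.2 i‖ := by
  rw [coord_param, add_sub_cancel_left, norm_mul, Complex.norm_real, Real.norm_eq_abs,
    abs_of_pos (Δ.radius_pos i)]

theorem unparam_param (p : (Fin m → ℂ) × (Fin k → ℂ)) : Δ.unparam (Δ.param p) = p := by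
  refine Prod.ext (funext fun i => ?_) (funext fun i => ?_) <;>
  simp [unparam, coord_param, Δ.radius_ne_zero]

theorem param_unparam (x : EuclideanSpace ℂ (Fin n)) : Δ.param (Δ.unparam x) = x := by
  refine Δ.coord.injective (PiLp.ext fun i => ?_)
  rw [coord_param]
  cases i <;> simp [unparam, Δ.radius_ne_zero]

theorem differentiable_param : Differentiable ℂ Δ.param := by
  have h : Differentiable ℂ fun p : (Fin m → ℂ) × (Fin k → ℂ) =>
      (WithLp.toLp 2 fun i => Δ.center i + Δ.radius i * Sum.elim p.1 p.2 i :
        EuclideanSpace ℂ (Fin m ⊕ Fin k)) := by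
    rw [differentiable_euclidean]
    rintro (i | i) <;> simp only [Sum.elim_inl, Sum.elim_inr] <;> fun_prop
  exact Δ.coord.symm.toContinuousLinearEquiv.differentiable.comp h

theorem differentiable_unparam : Differentiable ℂ Δ.unparam := by
  have h : ∀ i, Differentiable ℂ fun x => Δ.coord x i :=
    differentiable_euclidean.1 Δ.coord.toContinuousLinearEquiv.differentiable
  refine Differentiable.prodMk ?_ ?_ <;> refine differentiable_pi.2 fun i => ?_
  · exact ((h _).sub_const _).const_mul _
  · exact ((h _).sub_const _).const_mul _

theorem surjective_fderiv_param (p : (Fin m → ℂ) × (Fin k → ℂ)) :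
    Function.Surjective (fderiv ℂ Δ.param p) := by
  have h1 : Δ.param ∘ Δ.unparam = id := funext Δ.param_unparam
  have h2 := fderiv_comp (Δ.param p) (g := Δ.param) (f := Δ.unparam)
    (Δ.differentiable_param _) (Δ.differentiable_unparam _)
  rw [h1, fderiv_id, unparam_param] at h2
  intro v
  exact ⟨fderiv ℂ Δ.unparam (Δ.param p) v, (DFunLike.congr_fun h2 v).symm⟩

theorem eq_add (Δ : UnitaryPolydisc n m k) : n = m + k := by
  have := Δ.coord.toLinearEquiv.finrank_eq
  simpa using this

variable {Δ}

theorem param_mem_closedSet {p : (Fin m → ℂ) × (Fin k → ℂ)} (h₁ : ‖p.1‖ ≤ 1) (h₂ : ‖p.2‖ ≤ 1) :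
    Δ.param p ∈ Δ.closedSet := by
  intro i
  rw [norm_coord_param_sub]
  refine mul_le_of_le_one_right (Δ.radius_pos i).le ?_
  cases i with
  | inl i => exact (norm_le_pi_norm p.1 i).trans h₁
  | inr i => exact (norm_le_pi_norm p.2 i).trans h₂

theorem param_mem_toSet_iff {p : (Fin m → ℂ) × (Fin k → ℂ)} :
    Δ.param p ∈ Δ.toSet ↔ ‖p.1‖ < 1 ∧ ‖p.2‖ < 1 := by
  rw [pi_norm_lt_iff one_pos, pi_norm_lt_iff one_pos]
  have h : ∀ i, ‖Δ.coord (Δ.param p) i - Δ.center i‖ < Δ.radius i ↔ ‖Sum.elim p.1 p.2 i‖ < 1 := by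
    intro i
    rw [norm_coord_param_sub, mul_lt_iff_lt_one_right (Δ.radius_pos i)]
  exact (forall_congr' h).trans Sum.forall

theorem norm_le_half_of_param_mem_pow {p : (Fin m → ℂ) × (Fin k → ℂ)}
    (h : Δ.param p ∈ Δ.pow 2) : ‖p.1‖ ≤ 1 / 2 ∧ ‖p.2‖ ≤ 1 / 2 := by
  have h' : ∀ i, ‖Sum.elim p.1 p.2 i‖ ≤ 1 / 2 := by
    intro i
    have := h i
    rw [norm_coord_param_sub, mul_comm, mul_lt_mul_iff_left₀ (Δ.radius_pos i)] at this
    exact this.le.trans_eq (by norm_num)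
  exact ⟨(pi_norm_le_iff_of_nonneg (by norm_num)).2 fun i => h' (Sum.inl i),
    (pi_norm_le_iff_of_nonneg (by norm_num)).2 fun i => h' (Sum.inr i)⟩

theorem param_mem_wall {p : (Fin m → ℂ) × (Fin k → ℂ)} (h₁ : ‖p.1‖ ≤ 1) (h₂ : ‖p.2‖ = 1) :
    Δ.param p ∈ Δ.wall := by
  refine ⟨param_mem_closedSet h₁ h₂.le, ?_⟩
  by_contra! hne
  refine h₂.not_lt ((pi_norm_lt_iff one_pos).2 fun j => ?_)
  refine ((norm_le_pi_norm p.2 j).trans h₂.le).lt_of_ne fun h => hne j ?_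
  rw [norm_coord_param_sub, Sum.elim_inr, h, mul_one]

/-- The part of `X` in the polydisc, in normalised coordinates. -/
def normalized (Δ : UnitaryPolydisc n m k) (X : Set (EuclideanSpace ℂ (Fin n))) :
    Set ((Fin m → ℂ) × (Fin k → ℂ)) :=
  {p | Δ.param p ∈ X ∧ ‖p.2‖ < 1}

theorem ncard_fiber (X : Set (EuclideanSpace ℂ (Fin n))) {z : Fin m → ℂ} (hz : ‖z‖ < 1) :
    (Δ.fiber X fun i => Δ.center (Sum.inl i) + Δ.radius (Sum.inl i) * z i).ncard =
      {w | (z, w) ∈ Δ.normalized X}.ncard := by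
  have : Δ.fiber X (fun i => Δ.center (Sum.inl i) + Δ.radius (Sum.inl i) * z i) =
      (fun w => Δ.param (z, w)) '' {w | (z, w) ∈ Δ.normalized X} := by
    ext x
    constructor
    · rintro ⟨⟨hxX, hxΔ⟩, hx⟩
      obtain ⟨⟨z', w⟩, rfl⟩ : ∃ p, Δ.param p = x := ⟨_, Δ.param_unparam x⟩
      have hz' : z' = z := by
        funext i
        have := hx i
        rw [coord_param, add_right_inj] at this
        exact mul_left_cancel₀ (Δ.radius_ne_zero _) this
      subst hz'
      exact ⟨w, ⟨hxX, (param_mem_toSet_iff.1 hxΔ).2⟩, rfl⟩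
    · rintro ⟨w, ⟨hwX, hw⟩, rfl⟩
      exact ⟨⟨hwX, param_mem_toSet_iff.2 ⟨hz, hw⟩⟩, fun i => Δ.coord_param _ _⟩
  rw [this, ncard_image_of_injective]
  intro w w' h
  have := congrArg Δ.unparam h
  simp only [unparam_param, Prod.mk.injEq, true_and] at this
  exact this

variable {Ω X : Set (EuclideanSpace ℂ (Fin n))}

/-- A Weierstrass polydisc is proper over a neighbourhood of the closed base. -/
theorem IsWeierstrass.exists_isProperOver (h : Δ.IsWeierstrass Ω X) :
    ∃ G, closedBall 0 1 ⊆ G ∧ IsProperOver G (Δ.normalized X) := by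
  -- `O` is open and contains the closed polydisc; over the base points `z` for which it contains
  -- all `(z, w)` with `‖w‖ ≤ 1`, the set `X` does not approach the boundary of `Δ_w`
  set O : Set ((Fin m → ℂ) × (Fin k → ℂ)) :=
    {p | Δ.param p ∈ Ω ∧ (‖p.2‖ = 1 → Δ.param p ∉ X)} with hO
  have hcont : Continuous Δ.param := Δ.differentiable_param.continuous
  have hnorm : Continuous fun p : (Fin m → ℂ) × (Fin k → ℂ) => ‖p.2‖ := by fun_prop
  have hOo : IsOpen O := by
    rw [isOpen_iff_mem_nhds]
    rintro p ⟨hpΩ, hpX⟩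
    have h1 : ∀ᶠ q in 𝓝 p, Δ.param q ∈ Ω :=
      hcont.continuousAt.eventually (h.isOpen.mem_nhds hpΩ)
    by_cases hp : ‖p.2‖ = 1
    · have h2 := hcont.continuousAt.eventually
        ((h.isAnalytic.isAnalyticSetAt hpΩ).eventually_notMem (hpX hp))
      filter_upwards [h1, h2] with q hq1 hq2 using ⟨hq1, fun _ => hq2⟩
    · have h2 := hnorm.continuousAt.eventually_ne hp
      filter_upwards [h1, h2] with q hq1 hq2 using ⟨hq1, fun hq => absurd hq hq2⟩
  refine ⟨{z | ∀ w ∈ closedBall (0 : Fin k → ℂ) 1, (z, w) ∈ O}, fun z hz w hw => ?_,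
    ?_, fun z hz w => ?_, fun z hz => ?_⟩
  · rw [mem_closedBall_zero_iff] at hz hw
    refine ⟨h.closedSet_subset (param_mem_closedSet hz hw), fun hw1 hX => ?_⟩
    exact (h.inter_wall ▸ ⟨hX, param_mem_wall hz hw1⟩ : Δ.param (z, w) ∈ (∅ : Set _))
  · rw [isOpen_iff_mem_nhds]
    intro z hz
    exact eventually_forall_mem_of_isCompact hOo (isCompact_closedBall 0 1) hz
  · rcases lt_trichotomy ‖w‖ 1 with hw | hw | hw
    · have hO := hz w (mem_closedBall_zero_iff.2 hw.le)
      refine ((h.isAnalytic.isAnalyticSetAt hO.1).preimage Δ.differentiable_param).congr ?_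
      filter_upwards [hnorm.continuousAt.eventually_lt continuousAt_const hw] with q hq
      exact ⟨fun hqX => ⟨hqX, hq⟩, fun hqY => hqY.1⟩
    · have hO := hz w (mem_closedBall_zero_iff.2 hw.le)
      refine (isAnalyticSetAt_empty (z, w)).congr ?_
      filter_upwards [hcont.continuousAt.eventually
        ((h.isAnalytic.isAnalyticSetAt hO.1).eventually_notMem (hO.2 hw))] with q hq
      exact ⟨fun hqe => absurd hqe (notMem_empty q), fun hqY => absurd hqY.1 hq⟩
    · refine (isAnalyticSetAt_empty (z, w)).congr ?_
      filter_upwards [continuousAt_const.eventually_lt hnorm.continuousAt hw] with q hq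
      exact ⟨fun hqe => absurd hqe (notMem_empty q), fun hqY => absurd hqY.2 (not_lt.2 hq.le)⟩
  · exact ⟨1, Eventually.of_forall fun y w hw => hw.2.le⟩

/-- Pure dimensionality: the projection of every neighbourhood in `X ∩ Δ` of one of its points has
an interior point. -/
theorem IsWeierstrass.nonempty_interior_image (h : Δ.IsWeierstrass Ω X)
    (hfin : ∀ z ∈ ball (0 : Fin m → ℂ) 1, {w | (z, w) ∈ Δ.normalized X}.Finite)
    {p : (Fin m → ℂ) × (Fin k → ℂ)} (hp : p ∈ Δ.normalized X) (hp1 : p.1 ∈ ball 0 1)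
    {O : Set ((Fin m → ℂ) × (Fin k → ℂ))} (hO : O ∈ 𝓝 p) :
    (interior (Prod.fst '' (Δ.normalized X ∩ O))).Nonempty := by
  set O' : Set ((Fin m → ℂ) × (Fin k → ℂ)) := interior O ∩ ball 0 1 ×ˢ ball 0 1 with hO'
  have hO'o : IsOpen O' := isOpen_interior.inter (isOpen_ball.prod isOpen_ball)
  have hpO' : p ∈ O' := ⟨mem_interior_iff_mem_nhds.2 hO, hp1, mem_ball_zero_iff.2 hp.2⟩
  have hclos : Δ.param p ∈ closure (regularPoints X m) := (h.isPure _ hp.1).1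
  obtain ⟨q, hqO, hqX, U, hU, hqU, c, hmc, f, hf, hsurj, hXU⟩ := mem_closure_iff.1 hclos
    (Δ.unparam ⁻¹' O') (hO'o.preimage Δ.differentiable_unparam.continuous)
    (by rwa [mem_preimage, unparam_param])
  have hck : c = k := by
    have := Δ.eq_add
    omega
  subst hck
  set U' : Set ((Fin m → ℂ) × (Fin c → ℂ)) := O' ∩ Δ.param ⁻¹' U with hU'
  have hne := nonempty_interior_image_of_submersion (V := Fin c → ℂ) (F := Fin c → ℂ)
    (Y := Δ.normalized X) (U := U') (f := f ∘ Δ.param) rfl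
    (hO'o.inter (hU.preimage Δ.differentiable_param.continuous))
    (hf.comp Δ.differentiable_param.differentiableOn fun x hx => hx.2)
    (fun x hx => by
      rw [fderiv_comp _ (hf.differentiableAt (hU.mem_nhds hx.2)) (Δ.differentiable_param x)]
      exact (hsurj _ hx.2).comp (Δ.surjective_fderiv_param x))
    (fun x hx => by
      have h1 : Δ.param x ∈ X ∩ U ↔ Δ.param x ∈ U ∧ f (Δ.param x) = 0 := by rw [hXU]; rfl
      exact ⟨fun hxY => (h1.1 ⟨hxY.1, hx.2⟩).2,
        fun hfx => ⟨(h1.2 ⟨hx.2, hfx⟩).1, mem_ball_zero_iff.1 hx.1.2.2⟩⟩)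
    (fun x hx => hfin x.1 hx.2.1.2.1)
    ⟨Δ.unparam q, ⟨by rwa [param_unparam], mem_ball_zero_iff.1 hqO.2.2⟩, hqO, by
      rwa [mem_preimage, param_unparam]⟩
  exact hne.mono (interior_mono (image_mono (inter_subset_inter_right _ fun x hx =>
    interior_subset hx.1.1)))

/-- The degree bounds the number of points of every fibre. The numbers of points of the fibres are
bounded, by properness over the closed base; otherwise the supremum that defines the degree would
be `0`. -/
theorem IsWeierstrass.ncard_fiber_le_degree (h : Δ.IsWeierstrass Ω X) {z : Fin m → ℂ}
    (hz : z ∈ ball 0 1) : {w | (z, w) ∈ Δ.normalized X}.ncard ≤ Δ.degree X := by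
  obtain ⟨G, hG, hY⟩ := h.exists_isProperOver
  obtain ⟨C, hC⟩ := hY.exists_ncard_fiber_le_of_isCompact (isCompact_closedBall 0 1) hG
  have hbase : ∀ {z : Fin m → ℂ}, (fun i => Δ.center (Sum.inl i) + Δ.radius (Sum.inl i) * z i) ∈
      Δ.base ↔ ‖z‖ < 1 := by
    intro z
    rw [pi_norm_lt_iff one_pos]
    refine forall_congr' fun i => ?_
    rw [add_sub_cancel_left, norm_mul, Complex.norm_real, Real.norm_eq_abs,
      abs_of_pos (Δ.radius_pos _), mul_lt_iff_lt_one_right (Δ.radius_pos _)]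
  have hbdd : BddAbove (range fun z : Δ.base => (Δ.fiber X z).ncard) := by
    refine ⟨C, ?_⟩
    rintro _ ⟨⟨z, hz⟩, rfl⟩
    obtain ⟨z', rfl⟩ : ∃ z' : Fin m → ℂ,
        (fun i => Δ.center (Sum.inl i) + Δ.radius (Sum.inl i) * z' i) = z := by
      refine ⟨fun i => (Δ.radius (Sum.inl i) : ℂ)⁻¹ * (z i - Δ.center (Sum.inl i)),
          funext fun i => ?_⟩
      rw [mul_inv_cancel_left₀ (Δ.radius_ne_zero _)]
      ring
    have hz' := hbase.1 hz
    dsimp only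
    rw [ncard_fiber X hz']
    exact (hC z' (mem_closedBall_zero_iff.2 hz'.le)).2
  rw [← ncard_fiber X (mem_ball_zero_iff.1 hz)]
  exact le_ciSup hbdd ⟨_, hbase.2 (mem_ball_zero_iff.1 hz)⟩

theorem IsWeierstrass.finite_fiber (h : Δ.IsWeierstrass Ω X) {z : Fin m → ℂ}
    (hz : z ∈ ball 0 1) : {w | (z, w) ∈ Δ.normalized X}.Finite := by
  obtain ⟨G, hG, hY⟩ := h.exists_isProperOver
  obtain ⟨C, hC⟩ := hY.exists_ncard_fiber_le (hG (ball_subset_closedBall hz))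
  exact hC.self_of_nhds.1

/-- The reduction of powers of `wⱼ` on a Weierstrass polydisc. Properness, pure dimension and the
bound for the fibres by the degree are the hypotheses of `IsProperOver.exists_power_reduction`. -/
theorem IsWeierstrass.exists_power_reduction (h : Δ.IsWeierstrass Ω X) (j : Fin k) (q : ℕ) :
    ∃ c : Fin (Δ.degree X) → (Fin m → ℂ) → ℂ, (∀ i, DifferentiableOn ℂ (c i) (ball 0 1)) ∧
      (∀ i, ∀ z ∈ ball 0 1, ‖c i z‖ ≤ 3 ^ q) ∧ ∀ z ∈ ball 0 1, ∀ w, (z, w) ∈ Δ.normalized X →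
        w j ^ q = ∑ i, c i z * w j ^ (i : ℕ) := by
  obtain ⟨G, hG, hY⟩ := h.exists_isProperOver
  exact (hY.mono isOpen_ball (ball_subset_closedBall.trans hG)).exists_power_reduction
    (fun p hp hp1 O hO => h.nonempty_interior_image (fun z hz => h.finite_fiber hz) hp hp1 hO)
    (fun z hz => h.ncard_fiber_le_degree hz) (fun z _ w hw => hw.2.le) j q

theorem IsWeierstrass.inter_eq_empty_of_degree_eq_zero (h : Δ.IsWeierstrass Ω X)
    (hdeg : Δ.degree X = 0) : Δ.pow 2 ∩ X = ∅ := by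
  rw [eq_empty_iff_forall_notMem]
  rintro x ⟨hx, hxX⟩
  obtain ⟨⟨z, w⟩, rfl⟩ : ∃ p, Δ.param p = x := ⟨_, Δ.param_unparam x⟩
  obtain ⟨hz, hw⟩ := norm_le_half_of_param_mem_pow hx
  have hz1 : z ∈ ball (0 : Fin m → ℂ) 1 := mem_ball_zero_iff.2 (hz.trans_lt (by norm_num))
  have h1 := h.ncard_fiber_le_degree hz1
  rw [hdeg, Nat.le_zero, ncard_eq_zero (h.finite_fiber hz1)] at h1
  exact (h1 ▸ (⟨hxX, hw.trans_lt (by norm_num)⟩ : w ∈ {w | (z, w) ∈ Δ.normalized X}) :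
    w ∈ (∅ : Set (Fin k → ℂ)))

end UnitaryPolydisc

end Normalization

/-! ### Choice of the parameters -/

section Parameters

theorem exp_le_three_pow {x : ℝ} {s : ℕ} (h : x ≤ s) : Real.exp x ≤ 3 ^ s := by
  refine (Real.exp_le_exp.2 h).trans ?_
  rw [← Real.exp_one_pow]
  exact pow_le_pow_left₀ (Real.exp_pos _).le Real.exp_one_lt_three.le s

theorem two_thirds_pow_le (s : ℕ) : (2 / 3 : ℝ) ^ (3 * s) ≤ (3 ^ s)⁻¹ := by
  rw [pow_mul, ← inv_pow]
  exact pow_le_pow_left₀ (by positivity) (by norm_num) s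

theorem self_le_three_pow (s : ℕ) : (s : ℝ) ≤ 3 ^ s := by
  exact_mod_cast (Nat.lt_pow_self (by norm_num : 1 < 3)).le

/-- All quantities in the estimate are at most powers of one number `X`; the exponents of the three
small factors exceed those of the large ones by `2`. -/
theorem sum_three_terms_lt_one {X : ℝ} (hX : 3 ≤ X) {n A C₁ C₂ C₃ : ℕ}
    (hC₁ : C₁ = 2 * A + 3 * n + 5) (hC₂ : C₂ = 2 * A + 3 * n + 6 + 6 * n * C₁)
    (hC₃ : C₃ = 6 * n * C₂ + 6 * n * C₁ + 2 * A + 2 * n + 6)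
    {B B' M M' two u v₁ v₂ E F w₁ w₂ : ℝ} (hB : 0 ≤ B) (hB' : 0 ≤ B')
    (hM : 0 ≤ M) (hM' : 0 ≤ M') (htwo : 0 ≤ two) (hu : 0 ≤ u) (hv₁ : 0 ≤ v₁) (hv₂ : 0 ≤ v₂)
    (hE : 0 ≤ E) (hw₁ : 0 ≤ w₁) (hw₂ : 0 ≤ w₂) (hBX : B ≤ X ^ A) (hBX' : B' ≤ X ^ A)
    (hMX : M ≤ X ^ (n + 1)) (hMX' : M' ≤ X ^ (n + 1)) (htX : two ≤ X) (huX : u ≤ X ^ n)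
    (hvX₁ : v₁ ≤ X ^ (6 * n * C₁)) (hvX₂ : v₂ ≤ X ^ (3 * n * C₂)) (hEX : E ≤ X)
    (hFX : F ≤ X ^ (3 * n * C₂)) (hwX₁ : w₁ ≤ (X ^ C₁)⁻¹) (hwX₂ : w₂ ≤ (X ^ C₂)⁻¹)
    {u' : ℝ} (hu' : 0 ≤ u') (huX' : u' ≤ X ^ n) :
    (B * (two * u * M * w₁ + E * (two * u' * (M * v₁) * w₂)) +
      F * E * (two * (B * (M * v₁ * v₂)) / X ^ C₃)) * (B' * M') < 1 := by
  have hX0 : 0 < X := by linarith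
  have key : ∀ {j C : ℕ}, C = j + 2 → X ^ j * (X ^ C)⁻¹ ≤ 1 / 9 := by
    rintro j C rfl
    rw [pow_add, mul_inv, mul_inv_cancel_left₀ (by positivity), inv_le_comm₀ (by positivity)
      (by norm_num)]
    nlinarith
  have h1 : B * (two * u * M * w₁) * (B' * M') ≤ 1 / 9 := by
    calc _ ≤ X ^ A * (X * X ^ n * X ^ (n + 1) * (X ^ C₁)⁻¹) * (X ^ A * X ^ (n + 1)) := by gcongr
      _ = X ^ (2 * A + 3 * n + 3) * (X ^ C₁)⁻¹ := by ring
      _ ≤ _ := key hC₁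
  have h2 : B * (E * (two * u' * (M * v₁) * w₂)) * (B' * M') ≤ 1 / 9 := by
    calc _ ≤ X ^ A * (X * (X * X ^ n * (X ^ (n + 1) * X ^ (6 * n * C₁)) * (X ^ C₂)⁻¹)) *
          (X ^ A * X ^ (n + 1)) := by gcongr
      _ = X ^ (2 * A + 3 * n + 4 + 6 * n * C₁) * (X ^ C₂)⁻¹ := by
          generalize (X ^ C₂)⁻¹ = r
          ring
      _ ≤ _ := key (by omega)
  have h3 : F * E * (two * (B * (M * v₁ * v₂)) / X ^ C₃) * (B' * M') ≤ 1 / 9 := by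
    calc _ ≤ X ^ (3 * n * C₂) * X * (X * (X ^ A * (X ^ (n + 1) * X ^ (6 * n * C₁) *
          X ^ (3 * n * C₂))) / X ^ C₃) * (X ^ A * X ^ (n + 1)) := by gcongr
      _ = X ^ (6 * n * C₂ + 6 * n * C₁ + 2 * A + 2 * n + 4) * (X ^ C₃)⁻¹ := by
          rw [div_eq_mul_inv]
          generalize (X ^ C₃)⁻¹ = r
          ring
      _ ≤ _ := key (by omega)
  linarith

/-- The choice of the parameters: with `D` and `log H` a large multiple of the expected degree and
height there are more integer polynomials than boxes, and the approximation is good enough to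
contradict Liouville's inequality. All exponents are multiples of `t = ⌈T⌉`, where
`T = c * g * E * S ^ (m + 1)` is the order of the logarithm of the factor in Liouville's inequality;
so every quantity in the estimate is compared with a power of `3 ^ t`. -/
theorem exists_parameters (n : ℕ) : ∃ c : ℕ, 1 ≤ c ∧ ∀ (m k e g : ℕ) (S : ℝ), n = m + k →
    1 ≤ e ^ k → 1 ≤ g → 1 + Real.log g ≤ S → ∃ D H N N' L : ℕ, 1 ≤ L ∧ 1 ≤ H ∧
      (D : ℝ) ≤ c * (g * e ^ k * S ^ m) ∧ Real.log H ≤ c * (e ^ k * S ^ (m + 1)) ∧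
      (2 * L + 1) ^ (2 * (N' ^ m * e ^ k)) < (H + 1) ^ ((D + 1) ^ (m + 1)) ∧
      ∀ d ≤ g, ((D + 1) ^ (m + 1) * H * (2 * 3 ^ k * Real.exp S ^ ((m + 1) * D) * (2 / 3) ^ N +
          e ^ k * (2 * 3 ^ m * (Real.exp S ^ ((m + 1) * D) * 4 ^ (k * N)) * (2 / 3) ^ N')) +
        N' ^ m * e ^ k * (2 * ((D + 1) ^ (m + 1) * H *
          (Real.exp S ^ ((m + 1) * D) * 4 ^ (k * N) * (4 / 3) ^ (m * N'))) / L)) *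
        (((D + 1) ^ (m + 1) * H) ^ d * Real.exp (D * ((m + 1) * S))) < 1 := by
  -- `(D + 1) ^ (m + 1) * H` is at most `exp (A * a)`, where `a = c * E * S ^ (m + 1)`. The
  -- constants `C₁`, `C₂`, `C₃` belong to the orders of the expansions in `w` and in `z` and to the
  -- size of the boxes; each makes up for the factors of the previous ones. They depend on `n` only,
  -- and `c` is chosen last, to ensure that there are more polynomials than boxes.
  obtain ⟨A, hA⟩ : ∃ A, A = (n + 1) * (n + 4) + 1 := ⟨_, rfl⟩
  obtain ⟨C₁, hC₁⟩ : ∃ C₁, C₁ = 2 * A + 3 * n + 5 := ⟨_, rfl⟩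
  obtain ⟨C₂, hC₂⟩ : ∃ C₂, C₂ = 2 * A + 3 * n + 6 + 6 * n * C₁ := ⟨_, rfl⟩
  obtain ⟨C₃, hC₃⟩ : ∃ C₃, C₃ = 6 * n * C₂ + 6 * n * C₁ + 2 * A + 2 * n + 6 := ⟨_, rfl⟩
  obtain ⟨c, hc⟩ : ∃ c, c = 4 * (C₃ + 1) * (3 * C₂) ^ n * 2 ^ (n + 1) + 1 := ⟨_, rfl⟩
  have hc1 : 1 ≤ c := by omega
  refine ⟨c, hc1, fun m k e g S hn hE hg hS => ?_⟩
  obtain ⟨E, hEdef⟩ : ∃ E : ℝ, E = (e : ℝ) ^ k := ⟨_, rfl⟩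
  have hE1 : 1 ≤ E := by rw [hEdef]; exact_mod_cast hE
  have hg1 : (1 : ℝ) ≤ g := by exact_mod_cast hg
  have hc1' : (1 : ℝ) ≤ c := by exact_mod_cast hc1
  have hlogg : 0 ≤ Real.log g := Real.log_nonneg hg1
  have hS1 : 1 ≤ S := by linarith
  have hS0 : 0 < S := by linarith
  have hSm : 1 ≤ S ^ m := one_le_pow₀ hS1
  have hSm1 : S ≤ S ^ (m + 1) := le_self_pow₀ hS1 (Nat.succ_ne_zero m)
  obtain ⟨a, ha⟩ : ∃ a : ℝ, a = c * (E * S ^ (m + 1)) := ⟨_, rfl⟩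
  have hES : 1 ≤ E * S ^ (m + 1) := one_le_mul_of_one_le_of_one_le hE1 (hS1.trans hSm1)
  have hca : (c : ℝ) ≤ a := by rw [ha]; exact le_mul_of_one_le_right (by linarith) hES
  have hEa : E ≤ a := by
    rw [ha]
    exact (le_mul_of_one_le_right (by linarith) (hS1.trans hSm1)).trans
      (le_mul_of_one_le_left (by linarith) hc1')
  have hSa : S ≤ a := by
    rw [ha]
    exact hSm1.trans ((le_mul_of_one_le_left (by linarith) hE1).trans
      (le_mul_of_one_le_left (by linarith) hc1'))
  have ha1 : 1 ≤ a := hc1'.trans hca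
  obtain ⟨T, hT⟩ : ∃ T : ℝ, T = g * a := ⟨_, rfl⟩
  have haT : a ≤ T := by rw [hT]; exact le_mul_of_one_le_left (by linarith) hg1
  have hT1 : 1 ≤ T := ha1.trans haT
  obtain ⟨t, ht⟩ : ∃ t : ℕ, t = ⌈T⌉₊ := ⟨_, rfl⟩
  have hTt : T ≤ t := by rw [ht]; exact Nat.le_ceil T
  have htT : (t : ℝ) ≤ 2 * T := by
    have := Nat.ceil_lt_add_one (show 0 ≤ T by linarith)
    rw [← ht] at this
    linarith
  have ht1 : 1 ≤ t := by exact_mod_cast hT1.trans hTt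
  have hmn : (m : ℝ) ≤ n := by exact_mod_cast (by omega : m ≤ n)
  have hmn' : m ≤ n := by omega
  have hkn : k ≤ n := by omega
  -- the degree and the height
  obtain ⟨D, hD⟩ : ∃ D : ℕ, D = ⌊c * (g * E * S ^ m)⌋₊ := ⟨_, rfl⟩
  have hD0 : (1 : ℝ) ≤ c * (g * E * S ^ m) :=
    one_le_mul_of_one_le_of_one_le hc1' (one_le_mul_of_one_le_of_one_le
      (one_le_mul_of_one_le_of_one_le hg1 hE1) hSm)
  have hDle : (D : ℝ) ≤ c * (g * E * S ^ m) := by rw [hD]; exact Nat.floor_le (by linarith)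
  have hDlt : c * (g * E * S ^ m) < (D : ℝ) + 1 := by rw [hD]; exact Nat.lt_floor_add_one _
  have hDS : D * S ≤ T := by
    calc D * S ≤ c * (g * E * S ^ m) * S := by gcongr
      _ = T := by rw [hT, ha]; ring
  obtain ⟨H, hH⟩ : ∃ H : ℕ, H = ⌊Real.exp a⌋₊ := ⟨_, rfl⟩
  have hHle : (H : ℝ) ≤ Real.exp a := by rw [hH]; exact Nat.floor_le (Real.exp_pos a).le
  have hHlt : Real.exp a < (H : ℝ) + 1 := by rw [hH]; exact Nat.lt_floor_add_one _
  have hH1 : 1 ≤ H := by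
    rw [hH, Nat.one_le_floor_iff]
    exact Real.one_le_exp (by linarith)
  have hH0 : (0 : ℝ) < H := by exact_mod_cast hH1
  -- as `D` is linear in `g`, this depends on `g ≤ exp S`
  have hDexp : (D + 1 : ℝ) ≤ Real.exp ((n + 4) * a) := by
    have hle : ∀ x : ℝ, x ≤ Real.exp x := fun x => by linarith [Real.add_one_le_exp x]
    have hgS : (g : ℝ) ≤ Real.exp S := by
      rw [← Real.exp_log (show (0 : ℝ) < g by linarith)]
      exact Real.exp_le_exp.2 (by linarith)
    calc (D + 1 : ℝ) ≤ 2 * (c * (g * E * S ^ m)) := by linarith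
      _ ≤ Real.exp 1 * (Real.exp c * (Real.exp S * Real.exp E * Real.exp S ^ m)) := by
          gcongr
          · linarith [Real.add_one_le_exp (1 : ℝ)]
          · exact hle _
          · exact hle _
          · exact hle _
      _ = Real.exp (1 + (c + (S + E + m * S))) := by
          rw [← Real.exp_nat_mul, ← Real.exp_add, ← Real.exp_add, ← Real.exp_add, ← Real.exp_add]
      _ ≤ Real.exp ((n + 4) * a) := by
          refine Real.exp_le_exp.2 ?_
          have : m * S ≤ n * a := by gcongr
          linarith
  obtain ⟨B, hB⟩ : ∃ B : ℝ, B = ((D : ℝ) + 1) ^ (m + 1) * H := ⟨_, rfl⟩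
  have hB0 : 0 ≤ B := by rw [hB]; positivity
  have hBexp : B ≤ Real.exp (A * a) := by
    calc B ≤ Real.exp ((n + 4) * a) ^ (m + 1) * Real.exp a := by rw [hB]; gcongr
      _ ≤ Real.exp ((n + 4) * a) ^ (n + 1) * Real.exp a := by
          gcongr
          exact Real.one_le_exp (by positivity)
      _ = Real.exp (A * a) := by
          rw [← Real.exp_nat_mul, ← Real.exp_add, hA]
          push_cast
          ring_nf
  have hBpow : ∀ d ≤ g, B ^ d ≤ 3 ^ (A * t) := by
    intro d hd
    calc B ^ d ≤ Real.exp (A * a) ^ d := by gcongr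
      _ = Real.exp (d * (A * a)) := (Real.exp_nat_mul _ _).symm
      _ ≤ 3 ^ (A * t) := by
          refine exp_le_three_pow ?_
          have hdg : (d : ℝ) ≤ g := by exact_mod_cast hd
          calc (d : ℝ) * (A * a) ≤ g * (A * a) := by gcongr
            _ = A * T := by rw [hT]; ring
            _ ≤ _ := by push_cast; gcongr
  have hMexp : Real.exp (D * ((m + 1) * S)) ≤ 3 ^ ((n + 1) * t) := by
    refine exp_le_three_pow ?_
    calc (D : ℝ) * ((m + 1) * S) = (m + 1) * (D * S) := by ring
      _ ≤ (n + 1) * t := by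
          gcongr
          exact hDS.trans hTt
      _ = _ := by push_cast; ring
  have hMpow : Real.exp S ^ ((m + 1) * D) ≤ 3 ^ ((n + 1) * t) := by
    refine le_trans (le_of_eq ?_) hMexp
    rw [← Real.exp_nat_mul]
    push_cast
    ring_nf
  have hX3 : (3 : ℝ) ≤ 3 ^ t := le_self_pow₀ (by norm_num) (by omega)
  have h13 : (1 : ℝ) ≤ 3 := by norm_num
  refine ⟨D, H, 3 * (C₁ * t), 3 * (C₂ * t), 3 ^ (C₃ * t), Nat.one_le_pow _ _ (by norm_num), hH1,
    hEdef ▸ hDle, ?_, ?_, fun d hd => ?_⟩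
  · rw [← hEdef, ← ha]
    exact (Real.log_le_iff_le_exp hH0).2 hHle
  · have hlog3 : (3 : ℝ) ≤ Real.exp 2 := by linarith [Real.add_one_le_exp (2 : ℝ)]
    have hgoal : ((2 * 3 ^ (C₃ * t) + 1 : ℝ)) ^ (2 * ((3 * (C₂ * t)) ^ m * e ^ k)) <
        ((H : ℝ) + 1) ^ ((D + 1) ^ (m + 1)) := by
      have h2L : (2 * 3 ^ (C₃ * t) + 1 : ℝ) ≤ Real.exp (2 * ((C₃ + 1) * t)) := by
        calc (2 * 3 ^ (C₃ * t) + 1 : ℝ) ≤ 3 ^ (C₃ * t) * 3 := by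
              have : (1 : ℝ) ≤ 3 ^ (C₃ * t) := one_le_pow₀ h13
              linarith
          _ ≤ 3 ^ (C₃ * t) * 3 ^ t := by gcongr
          _ = 3 ^ ((C₃ + 1) * t) := by rw [← pow_add]; ring_nf
          _ ≤ Real.exp 2 ^ ((C₃ + 1) * t) := by gcongr
          _ = _ := by
              rw [← Real.exp_nat_mul]
              push_cast
              ring_nf
      -- the number of boxes against the number of polynomials, in logarithms: `T ^ (m + 1)` on
      -- both sides, so that the constant `c` decides
      have hcount : 2 * ((C₃ + 1) * (t : ℝ)) * (2 * ((3 * (C₂ * t)) ^ m * E)) <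
          a * (c * (g * E * S ^ m)) ^ (m + 1) := by
        have h1 : a * (c * (g * E * S ^ m)) ^ (m + 1) = c * (E * T ^ (m + 1)) := by
          rw [hT, ha]
          ring
        have hET : 0 < E * T ^ (m + 1) := by positivity
        have hC₂1 : (1 : ℝ) ≤ 3 * C₂ := by exact_mod_cast (by omega : 1 ≤ 3 * C₂)
        rw [h1]
        calc 2 * ((C₃ + 1) * (t : ℝ)) * (2 * ((3 * (C₂ * t)) ^ m * E)) =
              4 * (C₃ + 1) * (3 * C₂) ^ m * (E * (t : ℝ) ^ (m + 1)) := by ring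
          _ ≤ 4 * (C₃ + 1) * (3 * C₂) ^ n * (E * (2 * T) ^ (m + 1)) := by gcongr
          _ = 4 * (C₃ + 1) * (3 * C₂) ^ n * 2 ^ (m + 1) * (E * T ^ (m + 1)) := by ring
          _ ≤ 4 * (C₃ + 1) * (3 * C₂) ^ n * 2 ^ (n + 1) * (E * T ^ (m + 1)) := by
              gcongr
              norm_num
          _ < c * (E * T ^ (m + 1)) := by
              refine mul_lt_mul_of_pos_right ?_ hET
              rw [hc]
              push_cast
              linarith
      calc ((2 * 3 ^ (C₃ * t) + 1 : ℝ)) ^ (2 * ((3 * (C₂ * t)) ^ m * e ^ k)) ≤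
            Real.exp (2 * ((C₃ + 1) * t)) ^ (2 * ((3 * (C₂ * t)) ^ m * e ^ k)) := by gcongr
        _ = Real.exp (2 * ((C₃ + 1) * (t : ℝ)) * (2 * ((3 * (C₂ * t)) ^ m * E))) := by
            rw [← Real.exp_nat_mul, hEdef]
            push_cast
            ring_nf
        _ < Real.exp (a * (c * (g * E * S ^ m)) ^ (m + 1)) := Real.exp_lt_exp.2 hcount
        _ ≤ Real.exp (((D + 1) ^ (m + 1) : ℕ) * a) := by
            refine Real.exp_le_exp.2 ?_
            rw [mul_comm]
            push_cast
            gcongr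
        _ = Real.exp a ^ ((D + 1) ^ (m + 1)) := Real.exp_nat_mul _ _
        _ ≤ _ := by gcongr
    exact_mod_cast hgoal
  · have hpow : ∀ {r s : ℕ} {x : ℝ}, 0 ≤ x → x ≤ 3 ^ r → r ≤ t * s → x ≤ ((3 : ℝ) ^ t) ^ s := by
      intro r s x _ hx hrs
      rw [← pow_mul]
      exact hx.trans (pow_le_pow_right₀ h13 hrs)
    rw [← hEdef, ← hB]
    push_cast
    rw [show (3 : ℝ) ^ (C₃ * t) = (3 ^ t) ^ C₃ by rw [← pow_mul, mul_comm]]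
    refine sum_three_terms_lt_one (n := n) (A := A) hX3 hC₁ hC₂ hC₃ hB0 (by positivity)
      (by positivity) (by positivity) (by positivity) (by positivity) (by positivity)
      (by positivity) (by linarith) (by positivity) (by positivity) ?_ ?_ ?_ ?_ ?_ ?_
      ?_ ?_ ?_ ?_ ?_ ?_ (by positivity) ?_
    · have := hBpow 1 hg
      rw [pow_one] at this
      exact hpow hB0 this (by rw [mul_comm])
    · exact hpow (by positivity) (hBpow d hd) (by rw [mul_comm])
    · exact hpow (by positivity) hMpow (by rw [mul_comm])
    · exact hpow (by positivity) hMexp (by rw [mul_comm])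
    · linarith
    · exact hpow (by positivity) le_rfl (hkn.trans (Nat.le_mul_of_pos_left n ht1))
    · refine hpow (r := 2 * (k * (3 * (C₁ * t)))) (by positivity) ?_ ?_
      · rw [pow_mul (3 : ℝ) 2]
        exact pow_le_pow_left₀ (by norm_num) (by norm_num) _
      · calc 2 * (k * (3 * (C₁ * t))) ≤ 2 * (n * (3 * (C₁ * t))) := by gcongr
          _ = _ := by ring
    · refine hpow (r := m * (3 * (C₂ * t))) (by positivity) ?_ ?_
      · exact pow_le_pow_left₀ (by norm_num) (by norm_num) _
      · calc m * (3 * (C₂ * t)) ≤ n * (3 * (C₂ * t)) := by gcongr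
          _ = _ := by ring
    · calc E ≤ t := hEa.trans (haT.trans hTt)
        _ ≤ _ := self_le_three_pow t
    · refine hpow (r := m * (3 * (C₂ * t))) (by positivity) ?_ ?_
      · rw [mul_comm m, pow_mul]
        refine pow_le_pow_left₀ (by positivity) ?_ _
        exact_mod_cast self_le_three_pow (3 * (C₂ * t))
      · calc m * (3 * (C₂ * t)) ≤ n * (3 * (C₂ * t)) := by gcongr
          _ = _ := by ring
    · refine (two_thirds_pow_le _).trans_eq ?_
      rw [← pow_mul, mul_comm t]
    · refine (two_thirds_pow_le _).trans_eq ?_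
      rw [← pow_mul, mul_comm t]
    · exact hpow (by positivity) le_rfl (hmn'.trans (Nat.le_mul_of_pos_left n ht1))

end Parameters

/-! ### Integer polynomials with given coefficients -/

section IntegerPolynomials

open MvPolynomial

variable {l : ℕ}

/-- For `P = 0` this holds because `Real.log 0 = 0`. -/
theorem polyHeight_le_log {P : MvPolynomial (Fin l) ℤ} {B : ℕ} (hB : 1 ≤ B)
    (h : ∀ s, |P.coeff s| ≤ B) : polyHeight P ≤ Real.log B := by
  have hsup : (P.support.sup fun s => (P.coeff s).natAbs) ≤ B :=
    Finset.sup_le fun s _ => by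
      have := h s
      rw [Int.abs_eq_natAbs] at this
      exact_mod_cast this
  rw [polyHeight]
  rcases Nat.eq_zero_or_pos (P.support.sup fun s => (P.coeff s).natAbs) with h0 | h0
  · rw [h0, Nat.cast_zero, Real.log_zero]
    exact Real.log_nonneg (by exact_mod_cast hB)
  · exact Real.log_le_log (by exact_mod_cast h0) (by exact_mod_cast hsup)

theorem log_le_polyHeight {P : MvPolynomial (Fin l) ℤ} {B : ℕ} (hB : 1 ≤ B) {s : Fin l →₀ ℕ}
    (h : B ≤ |P.coeff s|) : Real.log B ≤ polyHeight P := by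
  have h1 : B ≤ (P.coeff s).natAbs := by
    rw [Int.abs_eq_natAbs] at h
    exact_mod_cast h
  have hs : s ∈ P.support := by
    rw [mem_support_iff]
    intro h0
    rw [h0, Int.natAbs_zero] at h1
    omega
  refine Real.log_le_log (by exact_mod_cast hB) ?_
  exact_mod_cast h1.trans (Finset.le_sup (f := fun s => (P.coeff s).natAbs) hs)

/-- The polynomial with coefficients `p γ`, all exponents being at most `D`. -/
noncomputable def polynomialOfCoeffs {D : ℕ} (p : (Fin l → Fin (D + 1)) → ℤ) :
    MvPolynomial (Fin l) ℤ :=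
  ∑ γ, monomial (Finsupp.equivFunOnFinite.symm fun i => (γ i : ℕ)) (p γ)

variable {D : ℕ} (p : (Fin l → Fin (D + 1)) → ℤ)

theorem aeval_polynomialOfCoeffs (y : Fin l → ℂ) :
    aeval y (polynomialOfCoeffs p) = ∑ γ, (p γ : ℂ) * ∏ i, y i ^ (γ i : ℕ) := by
  rw [polynomialOfCoeffs, map_sum]
  refine Finset.sum_congr rfl fun γ _ => ?_
  rw [aeval_monomial, Finsupp.prod_fintype _ _ fun i => pow_zero _]
  rfl

theorem exponent_injective : Function.Injective fun γ : Fin l → Fin (D + 1) =>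
    (Finsupp.equivFunOnFinite.symm fun i => (γ i : ℕ) : Fin l →₀ ℕ) := by
  intro γ γ' h
  funext i
  exact Fin.ext (DFunLike.congr_fun h i)

theorem coeff_polynomialOfCoeffs (γ : Fin l → Fin (D + 1)) :
    (polynomialOfCoeffs p).coeff (Finsupp.equivFunOnFinite.symm fun i => (γ i : ℕ)) = p γ := by
  classical
  rw [polynomialOfCoeffs, coeff_sum, Finset.sum_eq_single γ]
  · rw [coeff_monomial, if_pos rfl]
  · intro γ' _ hne
    rw [coeff_monomial, if_neg]
    exact fun h => hne (exponent_injective h)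
  · simp

theorem abs_coeff_polynomialOfCoeffs_le {H : ℕ} (hp : ∀ γ, |p γ| ≤ H) (s : Fin l →₀ ℕ) :
    |(polynomialOfCoeffs p).coeff s| ≤ H := by
  classical
  by_cases h : ∃ γ : Fin l → Fin (D + 1), Finsupp.equivFunOnFinite.symm (fun i => (γ i : ℕ)) = s
  · obtain ⟨γ, rfl⟩ := h
    rw [coeff_polynomialOfCoeffs]
    exact hp γ
  · rw [polynomialOfCoeffs, coeff_sum, Finset.sum_eq_zero, abs_zero]
    · positivity
    · intro γ _
      rw [coeff_monomial, if_neg]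
      exact fun h' => h ⟨γ, h'⟩

theorem totalDegree_polynomialOfCoeffs_le : (polynomialOfCoeffs p).totalDegree ≤ l * D := by
  refine totalDegree_finsetSum_le fun γ _ => ?_
  refine (totalDegree_monomial_le _ _).trans ?_
  rw [Finsupp.sum_fintype _ _ fun _ => rfl]
  calc _ ≤ ∑ _i : Fin l, D := Finset.sum_le_sum fun i _ => Nat.lt_succ_iff.1 (γ i).is_lt
    _ = l * D := by simp

/-- Multiplication by `2 ^ b * y₀ ^ a` makes the degree and the height of a polynomial at least
`a` and `b * log 2`, and increases them by no more than this. -/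
theorem exists_padding {l : ℕ} {P : MvPolynomial (Fin (l + 1)) ℤ} (hP : P ≠ 0) {H : ℕ} (hH : 1 ≤ H)
    (hPH : ∀ s, |P.coeff s| ≤ H) (a b : ℕ) : ∃ P' : MvPolynomial (Fin (l + 1)) ℤ, P' ≠ 0 ∧
      (∀ y : Fin (l + 1) → ℂ, aeval y P = 0 → aeval y P' = 0) ∧
      P'.totalDegree = a + P.totalDegree ∧ b * Real.log 2 ≤ polyHeight P' ∧
      polyHeight P' ≤ b * Real.log 2 + Real.log H := by
  classical
  have h2 : ((2 : ℤ) ^ b) ≠ 0 := by positivity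
  have hmon : monomial (Finsupp.single (0 : Fin (l + 1)) a) ((2 : ℤ) ^ b) ≠ 0 :=
    fun h => h2 (monomial_eq_zero.1 h)
  refine ⟨monomial (Finsupp.single 0 a) (2 ^ b) * P,
      mul_ne_zero hmon hP, fun y hy => ?_, ?_, ?_, ?_⟩
  · rw [map_mul, hy, mul_zero]
  · rw [totalDegree_mul_of_isDomain hmon hP,
        totalDegree_monomial _ h2, Finsupp.sum_single_index rfl]
  · obtain ⟨s, hs⟩ := ne_zero_iff.1 hP
    have hB : 1 ≤ 2 ^ b := Nat.one_le_two_pow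
    have := log_le_polyHeight (P := monomial (Finsupp.single 0 a) (2 ^ b) * P) hB
      (s := Finsupp.single 0 a + s) (by
        rw [coeff_monomial_mul, abs_mul, abs_of_pos (by positivity : (0 : ℤ) < 2 ^ b)]
        push_cast
        exact le_mul_of_one_le_right (by positivity) (Int.one_le_abs hs))
    rwa [Nat.cast_pow, Real.log_pow, Nat.cast_ofNat] at this
  · have hB : 1 ≤ 2 ^ b * H := Nat.one_le_iff_ne_zero.2 (by positivity)
    have := polyHeight_le_log (P := monomial (Finsupp.single 0 a) (2 ^ b) * P) hB (fun s => by
      rw [coeff_monomial_mul']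
      split_ifs
      · rw [abs_mul, abs_of_pos (by positivity : (0 : ℤ) < 2 ^ b)]
        push_cast
        gcongr
        exact hPH _
      · rw [abs_zero]
        positivity)
    have hH0 : (H : ℝ) ≠ 0 := by exact_mod_cast (by omega : H ≠ 0)
    rwa [Nat.cast_mul, Nat.cast_pow, Real.log_mul (by positivity) hH0, Real.log_pow,
      Nat.cast_ofNat] at this

end IntegerPolynomials

/-! ### Polynomials vanishing at algebraic points -/

section WeierstrassPolydisc

/-- If `p` takes tiny values on `X ∩ Δ²`, it vanishes at the algebraic points of bounded degree and
height, by Liouville's inequality; the existence of such a `p` is the box principle. -/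
theorem UnitaryPolydisc.IsWeierstrass.exists_vanishing_polynomial {n m k : ℕ}
    {Δ : UnitaryPolydisc n m k} {Ω X : Set (EuclideanSpace ℂ (Fin n))} (hΔ : Δ.IsWeierstrass Ω X)
    {Φ : EuclideanSpace ℂ (Fin n) → Fin (m + 1) → ℂ} (hΦ : DifferentiableOn ℂ Φ Δ.toSet)
    {g : ℕ} {h S : ℝ} (hh : 0 ≤ h) (hΦS : ∀ x ∈ Δ.toSet, ‖Φ x‖ ≤ Real.exp S) (hS : 0 ≤ S)
    (hghS : g * h ≤ S) {D H N N' L : ℕ} (hL : 1 ≤ L)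
    (hcard : (2 * L + 1) ^ (2 * (N' ^ m * Δ.degree X ^ k)) < (H + 1) ^ ((D + 1) ^ (m + 1)))
    (hsmall : ∀ d ≤ g, ((D + 1) ^ (m + 1) * H *
        (2 * 3 ^ k * Real.exp S ^ ((m + 1) * D) * (2 / 3) ^ N + Δ.degree X ^ k *
          (2 * 3 ^ m * (Real.exp S ^ ((m + 1) * D) * 4 ^ (k * N)) * (2 / 3) ^ N')) +
        N' ^ m * Δ.degree X ^ k * (2 * ((D + 1) ^ (m + 1) * H *
          (Real.exp S ^ ((m + 1) * D) * 4 ^ (k * N) * (4 / 3) ^ (m * N'))) / L)) *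
        (((D + 1) ^ (m + 1) * H) ^ d * Real.exp (D * ((m + 1) * S))) < 1) :
    ∃ p : (Fin (m + 1) → Fin (D + 1)) → ℤ, p ≠ 0 ∧ (∀ γ, |p γ| ≤ H) ∧
      ∀ x ∈ algebraicPoints (Δ.pow 2 ∩ X) g h Φ, ∑ γ, (p γ : ℂ) * ∏ i, Φ x i ^ (γ i : ℕ) = 0 := by
  have hmaps : MapsTo Δ.param (ball 0 1 ×ˢ ball 0 1) Δ.toSet := fun p hp =>
    UnitaryPolydisc.param_mem_toSet_iff.2 ⟨mem_ball_zero_iff.1 hp.1, mem_ball_zero_iff.1 hp.2⟩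
  obtain ⟨p, hp0, hpH, hp⟩ := exists_int_polynomial_small hΔ.exists_power_reduction
    (Φ := Φ ∘ Δ.param) (hΦ.comp Δ.differentiable_param.differentiableOn hmaps) (Real.one_le_exp hS)
    (fun q hq => hΦS _ (hmaps hq)) D H N N' hL hcard
  refine ⟨p, hp0, hpH, ?_⟩
  rintro x ⟨⟨hx, hxX⟩, halg, hdeg, hheight⟩
  obtain ⟨⟨z, w⟩, rfl⟩ : ∃ q, Δ.param q = x := ⟨_, Δ.param_unparam x⟩
  obtain ⟨hz, hw⟩ := UnitaryPolydisc.norm_le_half_of_param_mem_pow hx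
  by_contra hne
  have hlower := one_le_norm_mul_of_ne_zero halg hpH hne
  have hupper := hp z w ⟨hxX, hw.trans_lt (by norm_num)⟩ hz hw
  simp only [Function.comp_apply] at hupper
  set d := fieldDegree (Φ (Δ.param (z, w))) with hd
  have hsum : (d : ℝ) * ∑ i, weilHeight (Φ (Δ.param (z, w)) i) ≤ (m + 1) * S := by
    have h1 : ∑ i, weilHeight (Φ (Δ.param (z, w)) i) ≤ (m + 1) * h := by
      refine (Finset.sum_le_card_nsmul _ _ h fun i _ => ?_).trans_eq (by simp)
      refine le_trans ?_ hheight
      exact le_ciSup (f := fun i => weilHeight (Φ (Δ.param (z, w)) i)) (finite_range _).bddAbove i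
    have hdg : (d : ℝ) ≤ g := by exact_mod_cast hdeg
    calc (d : ℝ) * ∑ i, weilHeight (Φ (Δ.param (z, w)) i) ≤ d * ((m + 1) * h) := by gcongr
      _ ≤ g * ((m + 1) * h) := by gcongr
      _ = (m + 1) * (g * h) := by ring
      _ ≤ (m + 1) * S := by gcongr
  refine absurd (hsmall d hdeg) (not_lt.2 (hlower.trans ?_))
  gcongr

end WeierstrassPolydisc

/-! ### Algebraic points on an analytic set -/

theorem mainTheorem10 (n : ℕ) :
    ∃ K : ℝ, 0 < K ∧
      ∀ (m k : ℕ) (Ω X : Set (EuclideanSpace ℂ (Fin n))) (Δ : UnitaryPolydisc n m k)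
        (_ : Δ.IsWeierstrass Ω X)
        (Φ : EuclideanSpace ℂ (Fin n) → Fin (m + 1) → ℂ)
        (_ : DifferentiableOn ℂ Φ Δ.toSet)
        (_ : BddAbove ((fun x => ‖Φ x‖) '' Δ.toSet))
        (g : ℕ) (h : ℝ) (_ : 1 ≤ g) (_ : 0 ≤ h)
        (E : ℕ) (_ : E = Δ.degree X ^ k)
        (S : ℝ) (_ : S = g * h + Real.posLog (supNorm Δ.toSet Φ))
        (_ : 1 + Real.log g ≤ S),
        ∃ P : MvPolynomial (Fin (m + 1)) ℤ, P ≠ 0 ∧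
          (∀ x ∈ algebraicPoints (Δ.pow 2 ∩ X) g h Φ, MvPolynomial.aeval (Φ x) P = 0) ∧
          (K⁻¹ * (g * E * S ^ m) ≤ P.totalDegree ∧ (P.totalDegree : ℝ) ≤ K * (g * E * S ^ m)) ∧
          (K⁻¹ * (E * S ^ (m + 1)) ≤ polyHeight P ∧ polyHeight P ≤ K * (E * S ^ (m + 1))) := by
  obtain ⟨c, hc1, hpar⟩ := exists_parameters n
  have hc1' : (1 : ℝ) ≤ c := by exact_mod_cast hc1
  have hn0 : (0 : ℝ) ≤ n := Nat.cast_nonneg n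
  have hK : 2 + c ≤ 2 + ((n : ℝ) + 1) * c := by nlinarith
  -- the polynomial of the box principle contributes `(n + 1) * c` to the degree and `c` to the
  -- height, the padding at most `2`, rounding included
  refine ⟨2 + (n + 1) * c, by positivity, ?_⟩
  intro m k Ω X Δ hΔ Φ hΦ hbdd g h hg hh E hE S hS hgS
  have hg1 : (1 : ℝ) ≤ g := by exact_mod_cast hg
  have hS1 : 1 ≤ S := by linarith [Real.log_nonneg hg1]
  rcases Nat.eq_zero_or_pos E with hE0 | hE0
  · -- the covering has no sheets, so there are no points
    have hempty := hΔ.inter_eq_empty_of_degree_eq_zero (eq_zero_of_pow_eq_zero (hE ▸ hE0))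
    refine ⟨1, one_ne_zero, fun x hx => ?_, ?_, ?_⟩
    · exact absurd (hempty ▸ hx.1) (notMem_empty x)
    · simp [hE0]
    · have h1 : polyHeight (1 : MvPolynomial (Fin (m + 1)) ℤ) = 0 := by
        refine le_antisymm ((polyHeight_le_log le_rfl fun s => ?_).trans_eq (by simp)) ?_
        · rw [MvPolynomial.coeff_one]
          split_ifs <;> simp
        · exact Real.log_natCast_nonneg _
      simp [hE0, h1]
  · have hE1 : (1 : ℝ) ≤ E := by exact_mod_cast hE0
    obtain ⟨D, H, N, N', L, hL, hH, hD, hHlog, hcard, hsmall⟩ :=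
      hpar m k (Δ.degree X) g S Δ.eq_add (hE ▸ hE0) hg hgS
    have hΦS : ∀ x ∈ Δ.toSet, ‖Φ x‖ ≤ Real.exp S := by
      intro x hx
      have h1 : ‖Φ x‖ ≤ supNorm Δ.toSet Φ := by
        rw [image_eq_range] at hbdd
        exact le_ciSup (f := fun x : Δ.toSet => ‖Φ x‖) hbdd ⟨x, hx⟩
      have h2 : Real.posLog (supNorm Δ.toSet Φ) ≤ S := by
        have : 0 ≤ g * h := by positivity
        linarith
      rw [Real.posLog_eq_log_max_one ((norm_nonneg _).trans h1),
        Real.log_le_iff_le_exp (lt_of_lt_of_le one_pos (le_max_left _ _))] at h2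
      exact h1.trans ((le_max_right _ _).trans h2)
    have hghS : g * h ≤ S := by linarith [Real.posLog_nonneg (x := supNorm Δ.toSet Φ)]
    obtain ⟨p, hp0, hpH, hp⟩ := hΔ.exists_vanishing_polynomial hΦ hh hΦS (by linarith) hghS hL hcard
      hsmall
    have hP0 : polynomialOfCoeffs p ≠ 0 := by
      intro h0
      refine hp0 (funext fun γ => ?_)
      rw [← coeff_polynomialOfCoeffs p γ, h0, MvPolynomial.coeff_zero, Pi.zero_apply]
    have hES : 1 ≤ E * S ^ (m + 1) := one_le_mul_of_one_le_of_one_le hE1 (one_le_pow₀ hS1)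
    have hgES : 1 ≤ g * E * S ^ m := one_le_mul_of_one_le_of_one_le
      (one_le_mul_of_one_le_of_one_le hg1 hE1) (one_le_pow₀ hS1)
    -- padding gives the lower bounds
    obtain ⟨P, hP, hPp, hPdeg, hPlow, hPupp⟩ := exists_padding hP0 hH
      (abs_coeff_polynomialOfCoeffs_le p hpH) ⌈g * E * S ^ m⌉₊ ⌈E * S ^ (m + 1)⌉₊
    have ha := Nat.le_ceil ((g : ℝ) * E * S ^ m)
    have ha' := (Nat.ceil_lt_add_one (by linarith : (0 : ℝ) ≤ g * E * S ^ m)).le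
    have hb := Nat.le_ceil ((E : ℝ) * S ^ (m + 1))
    have hb' := (Nat.ceil_lt_add_one (by linarith : (0 : ℝ) ≤ E * S ^ (m + 1))).le
    rw [← Nat.cast_pow, ← hE] at hD hHlog
    have hlog2 : (1 / 2 : ℝ) ≤ Real.log 2 := by linarith [Real.log_two_gt_d9]
    have hlog2' : Real.log 2 ≤ 1 := by linarith [Real.log_two_lt_d9]
    have hKinv : (2 + ((n : ℝ) + 1) * c)⁻¹ ≤ 1 / 2 := by
      rw [inv_le_comm₀ (by positivity) (by norm_num)]
      linarith
    refine ⟨P, hP, fun x hx => hPp _ ((aeval_polynomialOfCoeffs p _).trans (hp x hx)),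
      ⟨?_, ?_⟩, ?_, ?_⟩
    · rw [hPdeg]
      push_cast
      have : (0 : ℝ) ≤ (polynomialOfCoeffs p).totalDegree := Nat.cast_nonneg _
      nlinarith
    · have h1 : ((polynomialOfCoeffs p).totalDegree : ℝ) ≤ (n + 1) * (c * (g * E * S ^ m)) := by
        calc ((polynomialOfCoeffs p).totalDegree : ℝ) ≤ ((m + 1 : ℕ) : ℝ) * D := by
              exact_mod_cast totalDegree_polynomialOfCoeffs_le p
          _ ≤ (n + 1) * (c * (g * E * S ^ m)) := by
              have : ((m + 1 : ℕ) : ℝ) ≤ n + 1 := by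
                exact_mod_cast (by have := Δ.eq_add; omega : m + 1 ≤ n + 1)
              gcongr
      rw [hPdeg]
      push_cast
      linarith
    · refine le_trans ?_ hPlow
      calc (2 + ((n : ℝ) + 1) * c)⁻¹ * (E * S ^ (m + 1)) ≤ 1 / 2 * (E * S ^ (m + 1)) := by gcongr
        _ ≤ Real.log 2 * ⌈E * S ^ (m + 1)⌉₊ := by gcongr
        _ = _ := mul_comm _ _
    · have h1 : (⌈E * S ^ (m + 1)⌉₊ : ℝ) * Real.log 2 ≤ ⌈E * S ^ (m + 1)⌉₊ :=
        mul_le_of_le_one_right (Nat.cast_nonneg _) hlog2'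
      have h2 : (2 + (c : ℝ)) * (E * S ^ (m + 1)) ≤
          (2 + ((n : ℝ) + 1) * c) * (E * S ^ (m + 1)) := by gcongr
      linarith
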